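/- **Problem class.** Let $F_1,\dots,F_M:\mathbb R^d\to\mathbb R$ be the objectives of $M\ge 1$ machines, $F=\frac1M\sum_m F_m$, and let $S_m^\star=\arg\min F_m$. Machine $m$ can draw $z\sim\mathcal D_m$ and observe a stochastic gradient $g_m(x;z)$, jointly measurable in $(x,z)$, with $\mathbb E_{z\sim\mathcal D_m}[g_m(x;z)]=\nabla F_m(x)$. Let $B,\mu,H>0$, $Q,\zeta_\star,\phi_\star,\sigma_2,\sigma_4\ge 0$, $0\le\tau\le 2H$, and suppose: - each $F_m$ is $\mu$-strongly convex, $\nabla F_m$ is $H$-Lipschitz, $F_m$ is $C^2$ and $\nabla^2F_m$ is $Q$-Lipschitz in operator norm; - for $q\in\{2,4\}$ there are $\sigma_{q,m}\ge0$ with $\mathbb E_{z\sim\mathcal D_m}\|g_m(x;z)-\nabla F_m(x)\|^q\le\sigma_{q,m}^q$ for all $x,m$, and $\frac1M\sum_m\sigma_{q,m}^q\le\sigma_q^q$; - the minimizer $x^\star$ of $F$ satisfies $\|x^\star\|\le B$; - with $\zeta_{m,n}=\inf\{\|x-y\|:x\in S_m^\star,y\in S_n^\star\}$, $\frac1{M^2}\sum_{m,n}\zeta_{m,n}^4\le\zeta_\star^4$;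 and $\frac1M\sum_m\operatorname{dist}(x^\star,S_m^\star)^4\le\phi_\star^4$; - $\|\nabla^2F_m(x)-\nabla^2F_n(x)\|\le\tau$ for all $m,n,x$. **Algorithm.** Local SGD with $K\ge1$ local steps, $R\ge1$ rounds and step size $\eta$ starts at $x_0^m=0$. With independent $z_t^m\sim\mathcal D_m$ it sets $x_{t+1}^m=x_t^m-\eta g_m(x_t^m;z_t^m)$ if $K\nmid t+1$, and $x_{t+1}^m=\frac1M\sum_n\big(x_t^n-\eta g_n(x_t^n;z_t^n)\big)$ if $K\mid t+1$. Put $x_t=\frac1M\sum_m x_t^m$. **Rate.** Let $\kappa=H/\mu$, $\kappa'=2+\frac{4Q^2B^2}{\mu^2}+\frac{6H^4}{\mu^4}$, and $$\begin{aligned}S=\;&\frac{\sigma_2^2}{\mu^2MKR}+\frac{\sigma_4^4}{\mu^4K^3R^3M^2B^2}\\&+\kappa'\Big(\frac{\tau^2\phi_\star^2}{\mu^2R^2}+\frac{\tau^4\sigma_4^2\phi_\star^2}{\mu^6KR^5B^2}+\frac{\sigma_2^2\tau^2\phi_\star^2}{\mu^4KR^4B^2}+\frac{\tau^4\phi_\star^4}{\mu^4B^2R^4}+\frac{H^2\zeta_\star^2}{\mu^2R^2}+\frac{\tau^2\sigma_2^2}{\mu^4KR^3}\Big)\\&+\kappa'\Big(\frac{\sigma_2^2\ln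 K}{\mu^2KR^2}+\frac{H^4\zeta_\star^4}{\mu^4R^3B^2}+\frac{\tau^4\sigma_4^4}{\mu^8K^2R^5B^2}+\frac{\sigma_2^2H^2\zeta_\star^2}{\mu^4B^2R^4}+\frac{\tau^2\sigma_2^4}{\mu^6KR^5B^2}+\frac{\sigma_4^4\ln K}{\mu^4KB^2R^4}\Big).\end{aligned}$$ For a target accuracy $\epsilon_t>0$, let $\epsilon$ be the maximum of $\epsilon_t$ and of the fourteen summands of $S$ (those in the brackets multiplied by $\kappa'$), and let $\Lambda=\max\{1,\ln(B^2/\epsilon)\}$. **Theorem.** There are absolute constants $C>0$ and $q\in\mathbb N$ such that the following holds for all parameters as above and all $\epsilon_t>0$ with $$R\ \ge\ \frac{\tau\sqrt{\kappa'}}{\mu}\,\Lambda^2 .$$ There is a step size $\eta\in(0,\frac1{2H}]$, depending only on the parameters and on $\epsilon_t$, and equal to $\min\{\frac1{2H},\frac1{\mu KR}\ln\frac{B^2}{\epsilon}\}$ whenever $B^2>e\epsilon$, such that for every problem of the class (in any dimension) $x_{KR}$ has a finite fourth moment, $$\mathbb E\|x_{KR}-x^\star\|^2+\frac1{B^2}\mathbb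 E\|x_{KR}-x^\star\|^4\ \le\ C\Lambda^q\big(e^{-\eta\mu KR}B^2+S\big),$$ and, if $\epsilon_t\le e^{-KR/\kappa}B^2+S$, $$\mathbb E\|x_{KR}-x^\star\|^2+\frac1{B^2}\mathbb E\|x_{KR}-x^\star\|^4\ \le\ C\Lambda^q\big(e^{-KR/\kappa}B^2+S\big).$$ -/

import Mathlib

open MeasureTheory ProbabilityTheory

noncomputable section

namespace LocalSGD

/-- The parameter space `ℝ^d` with its Euclidean norm. -/
abbrev Space (d : ℕ) : Type := EuclideanSpace ℝ (Fin d)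

/-- The scalar parameters of the problem class and of the communication budget. -/
structure Params where
  /-- number of machines -/
  M : ℕ
  /-- number of local steps per communication round -/
  K : ℕ
  /-- number of communication rounds -/
  R : ℕ
  /-- bound on the norm of the optimum of the average objective -/
  B : ℝ
  /-- strong convexity -/
  μ : ℝ
  /-- second-order smoothness -/
  H : ℝ
  /-- third-order smoothness -/
  Q : ℝ
  /-- second-order heterogeneity -/
  τ : ℝ
  /-- discrepancy between the optima of the machines -/
  ζ : ℝ
  /-- discrepancy between the optima of the machines and of the average -/
  φ : ℝ
  /-- second moment of the gradient noise -/
  σ₂ : ℝ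
  /-- fourth moment of the gradient noise -/
  σ₄ : ℝ

/-- The ranges of the parameters. -/
structure Params.Admissible (p : Params) : Prop where
  M_pos : 0 < p.M
  K_pos : 0 < p.K
  R_pos : 0 < p.R
  B_pos : 0 < p.B
  μ_pos : 0 < p.μ
  H_pos : 0 < p.H
  Q_nonneg : 0 ≤ p.Q
  τ_nonneg : 0 ≤ p.τ
  τ_le : p.τ ≤ 2 * p.H
  ζ_nonneg : 0 ≤ p.ζ
  φ_nonneg : 0 ≤ p.φ
  σ₂_nonneg : 0 ≤ p.σ₂
  σ₄_nonneg : 0 ≤ p.σ₄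

/-- The condition number `κ = H / μ`. -/
def Params.κ (p : Params) : ℝ := p.H / p.μ

/-- `κ' = 2 + 4 Q² B² / μ² + 6 H⁴ / μ⁴`. -/
def Params.κ' (p : Params) : ℝ :=
  2 + 4 * p.Q ^ 2 * p.B ^ 2 / p.μ ^ 2 + 6 * p.H ^ 4 / p.μ ^ 4

/-- The terms of the rate other than the exponentially decaying one. -/
def Params.rateTerms (p : Params) : List ℝ :=
  let M : ℝ := p.M
  let K : ℝ := p.K
  let R : ℝ := p.R
  [ p.σ₂ ^ 2 / (p.μ ^ 2 * M * K * R),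
    p.σ₄ ^ 4 / (p.μ ^ 4 * K ^ 3 * R ^ 3 * M ^ 2 * p.B ^ 2),
    p.κ' * (p.τ ^ 2 * p.φ ^ 2 / (p.μ ^ 2 * R ^ 2)),
    p.κ' * (p.τ ^ 4 * p.σ₄ ^ 2 * p.φ ^ 2 / (p.μ ^ 6 * K * R ^ 5 * p.B ^ 2)),
    p.κ' * (p.σ₂ ^ 2 * p.τ ^ 2 * p.φ ^ 2 / (p.μ ^ 4 * K * R ^ 4 * p.B ^ 2)),
    p.κ' * (p.τ ^ 4 * p.φ ^ 4 / (p.μ ^ 4 * p.B ^ 2 * R ^ 4)),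
    p.κ' * (p.H ^ 2 * p.ζ ^ 2 / (p.μ ^ 2 * R ^ 2)),
    p.κ' * (p.τ ^ 2 * p.σ₂ ^ 2 / (p.μ ^ 4 * K * R ^ 3)),
    p.κ' * (p.σ₂ ^ 2 * Real.log K / (p.μ ^ 2 * K * R ^ 2)),
    p.κ' * (p.H ^ 4 * p.ζ ^ 4 / (p.μ ^ 4 * R ^ 3 * p.B ^ 2)),
    p.κ' * (p.τ ^ 4 * p.σ₄ ^ 4 / (p.μ ^ 8 * K ^ 2 * R ^ 5 * p.B ^ 2)),
    p.κ' * (p.σ₂ ^ 2 * p.H ^ 2 * p.ζ ^ 2 / (p.μ ^ 4 * p.B ^ 2 * R ^ 4)),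
    p.κ' * (p.τ ^ 2 * p.σ₂ ^ 4 / (p.μ ^ 6 * K * R ^ 5 * p.B ^ 2)),
    p.κ' * (p.σ₄ ^ 4 * Real.log K / (p.μ ^ 4 * K * p.B ^ 2 * R ^ 4)) ]

/-- The sum of the terms of the rate other than the exponentially decaying one. -/
def Params.rate (p : Params) : ℝ := p.rateTerms.sum

/-- The accuracy `ε` used to tune the step size: the largest of the terms of the rate and of the
target accuracy `εt`. -/
def Params.accuracy (p : Params) (εt : ℝ) : ℝ := p.rateTerms.foldr max εt

/-- The logarithmic factor `max {1, ln (B² / ε)}` hidden by the soft-O notation. -/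
def Params.logFactor (p : Params) (εt : ℝ) : ℝ :=
  max 1 (Real.log (p.B ^ 2 / p.accuracy εt))

/-- The tuned step size `min {1 / (2H), ln (B² / ε) / (μ K R)}`. -/
def Params.tunedStep (p : Params) (εt : ℝ) : ℝ :=
  min (1 / (2 * p.H)) (1 / (p.μ * p.K * p.R) * Real.log (p.B ^ 2 / p.accuracy εt))

/-- A problem instance: the objective of each machine, its data distribution, and its stochastic
gradient oracle, which on a query `x` samples a datum `z` and returns `g m x z`. -/
structure Problem (d M : ℕ) (Z : Type*) [MeasurableSpace Z] where
  /-- objectives -/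
  F : Fin M → Space d → ℝ
  /-- data distributions -/
  D : Fin M → Measure Z
  /-- stochastic gradients -/
  g : Fin M → Space d → Z → Space d

/-- The set of minimizers of a function. -/
def optima {d : ℕ} (f : Space d → ℝ) : Set (Space d) := {x | IsMinOn f Set.univ x}

/-- The Hessian, as the derivative of the gradient; its norm is the operator norm. -/
def hessian {d : ℕ} (f : Space d → ℝ) (x : Space d) : Space d →L[ℝ] Space d :=
  fderiv ℝ (gradient f) x

namespace Problem

variable {d M : ℕ} {Z : Type*} [MeasurableSpace Z]

/-- The average objective `F = (1/M) ∑ₘ Fₘ`. -/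
def avg (P : Problem d M Z) (x : Space d) : ℝ := (1 / (M : ℝ)) * ∑ m, P.F m x

/-- The oracle draws from probability distributions, is measurable, and is unbiased. -/
def UnbiasedOracle (P : Problem d M Z) : Prop :=
  ∀ m, IsProbabilityMeasure (P.D m) ∧ Measurable (Function.uncurry (P.g m)) ∧
    ∀ x, Integrable (P.g m x) (P.D m) ∧ ∫ z, P.g m x z ∂(P.D m) = gradient (P.F m) x

/-- `μ`-strong convexity of every machine's objective. -/
def StronglyConvex (P : Problem d M Z) (μ : ℝ) : Prop :=
  ∀ m, Differentiable ℝ (P.F m) ∧ ∀ x y : Space d,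
    P.F m x + inner ℝ (gradient (P.F m) x) (y - x) + μ / 2 * ‖x - y‖ ^ 2 ≤ P.F m y

/-- Second-order smoothness. -/
def SmoothSecond (P : Problem d M Z) (H : ℝ) : Prop :=
  ∀ m, Differentiable ℝ (P.F m) ∧ ∀ x y : Space d,
    ‖gradient (P.F m) x - gradient (P.F m) y‖ ≤ H * ‖x - y‖

/-- Third-order smoothness. -/
def SmoothThird (P : Problem d M Z) (Q : ℝ) : Prop :=
  ∀ m, ContDiff ℝ 2 (P.F m) ∧ ∀ x y : Space d,
    ‖hessian (P.F m) x - hessian (P.F m) y‖ ≤ Q * ‖x - y‖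

/-- The gradient noise of machine `m` has `q`-th moment at most `s m ^ q` at every point, and the
average over the machines of `s m ^ q` is at most `σ ^ q`. -/
def NoiseMoment (P : Problem d M Z) (q : ℕ) (σ : ℝ) : Prop :=
  ∃ s : Fin M → ℝ, (∀ m, 0 ≤ s m) ∧ (1 / (M : ℝ)) * ∑ m, s m ^ q ≤ σ ^ q ∧
    ∀ m x, Integrable (fun z => ‖P.g m x z - gradient (P.F m) x‖ ^ q) (P.D m) ∧
      ∫ z, ‖P.g m x z - gradient (P.F m) x‖ ^ q ∂(P.D m) ≤ s m ^ q

/-- The distance between the sets of optima of machines `m` and `n`. -/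
def zetaPair (P : Problem d M Z) (m n : Fin M) : ℝ :=
  sInf ((fun xy : Space d × Space d => ‖xy.1 - xy.2‖) '' (optima (P.F m) ×ˢ optima (P.F n)))

/-- Discrepancy between the machines' optima, as a fourth-power mean. -/
def OptimaDiscrepancy (P : Problem d M Z) (ζ : ℝ) : Prop :=
  (1 / (M : ℝ) ^ 2) * ∑ m, ∑ n, P.zetaPair m n ^ 4 ≤ ζ ^ 4

/-- Discrepancy between the machines' optima and the optimum `xs` of the average objective, as a
fourth-power mean. -/
def AvgOptimaDiscrepancy (P : Problem d M Z) (xs : Space d) (φ : ℝ) : Prop :=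
  (1 / (M : ℝ)) * ∑ m, Metric.infDist xs (optima (P.F m)) ^ 4 ≤ φ ^ 4

/-- Second-order heterogeneity. -/
def HessianHeterogeneity (P : Problem d M Z) (τ : ℝ) : Prop :=
  ∀ m n x, ‖hessian (P.F m) x - hessian (P.F n) x‖ ≤ τ

/-- The vector of local models of vanilla Local SGD after `t` steps with step size `η`, started at
`0`, when machine `m` draws the datum `z t m` at time `t`. The models are averaged whenever the
number of completed steps is a multiple of `K`. -/
def localIterate (P : Problem d M Z) (K : ℕ) (η : ℝ) (z : ℕ → Fin M → Z) :
    ℕ → Fin M → Space d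
  | 0 => fun _ => 0
  | t + 1 => fun m =>
      let x := localIterate P K η z t
      if (t + 1) % K = 0 then
        (1 / (M : ℝ)) • ∑ n, (x n - η • P.g n (x n) (z t n))
      else
        x m - η • P.g m (x m) (z t m)

/-- The average `x_t` of the local models at time `t`. -/
def iterate (P : Problem d M Z) (K : ℕ) (η : ℝ) (z : ℕ → Fin M → Z) (t : ℕ) : Space d :=
  (1 / (M : ℝ)) • ∑ m, P.localIterate K η z t m

end Problem

/-- The instance `P`, with `xs` an optimum of its average objective, belongs to the problem class
with parameters `p`. -/
structure InClass {d : ℕ} {Z : Type*} [MeasurableSpace Z] (p : Params) (P : Problem d p.M Z)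
    (xs : Space d) : Prop where
  oracle : P.UnbiasedOracle
  strongly_convex : P.StronglyConvex p.μ
  smooth_second : P.SmoothSecond p.H
  smooth_third : P.SmoothThird p.Q
  second_moment : P.NoiseMoment 2 p.σ₂
  fourth_moment : P.NoiseMoment 4 p.σ₄
  optimum : xs ∈ optima P.avg
  bounded_optimum : ‖xs‖ ≤ p.B
  optima_discrepancy : P.OptimaDiscrepancy p.ζ
  avg_optima_discrepancy : P.AvgOptimaDiscrepancy xs p.φ
  hessian_heterogeneity : P.HessianHeterogeneity p.τ

/-- `z t m` (time `t`, machine `m`) are independent random data with laws `D m`. -/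
structure IsSampling {M : ℕ} {Z Ω : Type*} [MeasurableSpace Z] [MeasurableSpace Ω]
    (Pr : Measure Ω) (D : Fin M → Measure Z) (z : ℕ → Fin M → Ω → Z) : Prop where
  measurable : ∀ t m, Measurable (z t m)
  law : ∀ t m, Measure.map (z t m) Pr = D m
  indep : iIndepFun (fun tm : ℕ × Fin M => z tm.1 tm.2) Pr

/-- The random vector `x_{KR} - xs` produced by Local SGD with step size `η`. -/
def finalError {d : ℕ} {Z Ω : Type*} [MeasurableSpace Z] (p : Params) (P : Problem d p.M Z)
    (xs : Space d) (η : ℝ) (z : ℕ → Fin p.M → Ω → Z) (ω : Ω) : Space d :=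
  P.iterate p.K η (fun t m => z t m ω) (p.K * p.R) - xs

/-- `E ‖x_{KR} - xs‖² + E ‖x_{KR} - xs‖⁴ / B²`. -/
def totalError {d : ℕ} {Z Ω : Type*} [MeasurableSpace Z] [MeasurableSpace Ω] (p : Params)
    (P : Problem d p.M Z) (xs : Space d) (η : ℝ) (Pr : Measure Ω)
    (z : ℕ → Fin p.M → Ω → Z) : ℝ :=
  (∫ ω, ‖finalError p P xs η z ω‖ ^ 2 ∂Pr) +
    1 / p.B ^ 2 * (∫ ω, ‖finalError p P xs η z ω‖ ^ 4 ∂Pr)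

end LocalSGD

end

/-! The analysis follows four expectations: the second and fourth moments A, E of the distance from
the average model to x*, and the mean second and fourth powers S, T of the pairwise distances
between local models. A gradient step with η ≤ 1/(2H) contracts distances by 1 - ημ
(`gradient_step_contraction`), so the average model contracts towards x* up to a bias, caused by
evaluating gradients at different local models. To first order this bias sees only the heterogeneity
of the Hessians: the mean Hessian, applied to deviations that sum to zero, contributes nothing. Its
square is thus of order τ²S + Q²T (`gradBias_sq_le`), and the T term forces the fourth moments into
the analysis. Conversely, local models drift apart through ζ, φ, the noise and τ times the error of
the average model (`norm_pairDrift_le`), and communication resets their spread to zero.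

Put Φ = A + E/B² and Ψ = Λ(τ²/μ²)S + Λ³(κ'/B²)T. Young's inequality with parameter ημ/Λ in the
recursion of Φ costs a bounded factor over KR steps when ημKR ≤ Λ; the inverse parameter produces
the weights Λ and Λ³. Parameter 1/K in the recursion of Ψ costs a bounded factor per round. The
lower bound on R makes the feedback of Φ into Ψ at most of order 1/Λ over a round (`coupling_le`),
so the Gronwall argument `coupled_recursion` closes and gives `totalError_le`.

If B² > eε, the tuned step satisfies ημKR ≤ ln(B²/ε) = Λ, and the source terms become Λ-powers times
summands of S. Otherwise B² is at most eε, and a step so small that the error stays O(B²) suffices.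
-/

noncomputable section

namespace LocalSGD

/-! ### Gradients of smooth, strongly convex functions. -/

section Calculus

variable {E : Type*} [NormedAddCommGroup E] [InnerProductSpace ℝ E] [CompleteSpace E]

theorem descent_inequality {f : E → ℝ} {H : ℝ} (hf : Differentiable ℝ f)
    (hH : ∀ x y, ‖gradient f x - gradient f y‖ ≤ H * ‖x - y‖) (x v : E) :
    f (x + v) ≤ f x + inner ℝ (gradient f x) v + H / 2 * ‖v‖ ^ 2 := by
  -- Along the segment, `ψ` has nonpositive derivative by Cauchy–Schwarz and the Lipschitz bound;
  -- comparing its values at 0 and 1 is the claim.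
  set ψ : ℝ → ℝ := fun t => f (x + t • v) - t * inner ℝ (gradient f x) v - t ^ 2 * (H / 2 * ‖v‖ ^ 2)
    with hψ
  have hd : ∀ t, HasDerivAt ψ (inner ℝ (gradient f (x + t • v)) v - inner ℝ (gradient f x) v
      - 2 * t * (H / 2 * ‖v‖ ^ 2)) t := by
    intro t
    have h1 : HasDerivAt (fun t : ℝ => x + t • v) v t := by
      simpa using ((hasDerivAt_id t).smul_const v).const_add x
    have h2 : HasDerivAt (fun t : ℝ => f (x + t • v)) (inner ℝ (gradient f (x + t • v)) v) t := by
      rw [inner_gradient_left]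
      exact (hf (x + t • v)).hasFDerivAt.comp_hasDerivAt t h1
    have h3 := (hasDerivAt_id t).mul_const (inner ℝ (gradient f x) v)
    have h4 := (hasDerivAt_pow 2 t).mul_const (H / 2 * ‖v‖ ^ 2)
    have h5 := (h2.sub h3).sub h4
    simp only [Nat.cast_ofNat, Nat.add_one_sub_one, pow_one, one_mul] at h5
    exact h5
  have hanti : AntitoneOn ψ (Set.Icc 0 1) := by
    refine antitoneOn_of_deriv_nonpos (convex_Icc 0 1)
      (fun t _ => (hd t).continuousAt.continuousWithinAt)
      (fun t _ => (hd t).differentiableAt.differentiableWithinAt) fun t ht => ?_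
    rw [(hd t).deriv, ← inner_sub_left]
    rw [interior_Icc] at ht
    have h1 := hH (x + t • v) x
    rw [add_sub_cancel_left, norm_smul, Real.norm_of_nonneg ht.1.le] at h1
    have h2 := real_inner_le_norm (gradient f (x + t • v) - gradient f x) v
    nlinarith [mul_le_mul_of_nonneg_right h1 (norm_nonneg v)]
  have h := hanti (Set.left_mem_Icc.2 zero_le_one) (Set.right_mem_Icc.2 zero_le_one) zero_le_one
  simp only [hψ, one_smul, zero_smul, add_zero, one_mul, one_pow, zero_mul, sub_zero, ne_eq,
    OfNat.ofNat_ne_zero, not_false_eq_true, zero_pow] at h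
  linarith

/-- Here b is the gradient increment of the convex function f - μ‖·‖²/2. With v = b/H, the value of
f at y - v is bounded below from x and above from y, and at x + v the other way round; adding the
four inequalities cancels all function values. -/
theorem cocoercive {f : E → ℝ} {H μ : ℝ} (hf : Differentiable ℝ f) (hH0 : 0 < H) (hμ : 0 ≤ μ)
    (hH : ∀ x y, ‖gradient f x - gradient f y‖ ≤ H * ‖x - y‖)
    (hsc : ∀ x y : E, f x + inner ℝ (gradient f x) (y - x) + μ / 2 * ‖x - y‖ ^ 2 ≤ f y) (x y : E) :
    ‖gradient f y - gradient f x - μ • (y - x)‖ ^ 2 ≤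
      H * inner ℝ (gradient f y - gradient f x - μ • (y - x)) (y - x) := by
  set Δ := y - x with hΔ
  set b := gradient f y - gradient f x - μ • Δ with hb
  set v := (1 / H) • b with hv
  have e1 := hsc x (y - v)
  have e2 := descent_inequality hf hH y (-v)
  have e3 := hsc y (x + v)
  have e4 := descent_inequality hf hH x v
  have r1 : y - v - x = Δ - v := by rw [hΔ]; abel
  have r2 : x - (y - v) = -(Δ - v) := by rw [hΔ]; abel
  have r3 : x + v - y = -(Δ - v) := by rw [hΔ]; abel
  have r4 : y - (x + v) = Δ - v := by rw [hΔ]; abel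
  rw [r1, r2, norm_neg] at e1
  rw [r3, r4] at e3
  rw [← sub_eq_add_neg, norm_neg] at e2
  have hgy : gradient f y = b + gradient f x + μ • Δ := by rw [hb]; abel
  rw [hgy] at e2 e3
  have hvb : inner ℝ b v = H * ‖v‖ ^ 2 := by
    have : b = H • v := by rw [hv, smul_smul, mul_one_div_cancel hH0.ne', one_smul]
    rw [this, inner_smul_left, real_inner_self_eq_norm_sq]; simp
  have hbb : ‖b‖ ^ 2 = H ^ 2 * ‖v‖ ^ 2 := by
    have : b = H • v := by rw [hv, smul_smul, mul_one_div_cancel hH0.ne', one_smul]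
    rw [this, norm_smul, Real.norm_of_nonneg hH0.le]; ring
  have hn : ‖Δ - v‖ ^ 2 = ‖Δ‖ ^ 2 - 2 * inner ℝ Δ v + ‖v‖ ^ 2 := norm_sub_sq_real _ _
  rw [hn] at e1 e3
  simp only [inner_add_left, inner_sub_right, inner_neg_right, inner_smul_left,
    real_inner_self_eq_norm_sq, hvb, RCLike.conj_to_real] at e1 e2 e3 e4
  rw [hbb]
  have key : H * ‖v‖ ^ 2 ≤ inner ℝ b Δ := by
    nlinarith [mul_nonneg hμ (sq_nonneg ‖v‖)]
  nlinarith [mul_le_mul_of_nonneg_left key hH0.le]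

/-- The difference of the two steps is (1 - ημ)(x - y) - ηb with b as in `cocoercive`. Since 1 - ημ
≥ 1/2 and ηH ≤ 1/2, the cross term in the squared norm dominates η²‖b‖², so b only helps. -/
theorem gradient_step_contraction {f : E → ℝ} {H μ η : ℝ} (hf : Differentiable ℝ f) (hH0 : 0 < H)
    (hμ : 0 ≤ μ) (hμH : μ ≤ H)
    (hH : ∀ x y, ‖gradient f x - gradient f y‖ ≤ H * ‖x - y‖)
    (hsc : ∀ x y : E, f x + inner ℝ (gradient f x) (y - x) + μ / 2 * ‖x - y‖ ^ 2 ≤ f y)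
    (hη : 0 ≤ η) (hη2 : η ≤ 1 / (2 * H)) (x y : E) :
    ‖(x - η • gradient f x) - (y - η • gradient f y)‖ ≤ (1 - η * μ) * ‖x - y‖ := by
  have hηH : η * H ≤ 1 / 2 := by
    have := mul_le_mul_of_nonneg_right hη2 hH0.le
    rwa [one_div_mul_eq_div, div_mul_cancel_right₀ hH0.ne', ← one_div] at this
  have hημ : η * μ ≤ 1 / 2 := (mul_le_mul_of_nonneg_left hμH hη).trans hηH
  have hc := cocoercive hf hH0 hμ hH hsc y x
  set b := gradient f x - gradient f y - μ • (x - y) with hb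
  have he : (x - η • gradient f x) - (y - η • gradient f y) = (1 - η * μ) • (x - y) - η • b := by
    rw [hb]; module
  have hρ : 0 ≤ 1 - η * μ := by linarith
  refine abs_le_of_sq_le_sq' ?_ (by positivity) |>.2
  rw [he, norm_sub_sq_real, norm_smul, norm_smul, inner_smul_left, inner_smul_right,
    real_inner_comm, Real.norm_of_nonneg hρ, Real.norm_of_nonneg hη]
  simp only [RCLike.conj_to_real]
  have hi : 0 ≤ inner ℝ b (x - y) := by
    have := (sq_nonneg ‖b‖).trans hc
    exact nonneg_of_mul_nonneg_right this hH0
  have h1 : η ^ 2 * ‖b‖ ^ 2 ≤ η * (1 / 2) * inner ℝ b (x - y) := by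
    calc η ^ 2 * ‖b‖ ^ 2 ≤ η ^ 2 * (H * inner ℝ b (x - y)) := by gcongr
      _ = η * (η * H) * inner ℝ b (x - y) := by ring
      _ ≤ _ := by gcongr
  nlinarith [mul_nonneg (mul_nonneg hη hi) (by linarith : (0:ℝ) ≤ 1/2 - η * μ), mul_nonneg hη hi]

theorem gradient_differentiable {f : E → ℝ} (hf : ContDiff ℝ 2 f) :
    Differentiable ℝ (gradient f) := by
  have h : ContDiff ℝ 1 (fderiv ℝ f) := hf.fderiv_right (by norm_num)
  exact (InnerProductSpace.toDual ℝ E).symm.differentiable.comp (h.differentiable (by norm_num))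

/-- Quadratic lower and upper bounds are compared at one nonzero vector. In dimension zero both
hypotheses are vacuous, so that case has to be treated apart in the end. -/
theorem strongly_convex_mu_le [Nontrivial E] {f : E → ℝ} {H μ : ℝ} (hf : Differentiable ℝ f)
    (hH : ∀ x y, ‖gradient f x - gradient f y‖ ≤ H * ‖x - y‖)
    (hsc : ∀ x y : E, f x + inner ℝ (gradient f x) (y - x) + μ / 2 * ‖x - y‖ ^ 2 ≤ f y) :
    μ ≤ H := by
  obtain ⟨v, hv⟩ := exists_ne (0 : E)
  have h1 := hsc 0 v
  have h2 := descent_inequality hf hH 0 v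
  simp only [sub_zero, zero_sub, norm_neg, zero_add] at h1 h2
  have : 0 < ‖v‖ ^ 2 := by positivity
  nlinarith

theorem gradient_eq_zero_of_isMin {f : E → ℝ} {x : E} (h : IsMinOn f Set.univ x) :
    gradient f x = 0 := by
  have : IsLocalMin f x := h.isLocalMin Filter.univ_mem
  simp [gradient, this.fderiv_eq_zero]

theorem exists_isMin_of_strongly_convex [FiniteDimensional ℝ E] {f : E → ℝ} {μ : ℝ} (hμ : 0 < μ)
    (hf : Differentiable ℝ f)
    (hsc : ∀ x y : E, f x + inner ℝ (gradient f x) (y - x) + μ / 2 * ‖x - y‖ ^ 2 ≤ f y) :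
    ∃ x, IsMinOn f Set.univ x := by
  have : ProperSpace E := FiniteDimensional.proper ℝ E
  set r := 2 * ‖gradient f 0‖ / μ + 1
  have hr : 0 ≤ r := by positivity
  obtain ⟨x, hx, hmin⟩ := (isCompact_closedBall (0 : E) r).exists_isMinOn
    ⟨0, by simp [hr]⟩ hf.continuous.continuousOn
  refine ⟨x, fun y _ => ?_⟩
  -- Outside the ball the quadratic term outweighs the linear one, so f exceeds f(0) there.
  by_cases hy : y ∈ Metric.closedBall (0 : E) r
  · exact hmin hy
  · have h0 : f x ≤ f 0 := hmin (by simp [hr] : (0 : E) ∈ Metric.closedBall (0 : E) r)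
    have hy' : r < ‖y‖ := by simpa using hy
    have h1 := hsc 0 y
    simp only [sub_zero, zero_sub, norm_neg] at h1
    have h2 := neg_le_of_abs_le (abs_real_inner_le_norm (gradient f 0) y)
    have h3 : ‖gradient f 0‖ ≤ μ / 2 * ‖y‖ := by
      have : 2 * ‖gradient f 0‖ / μ ≤ ‖y‖ := by simp only [r] at hy'; linarith
      rw [div_le_iff₀ hμ] at this; linarith
    have h4 := mul_le_mul_of_nonneg_right h3 (norm_nonneg y)
    show f x ≤ f y
    nlinarith

theorem isMin_unique_of_strongly_convex {f : E → ℝ} {μ : ℝ} (hμ : 0 < μ)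
    (hsc : ∀ x y : E, f x + inner ℝ (gradient f x) (y - x) + μ / 2 * ‖x - y‖ ^ 2 ≤ f y)
    {x y : E} (hx : IsMinOn f Set.univ x) (hy : IsMinOn f Set.univ y) : x = y := by
  have h1 := hsc x y
  rw [gradient_eq_zero_of_isMin hx, inner_zero_left] at h1
  have h2 : f y ≤ f x := hy (Set.mem_univ x)
  have h3 : ‖x - y‖ ^ 2 ≤ 0 := by nlinarith
  have h4 : ‖x - y‖ = 0 := by
    have := sq_nonneg ‖x - y‖
    exact pow_eq_zero_iff two_ne_zero |>.1 (le_antisymm h3 this)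
  exact sub_eq_zero.1 (norm_eq_zero.1 h4)

/-- The difference of two gradients is Lipschitz with the bound on the difference of the
Hessians. -/
theorem gradient_sub_gradient_lipschitz {f g : E → ℝ} {τ : ℝ} (hf : ContDiff ℝ 2 f)
    (hg : ContDiff ℝ 2 g)
    (hτ : ∀ x, ‖fderiv ℝ (gradient f) x - fderiv ℝ (gradient g) x‖ ≤ τ) (x y : E) :
    ‖(gradient f x - gradient g x) - (gradient f y - gradient g y)‖ ≤ τ * ‖x - y‖ := by
  have hf' := gradient_differentiable hf
  have hg' := gradient_differentiable hg
  exact convex_univ.norm_image_sub_le_of_norm_hasFDerivWithin_le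
    (f := fun x => gradient f x - gradient g x)
    (fun x _ => ((hf' x).hasFDerivAt.sub (hg' x).hasFDerivAt).hasFDerivWithinAt)
    (fun x _ => hτ x) (Set.mem_univ y) (Set.mem_univ x)

/-- First-order expansion of a gradient around `y` along a linear map close to the Hessian. -/
theorem gradient_taylor {f : E → ℝ} {τ Q : ℝ} (hf : ContDiff ℝ 2 f) (hQ0 : 0 ≤ Q)
    (hQ : ∀ x y, ‖fderiv ℝ (gradient f) x - fderiv ℝ (gradient f) y‖ ≤ Q * ‖x - y‖) {y : E}
    {A : E →L[ℝ] E} (hA : ‖fderiv ℝ (gradient f) y - A‖ ≤ τ) (x : E) :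
    ‖gradient f x - gradient f y - A (x - y)‖ ≤ (τ + Q * ‖x - y‖) * ‖x - y‖ := by
  refine (convex_closedBall y ‖x - y‖).norm_image_sub_le_of_norm_hasFDerivWithin_le'
    (fun z _ => (gradient_differentiable hf z).hasFDerivAt.hasFDerivWithinAt)
    (fun z hz => ?_) (by simp) (by simp [dist_eq_norm])
  rw [Metric.mem_closedBall, dist_eq_norm] at hz
  calc ‖fderiv ℝ (gradient f) z - A‖
      = ‖(fderiv ℝ (gradient f) y - A) + (fderiv ℝ (gradient f) z - fderiv ℝ (gradient f) y)‖ := by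
        congr 1; abel
    _ ≤ τ + Q * ‖z - y‖ := norm_add_le_of_le hA (hQ z y)
    _ ≤ _ := by gcongr

end Calculus

/-! ### Second and fourth moments of sums of independent centred vectors. -/

section Moments

theorem memLp_integrable_norm_pow_two {E W : Type*} [NormedAddCommGroup E] [MeasurableSpace W]
    {ν : Measure W} [IsProbabilityMeasure ν] {Y : W → E} (hY : MemLp Y 4 ν) :
    Integrable (fun w => ‖Y w‖ ^ 2) ν :=
  (hY.mono_exponent (by norm_num : (2 : ENNReal) ≤ 4)).integrable_norm_pow (by norm_num)

theorem memLp_integrable_norm_pow_four {E W : Type*} [NormedAddCommGroup E] [MeasurableSpace W]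
    {ν : Measure W} {Y : W → E} (hY : MemLp Y 4 ν) :
    Integrable (fun w => ‖Y w‖ ^ 4) ν :=
  hY.integrable_norm_pow (p := 4) (by norm_num)

variable {E : Type*} [NormedAddCommGroup E] [InnerProductSpace ℝ E]

/-- The term linear in x is kept exact because it vanishes in expectation when x is centred and
independent of a; the other odd term is split by 4‖a‖‖x‖³ ≤ 2‖a‖²‖x‖² + 2‖x‖⁴. -/
theorem norm_add_pow_four_le (a x : E) :
    ‖a + x‖ ^ 4 ≤ ‖a‖ ^ 4 + 4 * inner ℝ (‖a‖ ^ 2 • a) x + 8 * (‖a‖ ^ 2 * ‖x‖ ^ 2) +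
      3 * ‖x‖ ^ 4 := by
  have h : ‖a + x‖ ^ 4 = (‖a‖ ^ 2 + 2 * inner ℝ a x + ‖x‖ ^ 2) ^ 2 := by
    rw [← norm_add_sq_real]; ring
  rw [h, inner_smul_left]
  simp only [RCLike.conj_to_real]
  have h1 := real_inner_le_norm a x
  have h2 : (inner ℝ a x) ^ 2 ≤ ‖a‖ ^ 2 * ‖x‖ ^ 2 := by
    rw [← mul_pow]; exact sq_le_sq' (neg_le_of_abs_le (abs_real_inner_le_norm a x)) h1
  have h3 : inner ℝ a x * ‖x‖ ^ 2 ≤ ‖a‖ * ‖x‖ * ‖x‖ ^ 2 := by gcongr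
  nlinarith [mul_nonneg (sq_nonneg ‖x‖) (sq_nonneg (‖a‖ - ‖x‖))]

variable [CompleteSpace E] [MeasurableSpace E] [BorelSpace E] {W : Type*} [MeasurableSpace W]
  {ν : Measure W}

theorem integral_inner_eq_zero_of_indep {Y X : W → E} (h : IndepFun Y X ν) (hY : Integrable Y ν)
    (hX : Integrable X ν) (h0 : ∫ w, X w ∂ν = 0) :
    Integrable (fun w => inner ℝ (Y w) (X w)) ν ∧ ∫ w, inner ℝ (Y w) (X w) ∂ν = 0 := by
  have h1 := h.integral_bilin hY hX (innerSL ℝ)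
  have h2 := h.integrable_bilin hY hX (innerSL ℝ)
  rw [h0] at h1
  simp only [map_zero] at h1 h2
  exact ⟨h2, h1⟩

variable [IsProbabilityMeasure ν]

theorem integral_norm_add_sq_of_indep {Y X : W → E} (h : IndepFun Y X ν) (hY : MemLp Y 4 ν)
    (hX : MemLp X 4 ν) (h0 : ∫ w, X w ∂ν = 0) :
    ∫ w, ‖Y w + X w‖ ^ 2 ∂ν = ∫ w, ‖Y w‖ ^ 2 ∂ν + ∫ w, ‖X w‖ ^ 2 ∂ν := by
  obtain ⟨i1, i2⟩ := integral_inner_eq_zero_of_indep h (hY.integrable (by norm_num))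
    (hX.integrable (by norm_num)) h0
  have hY2 := memLp_integrable_norm_pow_two hY
  have hX2 := memLp_integrable_norm_pow_two hX
  simp_rw [norm_add_sq_real]
  have j : Integrable (fun w => ‖Y w‖ ^ 2 + 2 * inner ℝ (Y w) (X w)) ν :=
    hY2.add (i1.const_mul 2)
  rw [integral_add j hX2, integral_add hY2 (i1.const_mul 2),
    integral_const_mul, i2]
  ring

theorem integral_norm_add_pow_four_of_indep {Y X : W → E} (h : IndepFun Y X ν) (hY : MemLp Y 4 ν)
    (hX : MemLp X 4 ν) (h0 : ∫ w, X w ∂ν = 0) :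
    ∫ w, ‖Y w + X w‖ ^ 4 ∂ν ≤ ∫ w, ‖Y w‖ ^ 4 ∂ν +
      8 * ((∫ w, ‖Y w‖ ^ 2 ∂ν) * ∫ w, ‖X w‖ ^ 2 ∂ν) + 3 * ∫ w, ‖X w‖ ^ 4 ∂ν := by
  have hY2 := memLp_integrable_norm_pow_two hY
  have hX2 := memLp_integrable_norm_pow_two hX
  have hY4 := memLp_integrable_norm_pow_four hY
  have hX4 := memLp_integrable_norm_pow_four hX
  -- Third moments are finite, so the term linear in X pairs X with an integrable vector independent
  -- of it and has mean zero.
  have hcub : Integrable (fun w => ‖Y w‖ ^ 2 • Y w) ν := by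
    refine (integrable_norm_iff (hY.1.norm.pow 2 |>.smul hY.1)).1 ?_
    have : Integrable (fun w => ‖Y w‖ ^ 3) ν :=
      (hY.mono_exponent (by norm_num : (3 : ENNReal) ≤ 4)).integrable_norm_pow (by norm_num)
    refine this.congr (Filter.Eventually.of_forall fun w => ?_)
    simp [norm_smul]; ring
  have hind : IndepFun (fun w => ‖Y w‖ ^ 2 • Y w) X ν :=
    h.comp (φ := fun y : E => ‖y‖ ^ 2 • y) (ψ := id)
      (Continuous.measurable (by fun_prop)) measurable_id
  obtain ⟨i1, i2⟩ := integral_inner_eq_zero_of_indep hind hcub (hX.integrable (by norm_num)) h0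
  have hind2 : IndepFun (fun w => ‖Y w‖ ^ 2) (fun w => ‖X w‖ ^ 2) ν :=
    h.comp (φ := fun y : E => ‖y‖ ^ 2) (ψ := fun y : E => ‖y‖ ^ 2)
      (by fun_prop) (by fun_prop)
  have hprod := hind2.integrable_mul hY2 hX2
  have hprod' := hind2.integral_mul_eq_mul_integral hY2.1 hX2.1
  simp only [Pi.mul_def] at hprod hprod'
  have j1 : Integrable (fun w => ‖Y w‖ ^ 4 + 4 * inner ℝ (‖Y w‖ ^ 2 • Y w) (X w)) ν :=
    hY4.add (i1.const_mul 4)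
  have j2 : Integrable (fun w => ‖Y w‖ ^ 4 + 4 * inner ℝ (‖Y w‖ ^ 2 • Y w) (X w) +
      8 * (‖Y w‖ ^ 2 * ‖X w‖ ^ 2)) ν := j1.add (hprod.const_mul 8)
  calc ∫ w, ‖Y w + X w‖ ^ 4 ∂ν
      ≤ ∫ w, (‖Y w‖ ^ 4 + 4 * inner ℝ (‖Y w‖ ^ 2 • Y w) (X w) + 8 * (‖Y w‖ ^ 2 * ‖X w‖ ^ 2) +
          3 * ‖X w‖ ^ 4) ∂ν :=
        integral_mono (memLp_integrable_norm_pow_four (hY.add hX)) (j2.add (hX4.const_mul 3))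
          fun w => norm_add_pow_four_le _ _
    _ = _ := by
        rw [integral_add j2 (hX4.const_mul 3), integral_add j1 (hprod.const_mul 8),
          integral_add hY4 (i1.const_mul 4), integral_const_mul, integral_const_mul,
          integral_const_mul, i2, hprod']
        ring

theorem moments_add_sum [SecondCountableTopology E] {ι : Type*} {X : ι → W → E}
    (hind : iIndepFun X ν)
    (hm : ∀ i, Measurable (X i)) (hX : ∀ i, MemLp (X i) 4 ν) (h0 : ∀ i, ∫ w, X i w ∂ν = 0)
    (u : E) (I : Finset ι) :
    MemLp (fun w => u + ∑ i ∈ I, X i w) 4 ν ∧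
    ∫ w, ‖u + ∑ i ∈ I, X i w‖ ^ 2 ∂ν = ‖u‖ ^ 2 + ∑ i ∈ I, ∫ w, ‖X i w‖ ^ 2 ∂ν ∧
    ∫ w, ‖u + ∑ i ∈ I, X i w‖ ^ 4 ∂ν ≤ ‖u‖ ^ 4 + 8 * ‖u‖ ^ 2 * (∑ i ∈ I, ∫ w, ‖X i w‖ ^ 2 ∂ν) +
      8 * (∑ i ∈ I, ∫ w, ‖X i w‖ ^ 2 ∂ν) ^ 2 + 3 * ∑ i ∈ I, ∫ w, ‖X i w‖ ^ 4 ∂ν := by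
  classical
  induction I using Finset.induction_on with
  | empty => simp [memLp_const]
  | insert j I hj ih =>
    obtain ⟨ih0, ih2, ih4⟩ := ih
    have hi : IndepFun (fun w => u + ∑ i ∈ I, X i w) (X j) ν := by
      have := (hind.indepFun_finsetSum_of_notMem hm hj).comp (φ := fun y => u + y) (ψ := id)
        (by fun_prop) measurable_id
      rw [Function.id_comp] at this
      convert this using 1
      ext w; simp
    have he : ∀ w, u + ∑ i ∈ insert j I, X i w = (u + ∑ i ∈ I, X i w) + X j w := by
      intro w; rw [Finset.sum_insert hj]; abel
    simp_rw [he, Finset.sum_insert hj]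
    have e2 := integral_norm_add_sq_of_indep hi ih0 (hX j) (h0 j)
    have e4 := integral_norm_add_pow_four_of_indep hi ih0 (hX j) (h0 j)
    refine ⟨ih0.add (hX j), by rw [e2, ih2]; ring, e4.trans ?_⟩
    rw [ih2]
    have hv : 0 ≤ ∫ w, ‖X j w‖ ^ 2 ∂ν := integral_nonneg fun w => by positivity
    -- With Σ the variance so far and v the new one, the new mixed term 8Σv is covered by 8(Σ + v)²
    -- - 8Σ² = 16Σv + 8v².
    nlinarith [sq_nonneg (∫ w, ‖X j w‖ ^ 2 ∂ν), Finset.sum_nonneg fun i (_ : i ∈ I) =>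
      integral_nonneg (μ := ν) (f := fun w => ‖X i w‖ ^ 2) fun w => by positivity]

end Moments

/-! ### Conditioning on the current state. -/

section MarkovStep

/-- By independence the joint law of X and Y is a product, so Fubini replaces conditional
expectations. Nonnegativity of f lets the integrable upper bound g supply integrability as well. -/
theorem integral_comp_le_of_indep {Ω S W : Type*} [MeasurableSpace Ω] [MeasurableSpace S]
    [MeasurableSpace W] {Pr : Measure Ω} [IsProbabilityMeasure Pr] {ν : Measure W}
    [IsProbabilityMeasure ν] {X : Ω → S} {Y : Ω → W} (hX : Measurable X) (hY : Measurable Y)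
    (hlaw : Measure.map Y Pr = ν) (hind : IndepFun X Y Pr) {step : S → W → S}
    (hstep : Measurable (Function.uncurry step)) {f g : S → ℝ} (hf : Measurable f)
    (hf0 : ∀ s, 0 ≤ f s)
    (hfi : ∀ s, Integrable (fun w => f (step s w)) ν) (hfg : ∀ s, ∫ w, f (step s w) ∂ν ≤ g s)
    (hg : Integrable (fun ω => g (X ω)) Pr) (hgm : Measurable g) :
    Integrable (fun ω => f (step (X ω) (Y ω))) Pr ∧
      ∫ ω, f (step (X ω) (Y ω)) ∂Pr ≤ ∫ ω, g (X ω) ∂Pr := by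
  have hXY := (indepFun_iff_map_prod_eq_prod_map_map hX.aemeasurable hY.aemeasurable).1 hind
  rw [hlaw] at hXY
  have : IsProbabilityMeasure (Measure.map X Pr) := Measure.isProbabilityMeasure_map hX.aemeasurable
  have hm : Measurable (fun p : S × W => f (step p.1 p.2)) := hf.comp hstep
  have hgX : Integrable g (Measure.map X Pr) :=
    (integrable_map_measure hgm.aestronglyMeasurable hX.aemeasurable).2 hg
  have hin : Integrable (fun s => ∫ w, f (step s w) ∂ν) (Measure.map X Pr) := by
    refine hgX.mono' hm.stronglyMeasurable.integral_prod_right'.aestronglyMeasurable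
      (Filter.Eventually.of_forall fun s => ?_)
    rw [Real.norm_of_nonneg (integral_nonneg fun w => hf0 _)]
    exact hfg s
  have hint : Integrable (fun p : S × W => f (step p.1 p.2)) ((Measure.map X Pr).prod ν) := by
    refine (integrable_prod_iff hm.aestronglyMeasurable).2
      ⟨Filter.Eventually.of_forall hfi, ?_⟩
    simpa only [Real.norm_of_nonneg (hf0 _)] using hin
  have hpair : AEMeasurable (fun ω => (X ω, Y ω)) Pr := (hX.prodMk hY).aemeasurable
  constructor
  · rw [← hXY] at hint
    exact (integrable_map_measure hm.aestronglyMeasurable hpair).1 hint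
  · have e1 : ∫ ω, f (step (X ω) (Y ω)) ∂Pr =
        ∫ p, f (step p.1 p.2) ∂((Measure.map X Pr).prod ν) := by
      rw [← hXY, integral_map hpair hm.aestronglyMeasurable]
    rw [e1, integral_prod _ hint, ← integral_map hX.aemeasurable hgm.aestronglyMeasurable]
    exact integral_mono hin hgX hfg

end MarkovStep

/-! ### Local SGD as a Markov chain driven by independent data. -/

section Chain

variable {d M : ℕ} {Z : Type*} [MeasurableSpace Z]

/-- The average of the models of the machines. -/
def mean (s : Fin M → Space d) : Space d := (1 / (M : ℝ)) • ∑ m, s m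

/-- One local stochastic gradient step on every machine. -/
def localStep (P : Problem d M Z) (η : ℝ) (s : Fin M → Space d) (w : Fin M → Z) :
    Fin M → Space d :=
  fun m => s m - η • P.g m (s m) (w m)

/-- One step of Local SGD, with averaging when `b` holds. -/
def chainStep (P : Problem d M Z) (η : ℝ) (b : Prop) [Decidable b] (s : Fin M → Space d)
    (w : Fin M → Z) : Fin M → Space d :=
  if b then fun _ => mean (localStep P η s w) else localStep P η s w

theorem localIterate_succ (P : Problem d M Z) (K : ℕ) (η : ℝ) (z : ℕ → Fin M → Z) (t : ℕ) :
    P.localIterate K η z (t + 1) =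
      chainStep P η ((t + 1) % K = 0) (P.localIterate K η z t) (z t) := by
  ext1 m
  simp only [Problem.localIterate, chainStep, mean, localStep]
  split_ifs <;> rfl

theorem measurable_mean : Measurable (mean : (Fin M → Space d) → Space d) := by
  unfold mean; fun_prop

theorem measurable_localStep {P : Problem d M Z}
    (hg : ∀ m, Measurable (Function.uncurry (P.g m))) (η : ℝ) :
    Measurable (Function.uncurry (localStep P η)) := by
  refine measurable_pi_lambda _ fun m => ?_
  have h : Measurable (fun p : (Fin M → Space d) × (Fin M → Z) => P.g m (p.1 m) (p.2 m)) :=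
    (hg m).comp (f := fun p : (Fin M → Space d) × (Fin M → Z) => (p.1 m, p.2 m)) (by fun_prop)
  exact Measurable.sub (by fun_prop) (h.const_smul η)

theorem measurable_chainStep {P : Problem d M Z}
    (hg : ∀ m, Measurable (Function.uncurry (P.g m))) (η : ℝ) (b : Prop) [Decidable b] :
    Measurable (Function.uncurry (chainStep P η b)) := by
  by_cases hb : b
  · have : Function.uncurry (chainStep P η b) =
        fun p _ => mean (Function.uncurry (localStep P η) p) := by
      ext1 p; simp [Function.uncurry, chainStep, hb]
    rw [this]
    exact measurable_pi_lambda _ fun _ => measurable_mean.comp (measurable_localStep hg η)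
  · have : Function.uncurry (chainStep P η b) = Function.uncurry (localStep P η) := by
      ext1 p; simp [Function.uncurry, chainStep, hb]
    rw [this]
    exact measurable_localStep hg η

variable {Ω : Type*} {z : ℕ → Fin M → Ω → Z}

/-- Adaptedness to the σ-algebra of the data drawn before time t; strictness of the inequality is
what makes the state independent of the data used at time t. -/
theorem measurable_localIterate_past {P : Problem d M Z}
    (hg : ∀ m, Measurable (Function.uncurry (P.g m))) (K : ℕ) (η : ℝ) (t : ℕ) :
    Measurable[⨆ i ∈ {i : ℕ × Fin M | i.1 < t}, MeasurableSpace.comap (z i.1 i.2) inferInstance]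
      (fun ω => P.localIterate K η (fun t m => z t m ω) t) := by
  induction t with
  | zero => exact measurable_const
  | succ t ih =>
    simp_rw [localIterate_succ]
    refine (measurable_chainStep hg η _).comp (Measurable.prodMk (ih.mono ?_ le_rfl) ?_)
    · exact biSup_mono fun i (hi : i.1 < t) => Nat.lt_succ_of_lt hi
    · refine @measurable_pi_lambda _ _ _ (_) _ _ fun m => ?_
      refine (comap_measurable (z t m)).mono ?_ le_rfl
      exact le_biSup (fun i : ℕ × Fin M => MeasurableSpace.comap (z i.1 i.2) inferInstance)
        (show (t, m) ∈ {i : ℕ × Fin M | i.1 < t + 1} from Nat.lt_succ_self t)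

variable [MeasurableSpace Ω] {Pr : Measure Ω} {D : Fin M → Measure Z}

theorem IsSampling.map_eq_pi (hz : IsSampling Pr D z) (t : ℕ) :
    Measure.map (fun ω m => z t m ω) Pr = Measure.pi D := by
  have h := hz.indep.precomp (g := fun m : Fin M => (t, m)) (fun a b h => by simpa using h)
  rw [h.map_fun_eq_pi_map fun m => (hz.measurable t m).aemeasurable]
  simp [hz.law]

theorem IsSampling.measurable_localIterate (hz : IsSampling Pr D z) {P : Problem d M Z}
    (hg : ∀ m, Measurable (Function.uncurry (P.g m))) (K : ℕ) (η : ℝ) (t : ℕ) :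
    Measurable (fun ω => P.localIterate K η (fun t m => z t m ω) t) :=
  (measurable_localIterate_past (z := z) hg K η t).mono
    (iSup₂_le fun i _ => (hz.measurable i.1 i.2).comap_le) le_rfl

theorem IsSampling.indepFun_localIterate (hz : IsSampling Pr D z) {P : Problem d M Z}
    (hg : ∀ m, Measurable (Function.uncurry (P.g m))) (K : ℕ) (η : ℝ) (t : ℕ) :
    IndepFun (fun ω => P.localIterate K η (fun t m => z t m ω) t) (fun ω m => z t m ω) Pr := by
  have h := indep_iSup_of_disjoint (fun i : ℕ × Fin M => (hz.measurable i.1 i.2).comap_le)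
    hz.indep.iIndep (S := {i | i.1 < t}) (T := {i | i.1 = t})
    (Set.disjoint_left.2 fun i (h1 : i.1 < t) (h2 : i.1 = t) => h1.ne h2)
  rw [IndepFun_iff_Indep]
  refine indep_of_indep_of_le_left (indep_of_indep_of_le_right h ?_)
    (measurable_localIterate_past hg K η t).comap_le
  refine Measurable.comap_le (@measurable_pi_lambda _ _ _ (_) _ _ fun m => ?_)
  refine (comap_measurable (z t m)).mono ?_ le_rfl
  exact le_biSup (fun i : ℕ × Fin M => MeasurableSpace.comap (z i.1 i.2) inferInstance)
    (show (t, m) ∈ {i : ℕ × Fin M | i.1 = t} from rfl)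

variable [IsProbabilityMeasure Pr] in
/-- A bound on the conditional expectation of a function of the next state of Local SGD. -/
theorem IsSampling.integral_next_le (hz : IsSampling Pr D z) {P : Problem d M Z}
    [∀ m, IsProbabilityMeasure (D m)]
    (hg : ∀ m, Measurable (Function.uncurry (P.g m))) (K : ℕ) (η : ℝ) (t : ℕ)
    {f g : (Fin M → Space d) → ℝ} (hf : Measurable f) (hf0 : ∀ s, 0 ≤ f s)
    (hfi : ∀ s, Integrable (fun w => f (chainStep P η ((t + 1) % K = 0) s w)) (Measure.pi D))
    (hfg : ∀ s, ∫ w, f (chainStep P η ((t + 1) % K = 0) s w) ∂(Measure.pi D) ≤ g s)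
    (hgm : Measurable g)
    (hgi : Integrable (fun ω => g (P.localIterate K η (fun t m => z t m ω) t)) Pr) :
    Integrable (fun ω => f (P.localIterate K η (fun t m => z t m ω) (t + 1))) Pr ∧
      ∫ ω, f (P.localIterate K η (fun t m => z t m ω) (t + 1)) ∂Pr ≤
        ∫ ω, g (P.localIterate K η (fun t m => z t m ω) t) ∂Pr := by
  simp_rw [localIterate_succ]
  exact integral_comp_le_of_indep (hz.measurable_localIterate hg K η t)
    (measurable_pi_lambda _ fun m => hz.measurable t m) (hz.map_eq_pi t)
    (hz.indepFun_localIterate hg K η t) (measurable_chainStep hg η _) hf hf0 hfi hfg hgi hgm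

end Chain

/-! ### Averages over machines and elementary power inequalities. -/

section Averages

variable {M : ℕ}

/-- The average of a finite family of real numbers. -/
def av (f : Fin M → ℝ) : ℝ := (1 / (M : ℝ)) * ∑ m, f m

theorem av_mono {f g : Fin M → ℝ} (h : ∀ m, f m ≤ g m) : av f ≤ av g :=
  mul_le_mul_of_nonneg_left (Finset.sum_le_sum fun m _ => h m) (by positivity)

theorem av_nonneg {f : Fin M → ℝ} (h : ∀ m, 0 ≤ f m) : 0 ≤ av f :=
  mul_nonneg (by positivity) (Finset.sum_nonneg fun m _ => h m)

theorem av_add (f g : Fin M → ℝ) : av (fun m => f m + g m) = av f + av g := by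
  simp [av, Finset.sum_add_distrib, mul_add]

theorem av_mul_left (c : ℝ) (f : Fin M → ℝ) : av (fun m => c * f m) = c * av f := by
  simp only [av, ← Finset.mul_sum]; ring

theorem av_const (hM : 0 < M) (c : ℝ) : av (fun _ : Fin M => c) = c := by
  have : (M : ℝ) ≠ 0 := by positivity
  simp only [av, Finset.sum_const, Finset.card_univ, Fintype.card_fin, nsmul_eq_mul]
  field_simp

theorem av_pow_le (hM : 0 < M) {f : Fin M → ℝ} (hf : ∀ m, 0 ≤ f m) (q : ℕ) :
    av f ^ q ≤ av fun m => f m ^ q := by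
  have hM' : (M : ℝ) ≠ 0 := by positivity
  have h := Real.pow_arith_mean_le_arith_mean_pow Finset.univ (fun _ : Fin M => 1 / (M : ℝ)) f
    (fun _ _ => by positivity) (by simp [hM']) (fun m _ => hf m) q
  simpa only [av, Finset.mul_sum] using h

theorem norm_average_le {E : Type*} [SeminormedAddCommGroup E] [NormedSpace ℝ E] (f : Fin M → E) :
    ‖(1 / (M : ℝ)) • ∑ m, f m‖ ≤ av fun m => ‖f m‖ := by
  rw [norm_smul, Real.norm_of_nonneg (by positivity)]
  exact mul_le_mul_of_nonneg_left (norm_sum_le _ _) (by positivity)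

theorem average_const {E : Type*} [AddCommGroup E] [Module ℝ E] (hM : 0 < M) (x : E) :
    (1 / (M : ℝ)) • ∑ _m : Fin M, x = x := by
  have hM' : (M : ℝ) ≠ 0 := by positivity
  rw [Finset.sum_const, Finset.card_univ, Fintype.card_fin, ← Nat.cast_smul_eq_nsmul ℝ, smul_smul,
    one_div_mul_cancel hM', one_smul]

theorem young_sq {θ : ℝ} (hθ : 0 < θ) (a b : ℝ) :
    (a + b) ^ 2 ≤ (1 + θ) * a ^ 2 + (1 + 1 / θ) * b ^ 2 := by
  have h : (1 + θ) * a ^ 2 + (1 + 1 / θ) * b ^ 2 - (a + b) ^ 2 = (θ * a - b) ^ 2 / θ := by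
    field_simp; ring
  have : 0 ≤ (θ * a - b) ^ 2 / θ := by positivity
  linarith

theorem young_pow_four {θ : ℝ} (hθ : 0 < θ) (a b : ℝ) :
    (a + b) ^ 4 ≤ (1 + θ) ^ 3 * a ^ 4 + (1 + 1 / θ) ^ 3 * b ^ 4 := by
  have h1 := young_sq hθ a b
  have h2 := young_sq hθ ((1 + θ) * a ^ 2) ((1 + 1 / θ) * b ^ 2)
  calc (a + b) ^ 4 = ((a + b) ^ 2) ^ 2 := by ring
    _ ≤ ((1 + θ) * a ^ 2 + (1 + 1 / θ) * b ^ 2) ^ 2 := by gcongr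
    _ ≤ _ := h2
    _ = _ := by ring

theorem sq_sum_four_le (a b c e : ℝ) :
    (a + b + c + e) ^ 2 ≤ 4 * (a ^ 2 + b ^ 2 + c ^ 2 + e ^ 2) := by
  nlinarith [sq_nonneg (a - b), sq_nonneg (a - c), sq_nonneg (a - e), sq_nonneg (b - c),
    sq_nonneg (b - e), sq_nonneg (c - e)]

theorem pow_four_sum_four_le (a b c e : ℝ) :
    (a + b + c + e) ^ 4 ≤ 64 * (a ^ 4 + b ^ 4 + c ^ 4 + e ^ 4) := by
  have h1 := sq_sum_four_le a b c e
  have h2 := sq_sum_four_le (a ^ 2) (b ^ 2) (c ^ 2) (e ^ 2)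
  calc (a + b + c + e) ^ 4 = ((a + b + c + e) ^ 2) ^ 2 := by ring
    _ ≤ (4 * (a ^ 2 + b ^ 2 + c ^ 2 + e ^ 2)) ^ 2 := by gcongr
    _ = 16 * (a ^ 2 + b ^ 2 + c ^ 2 + e ^ 2) ^ 2 := by ring
    _ ≤ 16 * (4 * ((a ^ 2) ^ 2 + (b ^ 2) ^ 2 + (c ^ 2) ^ 2 + (e ^ 2) ^ 2)) := by gcongr
    _ = _ := by ring

end Averages

/-! ### Consensus spread and the gradient bias it causes. -/

section State

variable {d M : ℕ} {Z : Type*} [MeasurableSpace Z]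

/-- The mean `q`-th power of the distance between the models of two machines. -/
def spread (q : ℕ) (s : Fin M → Space d) : ℝ := av fun m => av fun n => ‖s m - s n‖ ^ q

theorem spread_nonneg (q : ℕ) (s : Fin M → Space d) : 0 ≤ spread q s :=
  av_nonneg fun _ => av_nonneg fun _ => by positivity

theorem norm_sub_mean_le (hM : 0 < M) (s : Fin M → Space d) (m : Fin M) :
    ‖s m - mean s‖ ≤ av fun n => ‖s m - s n‖ := by
  have h : s m - mean s = (1 / (M : ℝ)) • ∑ n, (s m - s n) := by
    rw [Finset.sum_sub_distrib, smul_sub, average_const hM, mean]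
  rw [h]
  exact norm_average_le _

theorem av_norm_sub_mean_pow_le (hM : 0 < M) (s : Fin M → Space d) (q : ℕ) :
    (av fun m => ‖s m - mean s‖ ^ q) ≤ spread q s :=
  av_mono fun m => (pow_le_pow_left₀ (norm_nonneg _) (norm_sub_mean_le hM s m) q).trans
    (av_pow_le hM (fun _ => norm_nonneg _) q)

/-- The deviation of the averaged local gradients from the gradient at the average model. -/
def gradBias (P : Problem d M Z) (s : Fin M → Space d) : Space d :=
  (1 / (M : ℝ)) • ∑ m, (gradient (P.F m) (s m) - gradient (P.F m) (mean s))

/-- The crude Lipschitz bound is enough for the fourth moment: a finer one using Q would call for an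
eighth moment of the spread. This is the source of H⁴/μ⁴ in κ'. -/
theorem gradBias_pow_four_le {P : Problem d M Z} {H : ℝ} (hM : 0 < M)
    (hH : P.SmoothSecond H) (s : Fin M → Space d) :
    ‖gradBias P s‖ ^ 4 ≤ H ^ 4 * spread 4 s := by
  have h1 : ‖gradBias P s‖ ≤ av fun m => ‖gradient (P.F m) (s m) - gradient (P.F m) (mean s)‖ :=
    norm_average_le _
  calc ‖gradBias P s‖ ^ 4
      ≤ (av fun m => ‖gradient (P.F m) (s m) - gradient (P.F m) (mean s)‖) ^ 4 := by gcongr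
    _ ≤ av fun m => ‖gradient (P.F m) (s m) - gradient (P.F m) (mean s)‖ ^ 4 :=
        av_pow_le hM (fun _ => norm_nonneg _) 4
    _ ≤ av fun m => H ^ 4 * ‖s m - mean s‖ ^ 4 := av_mono fun m => by
        rw [← mul_pow]
        exact pow_le_pow_left₀ (norm_nonneg _) ((hH m).2 _ _) 4
    _ ≤ _ := by
        rw [av_mul_left]
        have := av_norm_sub_mean_pow_le hM s 4
        gcongr

/-- Deviations from the mean sum to zero, so one linear map A, common to all machines, can be
subtracted for free. With A the mean Hessian at the average model, the remainders have slope at most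
τ plus Q times the deviation, and H does not appear. -/
theorem gradBias_sq_le {P : Problem d M Z} {Q τ : ℝ} (hM : 0 < M) (hQ0 : 0 ≤ Q)
    (hQ : P.SmoothThird Q) (hτ : P.HessianHeterogeneity τ) (s : Fin M → Space d) :
    ‖gradBias P s‖ ^ 2 ≤ 2 * τ ^ 2 * spread 2 s + 2 * Q ^ 2 * spread 4 s := by
  set A : Space d →L[ℝ] Space d := (1 / (M : ℝ)) • ∑ n, hessian (P.F n) (mean s) with hA
  have hz : ∑ m, (s m - mean s) = 0 := by
    have h : (1 / (M : ℝ)) • ∑ m, (s m - mean s) = 0 := by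
      rw [Finset.sum_sub_distrib, smul_sub, average_const hM, mean, sub_self]
    exact (smul_eq_zero.1 h).resolve_left (by positivity)
  have he : gradBias P s = (1 / (M : ℝ)) • ∑ m, (gradient (P.F m) (s m)
      - gradient (P.F m) (mean s) - A (s m - mean s)) := by
    rw [gradBias, Finset.sum_sub_distrib (g := fun m => A (s m - mean s)), ← map_sum, hz, map_zero,
      sub_zero]
  have hAm : ∀ m, ‖fderiv ℝ (gradient (P.F m)) (mean s) - A‖ ≤ τ := fun m => by
    have h : fderiv ℝ (gradient (P.F m)) (mean s) - A =
        (1 / (M : ℝ)) • ∑ n, (hessian (P.F m) (mean s) - hessian (P.F n) (mean s)) := by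
      rw [Finset.sum_sub_distrib, smul_sub, average_const hM, hA, hessian]
    rw [h]
    exact (norm_average_le _).trans ((av_mono fun n => hτ m n _).trans_eq (av_const hM τ))
  rw [he]
  calc _ ≤ (av fun m => ‖gradient (P.F m) (s m)
          - gradient (P.F m) (mean s) - A (s m - mean s)‖) ^ 2 :=
        pow_le_pow_left₀ (norm_nonneg _) (norm_average_le _) 2
    _ ≤ av fun m => ‖gradient (P.F m) (s m)
          - gradient (P.F m) (mean s) - A (s m - mean s)‖ ^ 2 :=
        av_pow_le hM (fun _ => norm_nonneg _) 2
    _ ≤ av fun m => 2 * τ ^ 2 * ‖s m - mean s‖ ^ 2 + 2 * Q ^ 2 * ‖s m - mean s‖ ^ 4 :=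
        av_mono fun m => by
          refine (pow_le_pow_left₀ (norm_nonneg _)
            (gradient_taylor (hQ m).1 hQ0 (hQ m).2 (hAm m) (s m)) 2).trans ?_
          nlinarith [sq_nonneg (τ * ‖s m - mean s‖ - Q * ‖s m - mean s‖ ^ 2)]
    _ ≤ _ := by
        rw [av_add, av_mul_left, av_mul_left]
        have h2 := av_norm_sub_mean_pow_le hM s 2
        have h4 := av_norm_sub_mean_pow_le hM s 4
        gcongr

end State

/-! ### Deterministic drift of the average model and of pairs of models. -/

section ClassFacts

variable {d M : ℕ} {Z : Type*} [MeasurableSpace Z] {P : Problem d M Z}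

theorem sum_gradient_eq_zero (hM : 0 < M) (hd : ∀ m, Differentiable ℝ (P.F m)) {xs : Space d}
    (hxs : xs ∈ optima P.avg) : ∑ m, gradient (P.F m) xs = 0 := by
  have h1 : HasFDerivAt P.avg ((1 / (M : ℝ)) • ∑ m, fderiv ℝ (P.F m) xs) xs :=
    (HasFDerivAt.fun_sum fun m _ => (hd m xs).hasFDerivAt).const_mul (1 / (M : ℝ))
  have h2 : fderiv ℝ P.avg xs = 0 :=
    (IsMinOn.isLocalMin (s := Set.univ) hxs Filter.univ_mem).fderiv_eq_zero
  rw [h1.fderiv] at h2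
  have h3 := (smul_eq_zero.1 h2).resolve_left (by positivity)
  simp only [gradient, ← map_sum, h3, map_zero]

theorem exists_machine_optima {μ : ℝ} (hμ : 0 < μ) (hsc : P.StronglyConvex μ) :
    ∃ xm : Fin M → Space d, (∀ m, optima (P.F m) = {xm m}) ∧
      ∀ m, gradient (P.F m) (xm m) = 0 := by
  choose xm hxm using fun m => exists_isMin_of_strongly_convex hμ (hsc m).1 (hsc m).2
  refine ⟨xm, fun m => ?_, fun m => gradient_eq_zero_of_isMin (hxm m)⟩
  ext x
  exact ⟨fun hx => isMin_unique_of_strongly_convex hμ (hsc m).2 hx (hxm m),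
    fun hx => by rw [Set.mem_singleton_iff.1 hx]; exact hxm m⟩

theorem zetaPair_eq {xm : Fin M → Space d} (h : ∀ m, optima (P.F m) = {xm m}) (m n : Fin M) :
    P.zetaPair m n = ‖xm m - xm n‖ := by
  simp [Problem.zetaPair, h]

/-- The deterministic part of the error of the averaged model after a step. -/
def meanDrift (P : Problem d M Z) (xs : Space d) (η : ℝ) (s : Fin M → Space d) : Space d :=
  mean (fun m => s m - η • gradient (P.F m) (s m)) - xs

/-- The gradients at x* sum to zero, so x* may be replaced by the average of the machines' gradient
steps from x*. Each machine's step then contracts, and only the bias is left over. -/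
theorem norm_meanDrift_le {H μ η : ℝ} (hM : 0 < M) (hH0 : 0 < H) (hμ : 0 ≤ μ) (hμH : μ ≤ H)
    (hsc : P.StronglyConvex μ) (hH : P.SmoothSecond H) (hη : 0 ≤ η) (hη2 : η ≤ 1 / (2 * H))
    {xs : Space d} (hxs : xs ∈ optima P.avg) (s : Fin M → Space d) :
    ‖meanDrift P xs η s‖ ≤ (1 - η * μ) * ‖mean s - xs‖ + η * ‖gradBias P s‖ := by
  have h0 := sum_gradient_eq_zero hM (fun m => (hsc m).1) hxs
  have he : meanDrift P xs η s = (1 / (M : ℝ)) • ∑ m, ((mean s - η • gradient (P.F m) (mean s)) -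
      (xs - η • gradient (P.F m) xs)) - η • gradBias P s := by
    simp only [meanDrift, gradBias, Finset.sum_sub_distrib, smul_sub, average_const hM,
      ← Finset.smul_sum, h0, smul_zero]
    simp only [mean, Finset.sum_sub_distrib, ← Finset.smul_sum, smul_sub,
      smul_comm η (1 / (M : ℝ))]
    abel
  rw [he]
  refine (norm_sub_le _ _).trans (add_le_add ?_ ?_)
  · exact (norm_average_le _).trans ((av_mono fun m => gradient_step_contraction (hsc m).1 hH0 hμ
      hμH (hH m).2 (hsc m).2 hη hη2 _ _).trans_eq (av_const hM _))
  · rw [norm_smul, Real.norm_of_nonneg hη]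

/-- Both models are first moved by machine m's gradient, which contracts. The difference of the two
gradients at s n is τ-Lipschitz, so it is carried back to machine m's optimum, where it is at most H
times the distance of the two optima; the path runs through the average model and x*. -/
theorem norm_pairDrift_le {H μ η τ : ℝ} (hH0 : 0 < H) (hμ : 0 ≤ μ) (hμH : μ ≤ H)
    (hτ0 : 0 ≤ τ)
    (hsc : P.StronglyConvex μ) (hH : P.SmoothSecond H) (h2 : ∀ m, ContDiff ℝ 2 (P.F m))
    (hτ : P.HessianHeterogeneity τ)
    (hη : 0 ≤ η) (hη2 : η ≤ 1 / (2 * H)) {xm : Fin M → Space d}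
    (hxm : ∀ m, gradient (P.F m) (xm m) = 0) (xs : Space d) (s : Fin M → Space d) (m n : Fin M) :
    ‖(s m - η • gradient (P.F m) (s m)) - (s n - η • gradient (P.F n) (s n))‖ ≤
      (1 - η * μ) * ‖s m - s n‖ + η * (H * ‖xm m - xm n‖ + τ * ‖xs - xm m‖ + τ * ‖mean s - xs‖ +
        τ * ‖s n - mean s‖) := by
  have e : (s m - η • gradient (P.F m) (s m)) - (s n - η • gradient (P.F n) (s n)) =
      ((s m - η • gradient (P.F m) (s m)) - (s n - η • gradient (P.F m) (s n))) -
        η • (gradient (P.F m) (s n) - gradient (P.F n) (s n)) := by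
    module
  rw [e]
  refine (norm_sub_le _ _).trans (add_le_add
    (gradient_step_contraction (hsc m).1 hH0 hμ hμH (hH m).2 (hsc m).2 hη hη2 _ _) ?_)
  rw [norm_smul, Real.norm_of_nonneg hη]
  refine mul_le_mul_of_nonneg_left ?_ hη
  have h3 := gradient_sub_gradient_lipschitz (h2 m) (h2 n) (hτ m n) (s n) (xm m)
  have h4 := (hH n).2 (xm m) (xm n)
  rw [hxm n, sub_zero] at h4
  rw [hxm m, zero_sub, sub_neg_eq_add] at h3
  have h5 : ‖s n - xm m‖ ≤ ‖xs - xm m‖ + ‖mean s - xs‖ + ‖s n - mean s‖ := by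
    have : s n - xm m = (xs - xm m) + (mean s - xs) + (s n - mean s) := by abel
    rw [this]
    exact norm_add₃_le
  have h6 := norm_sub_le (gradient (P.F m) (s n) - gradient (P.F n) (s n) + gradient (P.F n) (xm m))
    (gradient (P.F n) (xm m))
  rw [add_sub_cancel_right] at h6
  nlinarith [mul_le_mul_of_nonneg_left h5 hτ0]

end ClassFacts

/-! ### Moments of the oracle noise. -/

section Noise

variable {d M : ℕ} {Z : Type*} [MeasurableSpace Z] {P : Problem d M Z}

/-- The noise of the stochastic gradient of machine `m` at `x`. -/
def noise (P : Problem d M Z) (m : Fin M) (x : Space d) (y : Z) : Space d :=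
  P.g m x y - gradient (P.F m) x

/-- The oracle noise has second moment at most `v` and fourth moment at most `b`. -/
structure NoiseBound (P : Problem d M Z) (v b : Fin M → ℝ) : Prop where
  memLp : ∀ m x, MemLp (noise P m x) 4 (P.D m)
  second : ∀ m x, ∫ y, ‖noise P m x y‖ ^ 2 ∂(P.D m) ≤ v m
  fourth : ∀ m x, ∫ y, ‖noise P m x y‖ ^ 4 ∂(P.D m) ≤ b m

theorem memLp_noise (ho : P.UnbiasedOracle) {m : Fin M} {x : Space d}
    (h : Integrable (fun y => ‖P.g m x y - gradient (P.F m) x‖ ^ 4) (P.D m)) :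
    MemLp (noise P m x) 4 (P.D m) := by
  obtain ⟨hp, hm, hi⟩ := ho m
  have hms : AEStronglyMeasurable (noise P m x) (P.D m) :=
    (hi x).1.1.sub aestronglyMeasurable_const
  refine (integrable_norm_rpow_iff hms (by norm_num) (by norm_num)).1 (h.congr ?_)
  refine Filter.Eventually.of_forall fun y => ?_
  simp only [ENNReal.toReal_ofNat]
  rw [← Real.rpow_natCast]
  rfl

theorem sq_integral_norm_sq_le (ho : P.UnbiasedOracle) {m : Fin M} {x : Space d}
    (h : MemLp (noise P m x) 4 (P.D m)) :
    (∫ y, ‖noise P m x y‖ ^ 2 ∂(P.D m)) ^ 2 ≤ ∫ y, ‖noise P m x y‖ ^ 4 ∂(P.D m) := by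
  have := (ho m).1
  have h2 := memLp_integrable_norm_pow_two h
  have h4 := memLp_integrable_norm_pow_four h
  set c := ∫ y, ‖noise P m x y‖ ^ 2 ∂(P.D m) with hc
  -- Jensen's inequality for the square, through its tangent line at the mean c.
  have hle : ∫ y, (2 * c * ‖noise P m x y‖ ^ 2 - c ^ 2) ∂(P.D m) ≤
      ∫ y, ‖noise P m x y‖ ^ 4 ∂(P.D m) :=
    integral_mono ((h2.const_mul _).sub (integrable_const _)) h4 fun y => by
      nlinarith [sq_nonneg (‖noise P m x y‖ ^ 2 - c)]
  rw [integral_sub (h2.const_mul _) (integrable_const _), integral_const_mul, ← hc] at hle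
  simp at hle
  nlinarith

theorem integral_eval_pi {D : Fin M → Measure Z} [∀ m, IsProbabilityMeasure (D m)]
    {G : Type*} [NormedAddCommGroup G] [NormedSpace ℝ G] (m : Fin M) {φ : Z → G}
    (hφ : AEStronglyMeasurable φ (D m)) :
    ∫ w : Fin M → Z, φ (w m) ∂(Measure.pi D) = ∫ y, φ y ∂(D m) := by
  have h : Measure.map (fun w : Fin M → Z => w m) (Measure.pi D) = D m :=
    (measurePreserving_eval D m).map_eq
  have hm : AEMeasurable (fun w : Fin M → Z => w m) (Measure.pi D) :=
    (measurable_pi_apply m).aemeasurable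
  rw [← h] at hφ
  have h1 := integral_map hm hφ
  rw [h] at h1
  exact h1.symm

theorem measurable_noise (ho : P.UnbiasedOracle) (m : Fin M) (x : Space d) :
    Measurable (noise P m x) :=
  ((ho m).2.1.comp measurable_prodMk_left).sub_const _

theorem integral_noise (ho : P.UnbiasedOracle) (m : Fin M) (x : Space d) :
    ∫ y, noise P m x y ∂(P.D m) = 0 := by
  obtain ⟨hp, -, h⟩ := ho m
  obtain ⟨hi, he⟩ := h x
  simp only [noise]
  rw [integral_sub hi (integrable_const _), he]
  simp

theorem integral_norm_smul_noise_pow_le (ho : P.UnbiasedOracle) {m : Fin M} {x : Space d} {q : ℕ}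
    (hq : Even q) {B : ℝ} (h : ∫ y, ‖noise P m x y‖ ^ q ∂(P.D m) ≤ B) (c : ℝ) :
    ∫ w : Fin M → Z, ‖c • noise P m x (w m)‖ ^ q ∂(Measure.pi P.D) ≤ c ^ q * B := by
  have : ∀ m, IsProbabilityMeasure (P.D m) := fun m => (ho m).1
  rw [integral_eval_pi (φ := fun y => ‖c • noise P m x y‖ ^ q) m
    ((((measurable_noise ho m x).const_smul c).norm.pow_const q).aestronglyMeasurable)]
  simp only [norm_smul, mul_pow, Real.norm_eq_abs, integral_const_mul, hq.pow_abs]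
  exact mul_le_mul_of_nonneg_left h (hq.pow_nonneg c)

/-- Arbitrary weights cover both uses: equal weights for the average model, and two opposite weights
for the difference of two models. -/
theorem noise_moments (ho : P.UnbiasedOracle) {v b : Fin M → ℝ} (hN : NoiseBound P v b)
    (s : Fin M → Space d) (u : Space d) (c : Fin M → ℝ) :
    MemLp (fun w : Fin M → Z => u + ∑ m, c m • noise P m (s m) (w m)) 4 (Measure.pi P.D) ∧
    ∫ w : Fin M → Z, ‖u + ∑ m, c m • noise P m (s m) (w m)‖ ^ 2 ∂(Measure.pi P.D) ≤
      ‖u‖ ^ 2 + ∑ m, c m ^ 2 * v m ∧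
    ∫ w : Fin M → Z, ‖u + ∑ m, c m • noise P m (s m) (w m)‖ ^ 4 ∂(Measure.pi P.D) ≤
      ‖u‖ ^ 4 + 8 * ‖u‖ ^ 2 * (∑ m, c m ^ 2 * v m) + 8 * (∑ m, c m ^ 2 * v m) ^ 2 +
        3 * ∑ m, c m ^ 4 * b m := by
  have : ∀ m, IsProbabilityMeasure (P.D m) := fun m => (ho m).1
  have hmeas : ∀ m, Measurable fun y => c m • noise P m (s m) y := fun m =>
    (measurable_noise ho m (s m)).const_smul (c m)
  have hind : iIndepFun (fun (m : Fin M) (w : Fin M → Z) => c m • noise P m (s m) (w m))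
      (Measure.pi P.D) :=
    iIndepFun_pi (X := fun m y => c m • noise P m (s m) y) fun m => (hmeas m).aemeasurable
  have hXL : ∀ m, MemLp (fun w : Fin M → Z => c m • noise P m (s m) (w m)) 4 (Measure.pi P.D) :=
    fun m => ((hN.memLp m (s m)).const_smul (c m)).comp_measurePreserving
      (measurePreserving_eval P.D m)
  have hX0 : ∀ m, ∫ w : Fin M → Z, c m • noise P m (s m) (w m) ∂(Measure.pi P.D) = 0 :=
    fun m => by
      rw [integral_eval_pi (φ := fun y => c m • noise P m (s m) y) m
        (hmeas m).aestronglyMeasurable, integral_smul, integral_noise ho, smul_zero]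
  obtain ⟨k0, k2, k4⟩ := moments_add_sum hind
    (fun m => (hmeas m).comp (measurable_pi_apply m)) hXL hX0 u Finset.univ
  have s2 := Finset.sum_le_sum fun m (_ : m ∈ Finset.univ) =>
    integral_norm_smul_noise_pow_le ho even_two (hN.second m (s m)) (c m)
  have s4 := Finset.sum_le_sum fun m (_ : m ∈ Finset.univ) =>
    integral_norm_smul_noise_pow_le ho (by decide : Even 4) (hN.fourth m (s m)) (c m)
  have s0 : 0 ≤ ∑ m, ∫ w : Fin M → Z, ‖c m • noise P m (s m) (w m)‖ ^ 2 ∂(Measure.pi P.D) :=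
    Finset.sum_nonneg fun m _ => integral_nonneg fun w => by positivity
  refine ⟨k0, k2.trans_le (add_le_add le_rfl s2), k4.trans (add_le_add (add_le_add (add_le_add
    le_rfl (mul_le_mul_of_nonneg_left s2 (by positivity)))
    (mul_le_mul_of_nonneg_left (pow_le_pow_left₀ s0 s2 2) (by norm_num)))
    (mul_le_mul_of_nonneg_left s4 (by norm_num)))⟩

end Noise

/-! ### One step of the algorithm from a fixed state. -/

section OneStep

variable {d : ℕ} {Z : Type*} [MeasurableSpace Z] {p : Params} {P : Problem d p.M Z} {xs : Space d}

/-- The fourth moment of a pair difference contains squared variances of single machines. The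
average of s₂⁴ is not controlled by σ₂, so a second bound estimates variances by s₄², whose squares
average to at most σ₄⁴. -/
theorem NoiseMoment.noiseBound {M : ℕ} {P : Problem d M Z} (ho : P.UnbiasedOracle) {σ₂ σ₄ : ℝ}
    (h2 : P.NoiseMoment 2 σ₂) (h4 : P.NoiseMoment 4 σ₄) :
    ∃ s₂ s₄ : Fin M → ℝ, av (fun m => s₂ m ^ 2) ≤ σ₂ ^ 2 ∧ av (fun m => s₄ m ^ 4) ≤ σ₄ ^ 4 ∧
      NoiseBound P (fun m => s₂ m ^ 2) (fun m => s₄ m ^ 4) ∧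
      NoiseBound P (fun m => s₄ m ^ 2) (fun m => s₄ m ^ 4) := by
  obtain ⟨s₂, -, hav2, hb2⟩ := h2
  obtain ⟨s₄, hs4, hav4, hb4⟩ := h4
  have hL : ∀ m x, MemLp (noise P m x) 4 (P.D m) := fun m x => memLp_noise ho (hb4 m x).1
  refine ⟨s₂, s₄, hav2, hav4, ⟨hL, fun m x => (hb2 m x).2, fun m x => (hb4 m x).2⟩,
    ⟨hL, fun m x => ?_, fun m x => (hb4 m x).2⟩⟩
  have h := (sq_integral_norm_sq_le ho (hL m x)).trans (hb4 m x).2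
  exact (abs_le_of_sq_le_sq' (h.trans_eq (by ring)) (sq_nonneg _)).2

theorem mean_localStep_sub (P : Problem d p.M Z) (xs : Space d) (η : ℝ) (s : Fin p.M → Space d)
    (w : Fin p.M → Z) :
    mean (localStep P η s w) - xs =
      meanDrift P xs η s + ∑ m, (-(η / (p.M : ℝ))) • noise P m (s m) (w m) := by
  have h : localStep P η s w =
      fun m => (s m - η • gradient (P.F m) (s m)) - η • noise P m (s m) (w m) := by
    ext1 m; simp only [localStep, noise]; module
  rw [h, meanDrift, mean, mean, Finset.sum_sub_distrib, smul_sub, ← Finset.smul_sum,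
    ← Finset.smul_sum, smul_smul, neg_smul, one_div_mul_eq_div]
  abel

/-- Writing the weights as a difference of indicators keeps the formula valid for m = n, where they
cancel. -/
theorem localStep_sub (P : Problem d p.M Z) (η : ℝ) (s : Fin p.M → Space d)
    (w : Fin p.M → Z) (m n : Fin p.M) :
    localStep P η s w m - localStep P η s w n =
      ((s m - η • gradient (P.F m) (s m)) - (s n - η • gradient (P.F n) (s n))) +
        ∑ i, (η * ((if i = n then 1 else 0) - (if i = m then 1 else 0))) •
          noise P i (s i) (w i) := by
  simp only [mul_sub, sub_smul, Finset.sum_sub_distrib, mul_ite, mul_one, mul_zero, ite_smul,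
    zero_smul, Finset.sum_ite_eq', Finset.mem_univ, if_true]
  simp only [localStep, noise]
  module

theorem sum_pair_weights_sq_le {M : ℕ} (η : ℝ) (m n : Fin M) {v : Fin M → ℝ} (hv : ∀ i, 0 ≤ v i) :
    ∑ i, (η * ((if i = n then 1 else 0) - (if i = m then 1 else 0))) ^ 2 * v i ≤
      2 * η ^ 2 * (v m + v n) := by
  have hle : ∀ i, (η * ((if i = n then 1 else 0) - (if i = m then 1 else 0))) ^ 2 * v i ≤
      2 * η ^ 2 * ((if i = n then v i else 0) + (if i = m then v i else 0)) := fun i => by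
    have h := mul_nonneg (sq_nonneg η) (hv i)
    rw [mul_pow, mul_right_comm, mul_assoc 2, mul_add, mul_ite, mul_ite, mul_zero]
    generalize η ^ 2 * v i = X at h
    split_ifs <;> norm_num <;> linarith
  refine (Finset.sum_le_sum fun i _ => hle i).trans_eq ?_
  rw [← Finset.mul_sum, Finset.sum_add_distrib]
  simp [add_comm]

theorem sum_pair_weights_pow_four_le {M : ℕ} (η : ℝ) (m n : Fin M) {v : Fin M → ℝ}
    (hv : ∀ i, 0 ≤ v i) :
    ∑ i, (η * ((if i = n then 1 else 0) - (if i = m then 1 else 0))) ^ 4 * v i ≤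
      8 * η ^ 4 * (v m + v n) := by
  have hle : ∀ i, (η * ((if i = n then 1 else 0) - (if i = m then 1 else 0))) ^ 4 * v i ≤
      8 * η ^ 4 * ((if i = n then v i else 0) + (if i = m then v i else 0)) := fun i => by
    have h := mul_nonneg (by positivity : 0 ≤ η ^ 4) (hv i)
    rw [mul_pow, mul_right_comm, mul_assoc 8, mul_add, mul_ite, mul_ite, mul_zero]
    generalize η ^ 4 * v i = X at h
    split_ifs <;> norm_num <;> linarith
  refine (Finset.sum_le_sum fun i _ => hle i).trans_eq ?_
  rw [← Finset.mul_sum, Finset.sum_add_distrib]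
  simp [add_comm]

/-- A fourth moment bound in which the mixed term is absorbed by Young's inequality. -/
theorem moment_four_absorb {θ U S T V W : ℝ} (hθ : 0 < θ) (hUT : U ^ 4 ≤ T) (hSV : S ^ 2 ≤ V) {w : ℝ} (hw : w ≤ W) :
    U ^ 4 + 8 * U ^ 2 * S + 8 * S ^ 2 + 3 * w ≤ (1 + θ) * T + (16 / θ + 8) * V + 3 * W := by
  have e : θ * U ^ 4 + 16 / θ * S ^ 2 - 8 * U ^ 2 * S = (θ * U ^ 2 - 4 * S) ^ 2 / θ := by
    field_simp; ring
  have : 0 ≤ (θ * U ^ 2 - 4 * S) ^ 2 / θ := by positivity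
  calc _ ≤ (1 + θ) * U ^ 4 + (16 / θ + 8) * S ^ 2 + 3 * w := by linarith
    _ ≤ _ := by gcongr

/-- Of the four factors 1 + γ in the fourth moment, three come from splitting off the bias and one
from absorbing the mixed noise term. -/
theorem mean_step_bounds (ha : p.Admissible) (h : InClass p P xs) (hμH : p.μ ≤ p.H) {η γ : ℝ}
    (hη : 0 < η) (hη2 : η ≤ 1 / (2 * p.H)) (hγ : 0 < γ) (s : Fin p.M → Space d) :
    MemLp (fun w => mean (localStep P η s w) - xs) 4 (Measure.pi P.D) ∧
    ∫ w, ‖mean (localStep P η s w) - xs‖ ^ 2 ∂(Measure.pi P.D) ≤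
      (1 + γ) * (1 - η * p.μ) ^ 2 * ‖mean s - xs‖ ^ 2 +
        (1 + 1 / γ) * η ^ 2 * (2 * p.τ ^ 2 * spread 2 s + 2 * p.Q ^ 2 * spread 4 s) +
        η ^ 2 * p.σ₂ ^ 2 / p.M ∧
    ∫ w, ‖mean (localStep P η s w) - xs‖ ^ 4 ∂(Measure.pi P.D) ≤
      (1 + γ) ^ 4 * (1 - η * p.μ) ^ 4 * ‖mean s - xs‖ ^ 4 +
        (1 + γ) * (1 + 1 / γ) ^ 3 * η ^ 4 * (p.H ^ 4 * spread 4 s) +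
        ((16 / γ + 8) * (η ^ 2 * p.σ₂ ^ 2 / p.M) ^ 2 + 3 * (η ^ 4 * p.σ₄ ^ 4 / p.M ^ 3)) := by
  obtain ⟨s₂, s₄, hs2, hs4, hN, -⟩ :=
    NoiseMoment.noiseBound h.oracle h.second_moment h.fourth_moment
  have hM : (0 : ℝ) < p.M := by exact_mod_cast ha.M_pos
  simp_rw [mean_localStep_sub]
  obtain ⟨k0, k2, k4⟩ := noise_moments h.oracle hN s (meanDrift P xs η s)
    (fun _ => -(η / (p.M : ℝ)))
  set u := meanDrift P xs η s
  have hu : ‖u‖ ≤ (1 - η * p.μ) * ‖mean s - xs‖ + η * ‖gradBias P s‖ :=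
    norm_meanDrift_le ha.M_pos ha.H_pos ha.μ_pos.le hμH h.strongly_convex h.smooth_second hη.le
      hη2 h.optimum s
  have hb2 := gradBias_sq_le ha.M_pos ha.Q_nonneg h.smooth_third h.hessian_heterogeneity s
  have hb4 := gradBias_pow_four_le ha.M_pos h.smooth_second s
  have hV : ∑ m, (-(η / (p.M : ℝ))) ^ 2 * s₂ m ^ 2 ≤ η ^ 2 * p.σ₂ ^ 2 / p.M := by
    rw [← Finset.mul_sum]
    have : ∑ m, s₂ m ^ 2 = p.M * av fun m => s₂ m ^ 2 := by rw [av]; field_simp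
    rw [this]
    calc _ = η ^ 2 / p.M * av fun m => s₂ m ^ 2 := by field_simp
      _ ≤ η ^ 2 / p.M * p.σ₂ ^ 2 := by gcongr
      _ = _ := by ring
  have hV0 : 0 ≤ ∑ m, (-(η / (p.M : ℝ))) ^ 2 * s₂ m ^ 2 :=
    Finset.sum_nonneg fun m _ => by positivity
  have hW : ∑ m, (-(η / (p.M : ℝ))) ^ 4 * s₄ m ^ 4 ≤ η ^ 4 * p.σ₄ ^ 4 / p.M ^ 3 := by
    rw [← Finset.mul_sum]
    have : ∑ m, s₄ m ^ 4 = p.M * av fun m => s₄ m ^ 4 := by rw [av]; field_simp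
    rw [this]
    calc _ = η ^ 4 / p.M ^ 3 * av fun m => s₄ m ^ 4 := by field_simp
      _ ≤ η ^ 4 / p.M ^ 3 * p.σ₄ ^ 4 := by gcongr
      _ = _ := by ring
  set V := η ^ 2 * p.σ₂ ^ 2 / p.M
  have hu2 : ‖u‖ ^ 2 ≤ (1 + γ) * (1 - η * p.μ) ^ 2 * ‖mean s - xs‖ ^ 2 +
      (1 + 1 / γ) * η ^ 2 * (2 * p.τ ^ 2 * spread 2 s + 2 * p.Q ^ 2 * spread 4 s) := by
    calc ‖u‖ ^ 2 ≤ _ := pow_le_pow_left₀ (norm_nonneg _) hu 2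
      _ ≤ _ := young_sq hγ _ _
      _ = (1 + γ) * (1 - η * p.μ) ^ 2 * ‖mean s - xs‖ ^ 2 +
          (1 + 1 / γ) * η ^ 2 * ‖gradBias P s‖ ^ 2 := by ring
      _ ≤ _ := by gcongr
  have hu4 : ‖u‖ ^ 4 ≤ (1 + γ) ^ 3 * (1 - η * p.μ) ^ 4 * ‖mean s - xs‖ ^ 4 +
      (1 + 1 / γ) ^ 3 * η ^ 4 * (p.H ^ 4 * spread 4 s) := by
    calc ‖u‖ ^ 4 ≤ _ := pow_le_pow_left₀ (norm_nonneg _) hu 4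
      _ ≤ _ := young_pow_four hγ _ _
      _ = (1 + γ) ^ 3 * (1 - η * p.μ) ^ 4 * ‖mean s - xs‖ ^ 4 +
          (1 + 1 / γ) ^ 3 * η ^ 4 * ‖gradBias P s‖ ^ 4 := by ring
      _ ≤ _ := by gcongr
  refine ⟨k0, k2.trans (add_le_add hu2 hV), k4.trans ?_⟩
  exact (moment_four_absorb hγ hu4 (pow_le_pow_left₀ hV0 hV 2) hW).trans_eq (by ring)

theorem pair_step_bounds (ha : p.Admissible) (h : InClass p P xs) (hμH : p.μ ≤ p.H) {η θ : ℝ}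
    (hη : 0 < η) (hη2 : η ≤ 1 / (2 * p.H)) (hθ : 0 < θ) {s₂ s₄ : Fin p.M → ℝ}
    (hN2 : NoiseBound P (fun m => s₂ m ^ 2) (fun m => s₄ m ^ 4))
    (hN4 : NoiseBound P (fun m => s₄ m ^ 2) (fun m => s₄ m ^ 4))
    {xm : Fin p.M → Space d} (hxm : ∀ m, gradient (P.F m) (xm m) = 0)
    (s : Fin p.M → Space d) (m n : Fin p.M) :
    MemLp (fun w => localStep P η s w m - localStep P η s w n) 4 (Measure.pi P.D) ∧
    ∫ w, ‖localStep P η s w m - localStep P η s w n‖ ^ 2 ∂(Measure.pi P.D) ≤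
      (1 + θ) * (1 - η * p.μ) ^ 2 * ‖s m - s n‖ ^ 2 +
        (1 + 1 / θ) * η ^ 2 * 4 * (p.H ^ 2 * ‖xm m - xm n‖ ^ 2 + p.τ ^ 2 * ‖xs - xm m‖ ^ 2 +
          p.τ ^ 2 * ‖mean s - xs‖ ^ 2 + p.τ ^ 2 * ‖s n - mean s‖ ^ 2) +
        2 * η ^ 2 * (s₂ m ^ 2 + s₂ n ^ 2) ∧
    ∫ w, ‖localStep P η s w m - localStep P η s w n‖ ^ 4 ∂(Measure.pi P.D) ≤
      (1 + θ) ^ 4 * (1 - η * p.μ) ^ 4 * ‖s m - s n‖ ^ 4 +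
        (1 + θ) * (1 + 1 / θ) ^ 3 * η ^ 4 * 64 * (p.H ^ 4 * ‖xm m - xm n‖ ^ 4 +
          p.τ ^ 4 * ‖xs - xm m‖ ^ 4 + p.τ ^ 4 * ‖mean s - xs‖ ^ 4 +
          p.τ ^ 4 * ‖s n - mean s‖ ^ 4) +
        (128 / θ + 88) * η ^ 4 * (s₄ m ^ 4 + s₄ n ^ 4) := by
  simp_rw [localStep_sub]
  set c : Fin p.M → ℝ :=
    fun i => η * ((if i = n then 1 else 0) - (if i = m then 1 else 0)) with hc
  set u := (s m - η • gradient (P.F m) (s m)) - (s n - η • gradient (P.F n) (s n)) with hu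
  obtain ⟨k0, k2, -⟩ := noise_moments h.oracle hN2 s u c
  obtain ⟨-, -, k4⟩ := noise_moments h.oracle hN4 s u c
  have hun := norm_pairDrift_le ha.H_pos ha.μ_pos.le hμH ha.τ_nonneg h.strongly_convex
    h.smooth_second (fun m => (h.smooth_third m).1) h.hessian_heterogeneity hη.le hη2 hxm xs s m n
  rw [← hu] at hun
  have hV2 := sum_pair_weights_sq_le η m n (v := fun i => s₂ i ^ 2) fun i => sq_nonneg _
  have hV4 := sum_pair_weights_sq_le η m n (v := fun i => s₄ i ^ 2) fun i => sq_nonneg _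
  have hc4 := sum_pair_weights_pow_four_le η m n (v := fun i => s₄ i ^ 4) fun i => by positivity
  have hV40 : 0 ≤ ∑ i, c i ^ 2 * s₄ i ^ 2 := Finset.sum_nonneg fun i _ => by positivity
  have hu2 := pow_le_pow_left₀ (norm_nonneg _) hun 2
  have hu4 := pow_le_pow_left₀ (norm_nonneg _) hun 4
  set g := p.H * ‖xm m - xm n‖ + p.τ * ‖xs - xm m‖ + p.τ * ‖mean s - xs‖ +
        p.τ * ‖s n - mean s‖ with hg
  have hg2 : g ^ 2 ≤ 4 * (p.H ^ 2 * ‖xm m - xm n‖ ^ 2 + p.τ ^ 2 * ‖xs - xm m‖ ^ 2 +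
          p.τ ^ 2 * ‖mean s - xs‖ ^ 2 + p.τ ^ 2 * ‖s n - mean s‖ ^ 2) :=
    (sq_sum_four_le _ _ _ _).trans_eq (by ring)
  have hg4 : g ^ 4 ≤ 64 * (p.H ^ 4 * ‖xm m - xm n‖ ^ 4 + p.τ ^ 4 * ‖xs - xm m‖ ^ 4 +
          p.τ ^ 4 * ‖mean s - xs‖ ^ 4 + p.τ ^ 4 * ‖s n - mean s‖ ^ 4) :=
    (pow_four_sum_four_le _ _ _ _).trans_eq (by ring)
  set g2 := p.H ^ 2 * ‖xm m - xm n‖ ^ 2 + p.τ ^ 2 * ‖xs - xm m‖ ^ 2 +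
          p.τ ^ 2 * ‖mean s - xs‖ ^ 2 + p.τ ^ 2 * ‖s n - mean s‖ ^ 2
  set g4 := p.H ^ 4 * ‖xm m - xm n‖ ^ 4 + p.τ ^ 4 * ‖xs - xm m‖ ^ 4 +
          p.τ ^ 4 * ‖mean s - xs‖ ^ 4 + p.τ ^ 4 * ‖s n - mean s‖ ^ 4
  refine ⟨k0, k2.trans (add_le_add ?_ hV2), k4.trans ?_⟩
  · calc ‖u‖ ^ 2 ≤ _ := hu2
      _ ≤ _ := young_sq hθ _ _
      _ = (1 + θ) * (1 - η * p.μ) ^ 2 * ‖s m - s n‖ ^ 2 + (1 + 1 / θ) * η ^ 2 * g ^ 2 := by ring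
      _ ≤ (1 + θ) * (1 - η * p.μ) ^ 2 * ‖s m - s n‖ ^ 2 + (1 + 1 / θ) * η ^ 2 * (4 * g2) := by
        gcongr
      _ = _ := by ring
  · have hU : ‖u‖ ^ 4 ≤ (1 + θ) ^ 3 * (1 - η * p.μ) ^ 4 * ‖s m - s n‖ ^ 4 +
        (1 + 1 / θ) ^ 3 * η ^ 4 * (64 * g4) := by
      calc ‖u‖ ^ 4 ≤ _ := hu4
        _ ≤ _ := young_pow_four hθ _ _
        _ = (1 + θ) ^ 3 * (1 - η * p.μ) ^ 4 * ‖s m - s n‖ ^ 4 +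
          (1 + 1 / θ) ^ 3 * η ^ 4 * g ^ 4 := by ring
        _ ≤ _ := by gcongr
    have hVsq : (2 * η ^ 2 * (s₄ m ^ 2 + s₄ n ^ 2)) ^ 2 ≤ 8 * η ^ 4 * (s₄ m ^ 4 + s₄ n ^ 4) := by
      calc _ = 4 * η ^ 4 * (s₄ m ^ 2 + s₄ n ^ 2) ^ 2 := by ring
        _ ≤ 4 * η ^ 4 * (2 * ((s₄ m ^ 2) ^ 2 + (s₄ n ^ 2) ^ 2)) := by
          gcongr
          exact add_sq_le
        _ = _ := by ring
    exact (moment_four_absorb hθ hU ((pow_le_pow_left₀ hV40 hV4 2).trans hVsq) hc4).trans_eq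
      (by ring)

end OneStep

/-! ### Recursions for the expected error and spread. -/

section Expectation

theorem integrable_av {M : ℕ} {W : Type*} [MeasurableSpace W] {ν : Measure W}
    {f : Fin M → W → ℝ} (hf : ∀ m, Integrable (f m) ν) : Integrable (fun w => av fun m => f m w) ν :=
  (integrable_finsetSum _ fun m _ => hf m).const_mul _

theorem integral_av {M : ℕ} {W : Type*} [MeasurableSpace W] {ν : Measure W}
    {f : Fin M → W → ℝ} (hf : ∀ m, Integrable (f m) ν) :
    ∫ w, av (fun m => f m w) ∂ν = av fun m => ∫ w, f m w ∂ν := by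
  simp only [av]
  rw [integral_const_mul, integral_finsetSum _ fun m _ => hf m]

variable {d : ℕ} {Z : Type*} [MeasurableSpace Z] {p : Params} {P : Problem d p.M Z} {xs : Space d}

theorem av_sq_le_of_av_pow_four_le {M : ℕ} (hM : 0 < M) {f : Fin M → ℝ} {c : ℝ}
    (h : av (fun m => f m ^ 4) ≤ c ^ 4) : av (fun m => f m ^ 2) ≤ c ^ 2 := by
  have h1 := av_pow_le hM (f := fun m => f m ^ 2) (fun m => sq_nonneg _) 2
  simp only [← pow_mul] at h1
  refine (abs_le_of_sq_le_sq' ((h1.trans h).trans_eq (by ring)) (sq_nonneg _)).2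

theorem discrepancy_bounds (ha : p.Admissible) (h : InClass p P xs) {xm : Fin p.M → Space d}
    (hxm : ∀ m, optima (P.F m) = {xm m}) :
    (av fun m => av fun n => ‖xm m - xm n‖ ^ 2) ≤ p.ζ ^ 2 ∧
    (av fun m => av fun n => ‖xm m - xm n‖ ^ 4) ≤ p.ζ ^ 4 ∧
    (av fun m => ‖xs - xm m‖ ^ 2) ≤ p.φ ^ 2 ∧ (av fun m => ‖xs - xm m‖ ^ 4) ≤ p.φ ^ 4 := by
  have h1 : (av fun m => av fun n => ‖xm m - xm n‖ ^ 4) ≤ p.ζ ^ 4 := by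
    refine le_trans (le_of_eq ?_) h.optima_discrepancy
    simp only [av, zetaPair_eq hxm, ← Finset.mul_sum]
    ring
  have h2 : (av fun m => ‖xs - xm m‖ ^ 4) ≤ p.φ ^ 4 := by
    refine le_trans (le_of_eq ?_) h.avg_optima_discrepancy
    simp only [av, hxm, Metric.infDist_singleton, dist_eq_norm]
  refine ⟨?_, h1, av_sq_le_of_av_pow_four_le ha.M_pos h2, h2⟩
  have h3 : (av fun m => av fun n => ‖xm m - xm n‖ ^ 2) ^ 2 ≤ p.ζ ^ 4 := by
    refine (av_pow_le ha.M_pos (fun m => av_nonneg fun n => sq_nonneg _) 2).trans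
      ((av_mono fun m => ?_).trans h1)
    refine (av_pow_le ha.M_pos (fun n => sq_nonneg _) 2).trans_eq ?_
    simp only [← pow_mul]
  exact (abs_le_of_sq_le_sq' (h3.trans_eq (by ring)) (sq_nonneg _)).2

/-- The pair bounds are averaged over all pairs. The distances from local models to their mean are
in turn bounded by the spread, so the estimate closes on the error and the spread. -/
theorem spread_step_bounds (ha : p.Admissible) (h : InClass p P xs) (hμH : p.μ ≤ p.H) {η θ : ℝ}
    (hη : 0 < η) (hη2 : η ≤ 1 / (2 * p.H)) (hθ : 0 < θ) (s : Fin p.M → Space d) :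
    (Integrable (fun w => spread 2 (localStep P η s w)) (Measure.pi P.D) ∧
    ∫ w, spread 2 (localStep P η s w) ∂(Measure.pi P.D) ≤
      (1 + θ) * (1 - η * p.μ) ^ 2 * spread 2 s +
        (1 + 1 / θ) * η ^ 2 * 4 * (p.H ^ 2 * p.ζ ^ 2 + p.τ ^ 2 * p.φ ^ 2 +
          p.τ ^ 2 * ‖mean s - xs‖ ^ 2 + p.τ ^ 2 * spread 2 s) +
        4 * η ^ 2 * p.σ₂ ^ 2) ∧
    (Integrable (fun w => spread 4 (localStep P η s w)) (Measure.pi P.D) ∧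
    ∫ w, spread 4 (localStep P η s w) ∂(Measure.pi P.D) ≤
      (1 + θ) ^ 4 * (1 - η * p.μ) ^ 4 * spread 4 s +
        (1 + θ) * (1 + 1 / θ) ^ 3 * η ^ 4 * 64 * (p.H ^ 4 * p.ζ ^ 4 +
          p.τ ^ 4 * p.φ ^ 4 + p.τ ^ 4 * ‖mean s - xs‖ ^ 4 + p.τ ^ 4 * spread 4 s) +
        (256 / θ + 176) * η ^ 4 * p.σ₄ ^ 4) := by
  have : ∀ m, IsProbabilityMeasure (P.D m) := fun m => (h.oracle m).1
  obtain ⟨s₂, s₄, hs2, hs4, hN2, hN4⟩ :=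
    NoiseMoment.noiseBound h.oracle h.second_moment h.fourth_moment
  obtain ⟨xm, hopt, hxm⟩ := exists_machine_optima ha.μ_pos h.strongly_convex
  obtain ⟨z2, z4, f2, f4⟩ := discrepancy_bounds ha h hopt
  have hp := pair_step_bounds ha h hμH hη hη2 hθ hN2 hN4 hxm s
  have hM := ha.M_pos
  have hi2 := fun m n => memLp_integrable_norm_pow_two (hp m n).1
  have hi4 := fun m n => memLp_integrable_norm_pow_four (hp m n).1
  have d2 := av_norm_sub_mean_pow_le hM s 2
  have d4 := av_norm_sub_mean_pow_le hM s 4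
  refine ⟨⟨integrable_av fun m => integrable_av fun n => hi2 m n, ?_⟩,
    ⟨integrable_av fun m => integrable_av fun n => hi4 m n, ?_⟩⟩
  · have e : ∫ w, spread 2 (localStep P η s w) ∂(Measure.pi P.D) = av fun m => av fun n =>
        ∫ w, ‖localStep P η s w m - localStep P η s w n‖ ^ 2 ∂(Measure.pi P.D) := by
      simp only [spread]
      rw [integral_av fun m => integrable_av fun n => hi2 m n]
      congr 1; ext m
      exact integral_av fun n => hi2 m n
    rw [e]
    refine (av_mono fun m => av_mono fun n => (hp m n).2.1).trans ?_
    simp only [av_add, av_mul_left, av_const hM]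
    have : 2 * η ^ 2 * ((av fun m => s₂ m ^ 2) + av fun m => s₂ m ^ 2) ≤
        4 * η ^ 2 * p.σ₂ ^ 2 := by nlinarith [sq_nonneg η]
    rw [spread] at d2 ⊢
    gcongr
  · have e : ∫ w, spread 4 (localStep P η s w) ∂(Measure.pi P.D) = av fun m => av fun n =>
        ∫ w, ‖localStep P η s w m - localStep P η s w n‖ ^ 4 ∂(Measure.pi P.D) := by
      simp only [spread]
      rw [integral_av fun m => integrable_av fun n => hi4 m n]
      congr 1; ext m
      exact integral_av fun n => hi4 m n
    rw [e]
    refine (av_mono fun m => av_mono fun n => (hp m n).2.2).trans ?_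
    simp only [av_add, av_mul_left, av_const hM]
    have : (128 / θ + 88) * η ^ 4 * ((av fun m => s₄ m ^ 4) + av fun m => s₄ m ^ 4) ≤
        (256 / θ + 176) * η ^ 4 * p.σ₄ ^ 4 := by
      calc _ = (256 / θ + 176) * η ^ 4 * (av fun m => s₄ m ^ 4) := by ring
        _ ≤ _ := by gcongr
    rw [spread] at d4 ⊢
    gcongr

/-- The `q`-th power of the distance of the average model from `xs`. -/
def err {M : ℕ} (xs : Space d) (q : ℕ) (s : Fin M → Space d) : ℝ := ‖mean s - xs‖ ^ q

theorem measurable_err {M : ℕ} (xs : Space d) (q : ℕ) :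
    Measurable (err xs q : (Fin M → Space d) → ℝ) :=
  ((measurable_mean.sub_const xs).norm).pow_const q

theorem err_nonneg {M : ℕ} (xs : Space d) (q : ℕ) (s : Fin M → Space d) : 0 ≤ err xs q s := by
  unfold err; positivity

theorem measurable_spread {M : ℕ} (q : ℕ) :
    Measurable (spread q : (Fin M → Space d) → ℝ) := by
  unfold spread av; fun_prop

/-- Averaging does not move the mean, so one error recursion serves local and communication steps
alike. -/
theorem err_chainStep (hM : 0 < p.M) (η : ℝ) (b : Prop) [Decidable b] (q : ℕ)
    (s : Fin p.M → Space d) (w : Fin p.M → Z) :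
    err xs q (chainStep P η b s w) = err xs q (localStep P η s w) := by
  unfold chainStep
  split_ifs
  · simp only [err]
    congr 3
    exact average_const hM _
  · rfl

theorem spread_chainStep_of_sync {η : ℝ} {b : Prop} [Decidable b] (hb : b) {q : ℕ} (hq : q ≠ 0)
    (s : Fin p.M → Space d) (w : Fin p.M → Z) : spread q (chainStep P η b s w) = 0 := by
  simp [chainStep, hb, spread, av, hq]

theorem spread_chainStep_of_not_sync {η : ℝ} {b : Prop} [Decidable b] (hb : ¬b) {q : ℕ}
    (s : Fin p.M → Space d) (w : Fin p.M → Z) :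
    spread q (chainStep P η b s w) = spread q (localStep P η s w) := by
  simp [chainStep, hb]

/-- The random state of Local SGD. -/
def state {Ω : Type*} (P : Problem d p.M Z) (η : ℝ) (z : ℕ → Fin p.M → Ω → Z) (t : ℕ) (ω : Ω) :
    Fin p.M → Space d :=
  P.localIterate p.K η (fun t m => z t m ω) t

theorem spread_next_of_sync {Ω : Type*} {z : ℕ → Fin p.M → Ω → Z} (η : ℝ) {t : ℕ} (ht : (t + 1) % p.K = 0) {q : ℕ}
    (hq : q ≠ 0) (ω : Ω) : spread q (state P η z (t + 1) ω) = 0 := by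
  rw [state, localIterate_succ]
  exact spread_chainStep_of_sync ht hq _ _

variable {Ω : Type*} [MeasurableSpace Ω] {Pr : Measure Ω} {z : ℕ → Fin p.M → Ω → Z}

/-- The second and fourth moments tracked by the analysis are finite at time `t`. -/
structure FiniteMoments (Pr : Measure Ω) (xs : Space d) (X : Ω → Fin p.M → Space d) : Prop where
  err_two : Integrable (fun ω => err xs 2 (X ω)) Pr
  err_four : Integrable (fun ω => err xs 4 (X ω)) Pr
  spread_two : Integrable (fun ω => spread 2 (X ω)) Pr
  spread_four : Integrable (fun ω => spread 4 (X ω)) Pr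

variable [IsProbabilityMeasure Pr]

theorem err_next (ha : p.Admissible) (h : InClass p P xs) (hz : IsSampling Pr P.D z)
    (hμH : p.μ ≤ p.H) {η γ : ℝ} (hη : 0 < η) (hη2 : η ≤ 1 / (2 * p.H)) (hγ : 0 < γ) {t : ℕ}
    (hF : FiniteMoments Pr xs (state P η z t)) :
    (Integrable (fun ω => err xs 2 (state P η z (t + 1) ω)) Pr ∧
    ∫ ω, err xs 2 (state P η z (t + 1) ω) ∂Pr ≤
      (1 + γ) * (1 - η * p.μ) ^ 2 * ∫ ω, err xs 2 (state P η z t ω) ∂Pr +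
        (1 + 1 / γ) * η ^ 2 * (2 * p.τ ^ 2 * ∫ ω, spread 2 (state P η z t ω) ∂Pr +
          2 * p.Q ^ 2 * ∫ ω, spread 4 (state P η z t ω) ∂Pr) +
        η ^ 2 * p.σ₂ ^ 2 / p.M) ∧
    (Integrable (fun ω => err xs 4 (state P η z (t + 1) ω)) Pr ∧
    ∫ ω, err xs 4 (state P η z (t + 1) ω) ∂Pr ≤
      (1 + γ) ^ 4 * (1 - η * p.μ) ^ 4 * ∫ ω, err xs 4 (state P η z t ω) ∂Pr +
        (1 + γ) * (1 + 1 / γ) ^ 3 * η ^ 4 * (p.H ^ 4 * ∫ ω, spread 4 (state P η z t ω) ∂Pr) +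
        ((16 / γ + 8) * (η ^ 2 * p.σ₂ ^ 2 / p.M) ^ 2 + 3 * (η ^ 4 * p.σ₄ ^ 4 / p.M ^ 3))) := by
  have : ∀ m, IsProbabilityMeasure (P.D m) := fun m => (h.oracle m).1
  have hg : ∀ m, Measurable (Function.uncurry (P.g m)) := fun m => (h.oracle m).2.1
  have hb := mean_step_bounds ha h hμH hη hη2 hγ
  have i2 := (((hF.spread_two.const_mul (2 * p.τ ^ 2)).add
    (hF.spread_four.const_mul (2 * p.Q ^ 2))).const_mul ((1 + 1 / γ) * η ^ 2))
  have i2' := (hF.err_two.const_mul ((1 + γ) * (1 - η * p.μ) ^ 2)).add i2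
  have i4 := (hF.spread_four.const_mul (p.H ^ 4)).const_mul ((1 + γ) * (1 + 1 / γ) ^ 3 * η ^ 4)
  have i4' := (hF.err_four.const_mul ((1 + γ) ^ 4 * (1 - η * p.μ) ^ 4)).add i4
  have m2 := measurable_spread (d := d) (M := p.M) 2
  have m4 := measurable_spread (d := d) (M := p.M) 4
  have n2 := measurable_err (M := p.M) xs 2
  have n4 := measurable_err (M := p.M) xs 4
  constructor
  · obtain ⟨j, hj⟩ := hz.integral_next_le hg p.K η t (f := err xs 2)
      (g := fun s => (1 + γ) * (1 - η * p.μ) ^ 2 * err xs 2 s +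
        (1 + 1 / γ) * η ^ 2 * (2 * p.τ ^ 2 * spread 2 s + 2 * p.Q ^ 2 * spread 4 s) +
        η ^ 2 * p.σ₂ ^ 2 / p.M) n2 (err_nonneg xs 2)
      (fun s => by
        simp only [err_chainStep ha.M_pos]; exact memLp_integrable_norm_pow_two (hb s).1)
      (fun s => by simp only [err_chainStep ha.M_pos]; exact (hb s).2.1)
      (by fun_prop) (i2'.add (integrable_const _))
    refine ⟨j, hj.trans_eq ?_⟩
    refine (integral_add i2' (integrable_const _)).trans ?_
    rw [integral_add' (hF.err_two.const_mul _) i2, integral_const_mul, integral_const_mul,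
      integral_add' (hF.spread_two.const_mul _) (hF.spread_four.const_mul _), integral_const_mul,
      integral_const_mul]
    simp
  · obtain ⟨j, hj⟩ := hz.integral_next_le hg p.K η t (f := err xs 4)
      (g := fun s => (1 + γ) ^ 4 * (1 - η * p.μ) ^ 4 * err xs 4 s +
        (1 + γ) * (1 + 1 / γ) ^ 3 * η ^ 4 * (p.H ^ 4 * spread 4 s) +
        ((16 / γ + 8) * (η ^ 2 * p.σ₂ ^ 2 / p.M) ^ 2 + 3 * (η ^ 4 * p.σ₄ ^ 4 / p.M ^ 3)))
      n4 (err_nonneg xs 4)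
      (fun s => by
        simp only [err_chainStep ha.M_pos]; exact memLp_integrable_norm_pow_four (hb s).1)
      (fun s => by simp only [err_chainStep ha.M_pos]; exact (hb s).2.2)
      (by fun_prop) (i4'.add (integrable_const _))
    refine ⟨j, hj.trans_eq ?_⟩
    refine (integral_add i4' (integrable_const _)).trans ?_
    rw [integral_add' (hF.err_four.const_mul _) i4, integral_const_mul, integral_const_mul,
      integral_const_mul]
    simp

theorem spread_next (ha : p.Admissible) (h : InClass p P xs) (hz : IsSampling Pr P.D z)
    (hμH : p.μ ≤ p.H) {η θ : ℝ} (hη : 0 < η) (hη2 : η ≤ 1 / (2 * p.H)) (hθ : 0 < θ) {t : ℕ}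
    (ht : ¬(t + 1) % p.K = 0) (hF : FiniteMoments Pr xs (state P η z t)) :
    (Integrable (fun ω => spread 2 (state P η z (t + 1) ω)) Pr ∧
    ∫ ω, spread 2 (state P η z (t + 1) ω) ∂Pr ≤
      (1 + θ) * (1 - η * p.μ) ^ 2 * ∫ ω, spread 2 (state P η z t ω) ∂Pr +
        (1 + 1 / θ) * η ^ 2 * 4 * (p.H ^ 2 * p.ζ ^ 2 + p.τ ^ 2 * p.φ ^ 2 +
          p.τ ^ 2 * ∫ ω, err xs 2 (state P η z t ω) ∂Pr +
          p.τ ^ 2 * ∫ ω, spread 2 (state P η z t ω) ∂Pr) +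
        4 * η ^ 2 * p.σ₂ ^ 2) ∧
    (Integrable (fun ω => spread 4 (state P η z (t + 1) ω)) Pr ∧
    ∫ ω, spread 4 (state P η z (t + 1) ω) ∂Pr ≤
      (1 + θ) ^ 4 * (1 - η * p.μ) ^ 4 * ∫ ω, spread 4 (state P η z t ω) ∂Pr +
        (1 + θ) * (1 + 1 / θ) ^ 3 * η ^ 4 * 64 * (p.H ^ 4 * p.ζ ^ 4 +
          p.τ ^ 4 * p.φ ^ 4 + p.τ ^ 4 * ∫ ω, err xs 4 (state P η z t ω) ∂Pr +
          p.τ ^ 4 * ∫ ω, spread 4 (state P η z t ω) ∂Pr) +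
        (256 / θ + 176) * η ^ 4 * p.σ₄ ^ 4) := by
  have : ∀ m, IsProbabilityMeasure (P.D m) := fun m => (h.oracle m).1
  have hg : ∀ m, Measurable (Function.uncurry (P.g m)) := fun m => (h.oracle m).2.1
  have hb := spread_step_bounds ha h hμH hη hη2 hθ
  have m2 := measurable_spread (d := d) (M := p.M) 2
  have m4 := measurable_spread (d := d) (M := p.M) 4
  have n2 := measurable_err (M := p.M) xs 2
  have n4 := measurable_err (M := p.M) xs 4
  have key : ∀ (c0 c1 k x : ℝ) (q : ℕ), Integrable (fun ω => spread q (state P η z t ω)) Pr →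
      Integrable (fun ω => err xs q (state P η z t ω)) Pr →
      Integrable (fun ω => c0 * spread q (state P η z t ω) + c1 *
        (k + x * err xs q (state P η z t ω) + x * spread q (state P η z t ω))) Pr ∧
      ∫ ω, (c0 * spread q (state P η z t ω) + c1 *
        (k + x * err xs q (state P η z t ω) + x * spread q (state P η z t ω))) ∂Pr =
      c0 * ∫ ω, spread q (state P η z t ω) ∂Pr + c1 *
        (k + x * ∫ ω, err xs q (state P η z t ω) ∂Pr +
          x * ∫ ω, spread q (state P η z t ω) ∂Pr) := by
    intro c0 c1 k x q hs he
    have a1 : Integrable (fun ω => k + x * err xs q (state P η z t ω)) Pr :=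
      (integrable_const k).add (he.const_mul x)
    have a2 : Integrable (fun ω => k + x * err xs q (state P η z t ω) +
      x * spread q (state P η z t ω)) Pr := a1.add (hs.const_mul x)
    refine ⟨(hs.const_mul c0).add (a2.const_mul c1), ?_⟩
    rw [integral_add (hs.const_mul c0) (a2.const_mul c1), integral_const_mul, integral_const_mul,
      integral_add a1 (hs.const_mul x), integral_add (integrable_const k) (he.const_mul x),
      integral_const_mul, integral_const_mul]
    simp
  constructor
  · obtain ⟨k1, k2⟩ := key ((1 + θ) * (1 - η * p.μ) ^ 2) ((1 + 1 / θ) * η ^ 2 * 4)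
      (p.H ^ 2 * p.ζ ^ 2 + p.τ ^ 2 * p.φ ^ 2) (p.τ ^ 2) 2 hF.spread_two hF.err_two
    obtain ⟨j, hj⟩ := hz.integral_next_le hg p.K η t (f := spread 2)
      (g := fun s => (1 + θ) * (1 - η * p.μ) ^ 2 * spread 2 s +
        (1 + 1 / θ) * η ^ 2 * 4 * (p.H ^ 2 * p.ζ ^ 2 + p.τ ^ 2 * p.φ ^ 2 +
          p.τ ^ 2 * err xs 2 s + p.τ ^ 2 * spread 2 s) + 4 * η ^ 2 * p.σ₂ ^ 2)
      m2 (spread_nonneg 2)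
      (fun s => by simp only [spread_chainStep_of_not_sync ht]; exact (hb s).1.1)
      (fun s => by simp only [spread_chainStep_of_not_sync ht]; exact (hb s).1.2)
      (by fun_prop) (k1.add (integrable_const _))
    refine ⟨j, hj.trans_eq ((integral_add k1 (integrable_const _)).trans ?_)⟩
    rw [k2]; simp
  · obtain ⟨k1, k2⟩ := key ((1 + θ) ^ 4 * (1 - η * p.μ) ^ 4)
      ((1 + θ) * (1 + 1 / θ) ^ 3 * η ^ 4 * 64)
      (p.H ^ 4 * p.ζ ^ 4 + p.τ ^ 4 * p.φ ^ 4) (p.τ ^ 4) 4 hF.spread_four hF.err_four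
    obtain ⟨j, hj⟩ := hz.integral_next_le hg p.K η t (f := spread 4)
      (g := fun s => (1 + θ) ^ 4 * (1 - η * p.μ) ^ 4 * spread 4 s +
        (1 + θ) * (1 + 1 / θ) ^ 3 * η ^ 4 * 64 * (p.H ^ 4 * p.ζ ^ 4 + p.τ ^ 4 * p.φ ^ 4 +
          p.τ ^ 4 * err xs 4 s + p.τ ^ 4 * spread 4 s) + (256 / θ + 176) * η ^ 4 * p.σ₄ ^ 4)
      m4 (spread_nonneg 4)
      (fun s => by simp only [spread_chainStep_of_not_sync ht]; exact (hb s).2.1)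
      (fun s => by simp only [spread_chainStep_of_not_sync ht]; exact (hb s).2.2)
      (by fun_prop) (k1.add (integrable_const _))
    refine ⟨j, hj.trans_eq ((integral_add k1 (integrable_const _)).trans ?_)⟩
    rw [k2]; simp

theorem finiteMoments_state (ha : p.Admissible) (h : InClass p P xs) (hz : IsSampling Pr P.D z)
    (hμH : p.μ ≤ p.H) {η : ℝ} (hη : 0 < η) (hη2 : η ≤ 1 / (2 * p.H)) (t : ℕ) :
    FiniteMoments Pr xs (state P η z t) := by
  induction t with
  | zero =>
    exact ⟨integrable_const (err xs 2 fun _ => 0), integrable_const (err xs 4 fun _ => 0),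
      integrable_const (spread 2 fun _ => (0 : Space d)),
      integrable_const (spread 4 fun _ => (0 : Space d))⟩
  | succ t ih =>
    -- Only finiteness matters here, so the Young parameter is simply 1.
    obtain ⟨⟨e2, -⟩, ⟨e4, -⟩⟩ := err_next ha h hz hμH hη hη2 one_pos ih
    by_cases ht : (t + 1) % p.K = 0
    · refine ⟨e2, e4, ?_, ?_⟩ <;>
      simp [spread_next_of_sync η ht]
    · obtain ⟨⟨s2, -⟩, ⟨s4, -⟩⟩ := spread_next ha h hz hμH hη hη2 one_pos ht ih
      exact ⟨e2, e4, s2, s4⟩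

end Expectation

/-! ### A Gronwall inequality with periodic resets. -/

section Recursion

theorem one_add_div_pow_le_exp {c : ℝ} (hc : 0 ≤ c) {K j : ℕ} (hK : 0 < K) (hj : j ≤ K) :
    (1 + c / K) ^ j ≤ Real.exp c := by
  have hK' : (0 : ℝ) < K := by exact_mod_cast hK
  have h1 : 1 + c / K ≤ Real.exp (c / K) := by linarith [Real.add_one_le_exp (c / K)]
  calc (1 + c / K) ^ j ≤ (1 + c / K) ^ K :=
        pow_le_pow_right₀ (by linarith [div_nonneg hc hK'.le]) hj
    _ ≤ Real.exp (c / K) ^ K := by gcongr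
    _ = Real.exp c := by rw [← Real.exp_nat_mul]; congr 1; field_simp

/-- A discrete Gronwall inequality for an error `Φ` driven by a consensus error `Ψ` which is reset
to zero every `K` steps. -/
theorem coupled_recursion {K : ℕ} (hK : 0 < K) {Φ Ψ : ℕ → ℝ} {ρ ε Λ c G N X : ℝ}
    (hρ : 1 / 2 ≤ ρ) (hρ1 : ρ ≤ 1) (hε : 0 ≤ ε) (hΛ : 1 ≤ Λ) (hc : 0 ≤ c) (hG : 0 ≤ G)
    (hN : 0 ≤ N) (hX : 0 ≤ X) (hΦ0 : Φ 0 ≤ X) (hΨ0 : Ψ 0 = 0)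
    (hΦ : ∀ t, Φ (t + 1) ≤ (1 + 15 * (ε / Λ)) * ρ ^ 2 * Φ t + 16 * ε * Ψ t + N)
    (hsync : ∀ t, (t + 1) % K = 0 → Ψ (t + 1) = 0)
    (hΨ : ∀ t, ¬(t + 1) % K = 0 →
      Ψ (t + 1) ≤ (1 + c / K) * ρ ^ 2 * Ψ t + c / K * (Φ t / Λ + G)) (t : ℕ) :
    Φ t ≤ (1 + (15 + 256 * Real.exp c) * (ε / Λ)) ^ t *
      (ρ ^ (2 * t) * X + t * (64 * Real.exp c * ε * G + N)) := by
  have hK' : (0 : ℝ) < K := by exact_mod_cast hK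
  set γ := ε / Λ with hγ
  have hγ0 : 0 ≤ γ := by positivity
  set C := Real.exp c
  have hC : 0 < C := Real.exp_pos c
  set α := (15 + 256 * C) * γ with hα
  have hα0 : 0 ≤ α := by positivity
  set β := 64 * C * ε * G + N with hβ
  have hβ0 : 0 ≤ β := by positivity
  have hρ0 : 0 ≤ ρ := by linarith
  have hρ2 : 1 / 4 ≤ ρ ^ 2 := by nlinarith
  have hρ21 : ρ ^ 2 ≤ 1 := pow_le_one₀ hρ0 hρ1
  -- `U` is a supersolution of the error recursion in which the influence of Ψ has been absorbed
  -- into α and β.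
  set U : ℕ → ℝ := fun t => (1 + α) ^ t * (ρ ^ (2 * t) * X + t * β) with hU
  have hU0 : ∀ t, 0 ≤ U t := fun t => by positivity
  have hUs : ∀ t, (1 + α) * ρ ^ 2 * U t + β ≤ U (t + 1) := fun t => by
    have h1 : 1 ≤ (1 + α) ^ (t + 1) := one_le_pow₀ (by linarith)
    have h2 : 0 ≤ (1 + α) ^ (t + 1) * (t * β) := by positivity
    have e1 : (1 + α) * ρ ^ 2 * U t =
        (1 + α) ^ (t + 1) * (ρ ^ (2 * (t + 1)) * X) + ρ ^ 2 * ((1 + α) ^ (t + 1) * (t * β)) := by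
      simp only [hU]; ring
    have e2 : U (t + 1) = (1 + α) ^ (t + 1) * (ρ ^ (2 * (t + 1)) * X) +
        (1 + α) ^ (t + 1) * (t * β) + (1 + α) ^ (t + 1) * β := by
      simp only [hU]; push_cast; ring
    rw [e1, e2]
    nlinarith [mul_le_mul_of_nonneg_right h1 hβ0, mul_le_mul_of_nonneg_right hρ21 h2]
  have hUρ : ∀ t, ρ ^ 2 * U t ≤ U (t + 1) := fun t => by
    have : 0 ≤ α * (ρ ^ 2 * U t) := mul_nonneg hα0 (mul_nonneg (by positivity) (hU0 t))
    linarith [hUs t]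
  -- The bound on Ψ depends on the position in the round: it vanishes at a reset and never exceeds
  -- 4eᶜ(U/Λ + G). The factor 4 pays for ρ² ≥ 1/4 when U at time t is compared with U at time t + 1.
  have hmain : ∀ t, Φ t ≤ U t ∧ Ψ t ≤ 4 * ((1 + c / K) ^ (t % K) - 1) * (U t / Λ + G) := by
    intro t
    induction t with
    | zero => simp [hU, hΦ0, hΨ0]
    | succ t ih =>
      obtain ⟨ihΦ, ihΨ⟩ := ih
      have hV0 : 0 ≤ U t / Λ + G := by have := hU0 t; positivity
      have hq1 : 1 ≤ 1 + c / K := by linarith [div_nonneg hc hK'.le]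
      constructor
      · have hpow := one_add_div_pow_le_exp hc hK (Nat.mod_lt t hK).le
        have hΨC : Ψ t ≤ 4 * C * (U t / Λ + G) := by
          refine ihΨ.trans (mul_le_mul_of_nonneg_right ?_ hV0)
          linarith
        have e : ε * (U t / Λ) = γ * U t := by rw [hγ]; ring
        have hγU : γ * U t ≤ 4 * (γ * (ρ ^ 2 * U t)) := by
          have := mul_nonneg hγ0 (hU0 t)
          nlinarith
        calc Φ (t + 1) ≤ (1 + 15 * γ) * ρ ^ 2 * Φ t + 16 * ε * Ψ t + N := hΦ t
          _ ≤ (1 + 15 * γ) * ρ ^ 2 * U t + 16 * ε * (4 * C * (U t / Λ + G)) + N := by gcongr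
          _ = (1 + 15 * γ) * ρ ^ 2 * U t + 64 * C * (ε * (U t / Λ)) + β := by rw [hβ]; ring
          _ = (1 + 15 * γ) * ρ ^ 2 * U t + 64 * C * (γ * U t) + β := by rw [e]
          _ ≤ (1 + 15 * γ) * ρ ^ 2 * U t + 64 * C * (4 * (γ * (ρ ^ 2 * U t))) + β := by gcongr
          _ = (1 + α) * ρ ^ 2 * U t + β := by rw [hα]; ring
          _ ≤ U (t + 1) := hUs t
      · by_cases ht : (t + 1) % K = 0
        · rw [hsync t ht, ht]; simp
        · have hmod : (t + 1) % K = t % K + 1 := by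
            rcases Nat.lt_or_ge (t % K + 1) K with h | h
            · rw [Nat.add_mod, Nat.mod_eq_of_lt (a := 1) (by omega), Nat.mod_eq_of_lt h]
            · exfalso
              have h1 := Nat.mod_lt t hK
              have h2 : t % K + 1 = K := by omega
              apply ht
              rw [← Nat.mod_add_mod, h2, Nat.mod_self]
          rw [hmod]
          set q := (1 + c / K) ^ (t % K) with hq
          have hqge : 1 ≤ q := one_le_pow₀ hq1
          have hΛ0 : 0 < Λ := by linarith
          have hV1 : ρ ^ 2 * (U t / Λ + G) ≤ U (t + 1) / Λ + G := by
            have : ρ ^ 2 * (U t / Λ) ≤ U (t + 1) / Λ := by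
              rw [← mul_div_assoc]
              exact div_le_div_of_nonneg_right (hUρ t) hΛ0.le
            nlinarith
          have hV2 : U t / Λ + G ≤ 4 * (U (t + 1) / Λ + G) := by nlinarith
          calc Ψ (t + 1) ≤ (1 + c / K) * ρ ^ 2 * Ψ t + c / K * (Φ t / Λ + G) := hΨ t ht
            _ ≤ (1 + c / K) * ρ ^ 2 * (4 * (q - 1) * (U t / Λ + G)) +
                c / K * (U t / Λ + G) := by gcongr
            _ = (1 + c / K) * (4 * (q - 1)) * (ρ ^ 2 * (U t / Λ + G)) +
                c / K * (U t / Λ + G) := by ring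
            _ ≤ (1 + c / K) * (4 * (q - 1)) * (U (t + 1) / Λ + G) +
                c / K * (4 * (U (t + 1) / Λ + G)) := by
              have : 0 ≤ q - 1 := by linarith
              gcongr
            _ = 4 * ((1 + c / K) ^ (t % K + 1) - 1) * (U (t + 1) / Λ + G) := by
              rw [pow_succ, ← hq]; ring
  exact (hmain t).1

/-- The closed form of the coupled recursion over a horizon `T` with `ε T ≤ Λ`. -/
theorem coupled_recursion_horizon {K T : ℕ} (hK : 0 < K) {Φ Ψ : ℕ → ℝ} {ε Λ c G N X : ℝ}
    (hε : 0 ≤ ε) (hε2 : ε ≤ 1 / 2) (hΛ : 1 ≤ Λ) (hc : 0 ≤ c) (hG : 0 ≤ G)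
    (hN : 0 ≤ N) (hX : 0 ≤ X) (hT : ε * T ≤ Λ) (hΦ0 : Φ 0 ≤ X) (hΨ0 : Ψ 0 = 0)
    (hΦ : ∀ t, Φ (t + 1) ≤ (1 + 15 * (ε / Λ)) * (1 - ε) ^ 2 * Φ t + 16 * ε * Ψ t + N)
    (hsync : ∀ t, (t + 1) % K = 0 → Ψ (t + 1) = 0)
    (hΨ : ∀ t, ¬(t + 1) % K = 0 →
      Ψ (t + 1) ≤ (1 + c / K) * (1 - ε) ^ 2 * Ψ t + c / K * (Φ t / Λ + G)) :
    Φ T ≤ Real.exp (15 + 256 * Real.exp c) *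
      (Real.exp (-(2 * (ε * T))) * X + 64 * Real.exp c * (Λ * G) + T * N) := by
  have h := coupled_recursion hK (by linarith) (by linarith) hε hΛ hc hG hN hX hΦ0 hΨ0 hΦ hsync hΨ T
  have hΛ0 : 0 < Λ := by linarith
  refine h.trans ?_
  -- Growth by a multiple of ε/Λ per step stays bounded over the whole horizon because εT ≤ Λ.
  have h1 : (1 + (15 + 256 * Real.exp c) * (ε / Λ)) ^ T ≤ Real.exp (15 + 256 * Real.exp c) := by
    have h2 : 1 + (15 + 256 * Real.exp c) * (ε / Λ) ≤
        Real.exp ((15 + 256 * Real.exp c) * (ε / Λ)) := by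
      linarith [Real.add_one_le_exp ((15 + 256 * Real.exp c) * (ε / Λ))]
    calc _ ≤ Real.exp ((15 + 256 * Real.exp c) * (ε / Λ)) ^ T := by gcongr
      _ = Real.exp ((15 + 256 * Real.exp c) * (ε * T / Λ)) := by
          rw [← Real.exp_nat_mul]; congr 1; ring
      _ ≤ _ := by
          apply Real.exp_le_exp.2
          have : ε * T / Λ ≤ 1 := (div_le_one hΛ0).2 hT
          exact mul_le_of_le_one_right (by positivity) this
  have h3 : (1 - ε) ^ (2 * T) ≤ Real.exp (-(2 * (ε * T))) := by
    have h4 : 1 - ε ≤ Real.exp (-ε) := by linarith [Real.add_one_le_exp (-ε)]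
    calc (1 - ε) ^ (2 * T) ≤ Real.exp (-ε) ^ (2 * T) :=
          pow_le_pow_left₀ (by linarith) h4 _
      _ = _ := by rw [← Real.exp_nat_mul]; congr 1; push_cast; ring
  have h5 : T * (64 * Real.exp c * ε * G + N) ≤ 64 * Real.exp c * (Λ * G) + T * N := by
    calc T * (64 * Real.exp c * ε * G + N) = 64 * Real.exp c * ((ε * T) * G) + T * N := by ring
      _ ≤ _ := by gcongr
  have h6 : 0 ≤ (1 - ε) ^ (2 * T) := pow_nonneg (by linarith) _
  rw [add_assoc]
  gcongr

end Recursion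

/-! ### The combined potentials and their recursions. -/

section MainBound

/-- The per-round growth of the consensus error caused by heterogeneity and noise. -/
def consensusSource (p : Params) (η Λ : ℝ) : ℝ :=
  8 * Λ * (p.τ ^ 2 / p.μ ^ 2) * ((p.K * η) ^ 2 * (p.H ^ 2 * p.ζ ^ 2 + p.τ ^ 2 * p.φ ^ 2) +
    2 * Real.log p.K * (p.K * η ^ 2 * p.σ₂ ^ 2)) +
  1024 * Λ ^ 3 * (p.κ' / p.B ^ 2) *
    ((p.K * η) ^ 4 * (p.H ^ 4 * p.ζ ^ 4 + p.τ ^ 4 * p.φ ^ 4) +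
      2 * Real.log p.K * (p.K ^ 2 * η ^ 4 * p.σ₄ ^ 4))

/-- The per-step growth of the error of the average model caused by noise. -/
def noiseSource (p : Params) (η Λ : ℝ) : ℝ :=
  η ^ 2 * p.σ₂ ^ 2 / p.M + ((16 / (η * p.μ / Λ) + 8) * (η ^ 2 * p.σ₂ ^ 2 / p.M) ^ 2 +
    3 * (η ^ 4 * p.σ₄ ^ 4 / p.M ^ 3)) / p.B ^ 2

theorem Params.Admissible.two_le_κ' {p : Params} (ha : p.Admissible) : 2 ≤ p.κ' := by
  have := ha.μ_pos
  have : 0 ≤ 4 * p.Q ^ 2 * p.B ^ 2 / p.μ ^ 2 := by positivity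
  have : 0 ≤ 6 * p.H ^ 4 / p.μ ^ 4 := by positivity
  unfold Params.κ'; linarith

/-- From τ ≤ 2H the ratio is at most 4t with t = H²/μ², and 4t ≤ 2 + 6t². -/
theorem Params.Admissible.τ_sq_div_le {p : Params} (ha : p.Admissible) :
    p.τ ^ 2 / p.μ ^ 2 ≤ p.κ' := by
  have hμ := ha.μ_pos
  have h1 : p.τ ^ 2 / p.μ ^ 2 ≤ 4 * (p.H / p.μ) ^ 2 := by
    rw [div_pow, ← mul_div_assoc]
    gcongr
    nlinarith [ha.τ_nonneg, ha.τ_le]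
  have h2 : 6 * p.H ^ 4 / p.μ ^ 4 = 6 * ((p.H / p.μ) ^ 2) ^ 2 := by
    rw [div_pow, div_pow]; ring
  have : 0 ≤ 4 * p.Q ^ 2 * p.B ^ 2 / p.μ ^ 2 := by positivity
  unfold Params.κ'
  rw [h2]
  nlinarith [sq_nonneg ((p.H / p.μ) ^ 2 - 1 / 2)]

theorem Params.Admissible.Q_H_le {p : Params} (ha : p.Admissible) {Λ : ℝ} (hΛ : 1 ≤ Λ) :
    Λ * (p.Q ^ 2 / p.μ ^ 2) + Λ ^ 3 * (p.H ^ 4 / p.μ ^ 4 / p.B ^ 2) ≤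
      Λ ^ 3 * (p.κ' / p.B ^ 2) := by
  have hμ := ha.μ_pos
  have hB := ha.B_pos
  have e : p.κ' / p.B ^ 2 = 2 / p.B ^ 2 + 4 * (p.Q ^ 2 / p.μ ^ 2) +
      6 * (p.H ^ 4 / p.μ ^ 4 / p.B ^ 2) := by
    unfold Params.κ'; field_simp
  have h1 : Λ ≤ Λ ^ 3 := le_self_pow₀ hΛ (by norm_num)
  have q1 : 0 ≤ p.Q ^ 2 / p.μ ^ 2 := by positivity
  have q2 : 0 ≤ Λ ^ 3 * (p.H ^ 4 / p.μ ^ 4 / p.B ^ 2) := by positivity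
  have q3 : 0 ≤ Λ ^ 3 * (2 / p.B ^ 2) := by positivity
  have q4 : 0 ≤ Λ ^ 3 * (p.Q ^ 2 / p.μ ^ 2) := by positivity
  rw [e]
  nlinarith [mul_le_mul_of_nonneg_right h1 q1]

theorem one_add_pow_four_le {γ : ℝ} (h0 : 0 ≤ γ) (h1 : γ ≤ 1) : (1 + γ) ^ 4 ≤ 1 + 15 * γ := by
  have h2 : γ ^ 2 ≤ γ := by nlinarith
  have h3 : γ ^ 3 ≤ γ := by nlinarith
  have h4 : γ ^ 4 ≤ γ := by nlinarith
  nlinarith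

/-- One step of the recursion for the error of the average model, from the separate recursions of
its second and fourth moments. -/
theorem error_recursion {p : Params} (ha : p.Admissible) {η Λ : ℝ} (hη : 0 < η)
    (hε : η * p.μ ≤ 1 / 2) (hΛ : 1 ≤ Λ) {A A' E E' S T : ℝ} (hA : 0 ≤ A) (hE : 0 ≤ E)
    (hS : 0 ≤ S) (hT : 0 ≤ T)
    (hA' : A' ≤ (1 + η * p.μ / Λ) * (1 - η * p.μ) ^ 2 * A +
      (1 + 1 / (η * p.μ / Λ)) * η ^ 2 * (2 * p.τ ^ 2 * S + 2 * p.Q ^ 2 * T) +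
      η ^ 2 * p.σ₂ ^ 2 / p.M)
    (hE' : E' ≤ (1 + η * p.μ / Λ) ^ 4 * (1 - η * p.μ) ^ 4 * E +
      (1 + η * p.μ / Λ) * (1 + 1 / (η * p.μ / Λ)) ^ 3 * η ^ 4 * (p.H ^ 4 * T) +
      ((16 / (η * p.μ / Λ) + 8) * (η ^ 2 * p.σ₂ ^ 2 / p.M) ^ 2 +
        3 * (η ^ 4 * p.σ₄ ^ 4 / p.M ^ 3))) :
    A' + E' / p.B ^ 2 ≤ (1 + 15 * (η * p.μ / Λ)) * (1 - η * p.μ) ^ 2 * (A + E / p.B ^ 2) +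
      16 * (η * p.μ) * (Λ * (p.τ ^ 2 / p.μ ^ 2) * S + Λ ^ 3 * (p.κ' / p.B ^ 2) * T) +
      noiseSource p η Λ := by
  have hμ := ha.μ_pos
  have hB := ha.B_pos
  have hΛ0 : 0 < Λ := by linarith
  -- Young's inequality costs 1/γ = Λ/(ημ) in the second moment and its cube in the fourth; this
  -- fixes the weights Λ and Λ³ of the spreads.
  set γ := η * p.μ / Λ with hγ
  have hγ0 : 0 < γ := by positivity
  have hγ1 : γ ≤ 1 := by
    rw [hγ, div_le_one hΛ0]; linarith
  have hinv : 1 + 1 / γ ≤ 2 * (1 / γ) := by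
    have : 1 ≤ 1 / γ := by rw [le_div_iff₀ hγ0]; linarith
    linarith
  have hr2 : (1 - η * p.μ) ^ 2 ≤ 1 :=
    pow_le_one₀ (by linarith) (by linarith [mul_pos hη hμ])
  have hr4 : (1 - η * p.μ) ^ 4 ≤ (1 - η * p.μ) ^ 2 := by
    have : (1 - η * p.μ) ^ 4 = (1 - η * p.μ) ^ 2 * (1 - η * p.μ) ^ 2 := by ring
    rw [this]
    exact mul_le_of_le_one_left (sq_nonneg _) hr2
  have a1 : (1 + γ) * (1 - η * p.μ) ^ 2 * A ≤ (1 + 15 * γ) * (1 - η * p.μ) ^ 2 * A := by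
    gcongr; linarith
  have a2 : (1 + 1 / γ) * η ^ 2 * (2 * p.τ ^ 2 * S + 2 * p.Q ^ 2 * T) ≤
      16 * (η * p.μ) * (Λ * (p.τ ^ 2 / p.μ ^ 2) * S + Λ * (p.Q ^ 2 / p.μ ^ 2) * T) := by
    calc _ ≤ 2 * (1 / γ) * η ^ 2 * (2 * p.τ ^ 2 * S + 2 * p.Q ^ 2 * T) := by gcongr
      _ = 4 * (η * p.μ) * (Λ * (p.τ ^ 2 / p.μ ^ 2) * S + Λ * (p.Q ^ 2 / p.μ ^ 2) * T) := by
        rw [hγ]; field_simp; ring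
      _ ≤ _ := by gcongr; norm_num
  have b1 : (1 + γ) ^ 4 * (1 - η * p.μ) ^ 4 * E ≤ (1 + 15 * γ) * (1 - η * p.μ) ^ 2 * E := by
    have := one_add_pow_four_le hγ0.le hγ1
    gcongr
  have b2 : (1 + γ) * (1 + 1 / γ) ^ 3 * η ^ 4 * (p.H ^ 4 * T) ≤
      16 * (η * p.μ) * (Λ ^ 3 * (p.H ^ 4 / p.μ ^ 4) * T) := by
    calc _ ≤ 2 * (2 * (1 / γ)) ^ 3 * η ^ 4 * (p.H ^ 4 * T) := by gcongr; linarith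
      _ = _ := by rw [hγ]; field_simp; ring
  have c1 := mul_le_mul_of_nonneg_right (ha.Q_H_le hΛ) hT
  have c2 : E' / p.B ^ 2 ≤ ((1 + 15 * γ) * (1 - η * p.μ) ^ 2 * E +
      16 * (η * p.μ) * (Λ ^ 3 * (p.H ^ 4 / p.μ ^ 4) * T) +
      ((16 / γ + 8) * (η ^ 2 * p.σ₂ ^ 2 / p.M) ^ 2 + 3 * (η ^ 4 * p.σ₄ ^ 4 / p.M ^ 3))) /
        p.B ^ 2 := by
    refine div_le_div_of_nonneg_right ?_ (by positivity)
    linarith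
  have c3 := mul_le_mul_of_nonneg_left c1 (by positivity : 0 ≤ 16 * (η * p.μ))
  calc A' + E' / p.B ^ 2 ≤ ((1 + 15 * γ) * (1 - η * p.μ) ^ 2 * A +
        16 * (η * p.μ) * (Λ * (p.τ ^ 2 / p.μ ^ 2) * S + Λ * (p.Q ^ 2 / p.μ ^ 2) * T) +
        η ^ 2 * p.σ₂ ^ 2 / p.M) + _ := add_le_add (by linarith) c2
    _ = (1 + 15 * γ) * (1 - η * p.μ) ^ 2 * (A + E / p.B ^ 2) +
        16 * (η * p.μ) * (Λ * (p.τ ^ 2 / p.μ ^ 2) * S) + 16 * (η * p.μ) *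
        ((Λ * (p.Q ^ 2 / p.μ ^ 2) + Λ ^ 3 * (p.H ^ 4 / p.μ ^ 4 / p.B ^ 2)) * T) +
        noiseSource p η Λ := by rw [noiseSource, ← hγ]; ring
    _ ≤ (1 + 15 * γ) * (1 - η * p.μ) ^ 2 * (A + E / p.B ^ 2) +
        16 * (η * p.μ) * (Λ * (p.τ ^ 2 / p.μ ^ 2) * S) + 16 * (η * p.μ) *
        (Λ ^ 3 * (p.κ' / p.B ^ 2) * T) + noiseSource p η Λ := by gcongr
    _ = _ := by ring

/-- Lets every noise term of the spread carry a factor ln K. For K = 1 each step is a reset, so no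
spread arises and the vanishing logarithm is harmless. -/
theorem one_le_two_mul_log {K : ℕ} (hK : 2 ≤ K) : 1 ≤ 2 * Real.log K := by
  have h1 : Real.log 2 ≤ Real.log K := Real.log_le_log (by norm_num) (by exact_mod_cast hK)
  linarith [Real.log_two_gt_d9]

/-- The Young parameter is 1/K, so a whole round costs a bounded factor. The feedback of S through τ
is absorbed into the contraction since (1 - ε)² ≥ 1/4. -/
theorem spread_two_recursion {K : ℕ} (hK : 2 ≤ K) {η ε τ D A S S' σ : ℝ}
    (hε : ε ≤ 1 / 2) (hD : 0 ≤ D) (hA : 0 ≤ A) (hS : 0 ≤ S)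
    (hτ : (K * η * τ) ^ 2 ≤ 1 / 2)
    (hS' : S' ≤ (1 + 1 / (K : ℝ)) * (1 - ε) ^ 2 * S +
      (1 + 1 / (1 / (K : ℝ))) * η ^ 2 * 4 * (D + τ ^ 2 * A + τ ^ 2 * S) + 4 * η ^ 2 * σ ^ 2) :
    S' ≤ (1 + 1040 / (K : ℝ)) * (1 - ε) ^ 2 * S + 8 / K * ((K * η * τ) ^ 2 * A +
      ((K * η) ^ 2 * D + 2 * Real.log K * (K * η ^ 2 * σ ^ 2))) := by
  have hK2 : (2 : ℝ) ≤ K := by exact_mod_cast hK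
  have hK0 : (0 : ℝ) < K := by linarith
  have hr : 1 / 4 ≤ (1 - ε) ^ 2 := by nlinarith
  have hl := one_le_two_mul_log hK
  have h1 : (1 + 1 / (1 / (K : ℝ))) * η ^ 2 * 4 * (D + τ ^ 2 * A + τ ^ 2 * S) ≤
      8 / K * ((K * η) ^ 2 * D + (K * η * τ) ^ 2 * A + (K * η * τ) ^ 2 * S) := by
    rw [one_div_one_div]
    calc _ ≤ (K + K) * η ^ 2 * 4 * (D + τ ^ 2 * A + τ ^ 2 * S) := by gcongr; linarith
      _ = _ := by field_simp; ring
  have h2 : 8 / K * ((K * η * τ) ^ 2 * S) ≤ 16 / K * ((1 - ε) ^ 2 * S) := by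
    calc 8 / K * ((K * η * τ) ^ 2 * S) ≤ 8 / K * (1 / 2 * S) := by gcongr
      _ = 16 / K * (1 / 4 * S) := by ring
      _ ≤ _ := by gcongr
  have h3 : 4 * η ^ 2 * σ ^ 2 ≤ 8 / K * (2 * Real.log K * (K * η ^ 2 * σ ^ 2)) := by
    calc 4 * η ^ 2 * σ ^ 2 ≤ 8 * η ^ 2 * σ ^ 2 * 1 := by nlinarith [mul_nonneg (sq_nonneg η) (sq_nonneg σ)]
      _ ≤ 8 * η ^ 2 * σ ^ 2 * (2 * Real.log K) := by gcongr
      _ = _ := by field_simp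
  -- Padding: 1 + 16 + 1023 = 1040 matches the fourth-moment rate 15 + 1024 + 1, so that both
  -- spreads share one growth factor.
  have h4 : 0 ≤ 1023 / K * ((1 - ε) ^ 2 * S) := by positivity
  calc S' ≤ (1 + 1 / (K : ℝ)) * (1 - ε) ^ 2 * S +
      8 / K * ((K * η) ^ 2 * D + (K * η * τ) ^ 2 * A) + 8 / K * ((K * η * τ) ^ 2 * S) +
      4 * η ^ 2 * σ ^ 2 := by linarith
    _ ≤ (1 + 1 / (K : ℝ)) * (1 - ε) ^ 2 * S +
      8 / K * ((K * η) ^ 2 * D + (K * η * τ) ^ 2 * A) + 16 / K * ((1 - ε) ^ 2 * S) +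
      8 / K * (2 * Real.log K * (K * η ^ 2 * σ ^ 2)) + 1023 / K * ((1 - ε) ^ 2 * S) := by linarith
    _ = _ := by ring

theorem spread_four_recursion {K : ℕ} (hK : 2 ≤ K) {η ε τ D A S S' σ : ℝ}
    (hε0 : 0 ≤ ε) (hε : ε ≤ 1 / 2) (hD : 0 ≤ D) (hA : 0 ≤ A) (hS : 0 ≤ S)
    (hτ : (K * η * τ) ^ 2 ≤ 1 / 2)
    (hS' : S' ≤ (1 + 1 / (K : ℝ)) ^ 4 * (1 - ε) ^ 4 * S +
      (1 + 1 / (K : ℝ)) * (1 + 1 / (1 / (K : ℝ))) ^ 3 * η ^ 4 * 64 *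
        (D + τ ^ 4 * A + τ ^ 4 * S) + (256 / (1 / (K : ℝ)) + 176) * η ^ 4 * σ ^ 4) :
    S' ≤ (1 + 1040 / (K : ℝ)) * (1 - ε) ^ 2 * S + 1024 / K * ((K * η * τ) ^ 4 * A +
      ((K * η) ^ 4 * D + 2 * Real.log K * (K ^ 2 * η ^ 4 * σ ^ 4))) := by
  have hK2 : (2 : ℝ) ≤ K := by exact_mod_cast hK
  have hK0 : (0 : ℝ) < K := by linarith
  have hK1 : 1 / (K : ℝ) ≤ 1 := by rw [div_le_one hK0]; linarith
  have hr : 1 / 4 ≤ (1 - ε) ^ 2 := by nlinarith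
  have hr1 : (1 - ε) ^ 2 ≤ 1 := pow_le_one₀ (by linarith) (by linarith)
  have hr4 : (1 - ε) ^ 4 ≤ (1 - ε) ^ 2 := by
    have : (1 - ε) ^ 4 = (1 - ε) ^ 2 * (1 - ε) ^ 2 := by ring
    rw [this]
    exact mul_le_of_le_one_left (sq_nonneg _) hr1
  have hτ4 : (K * η * τ) ^ 4 ≤ 1 / 4 := by
    calc (K * η * τ) ^ 4 = ((K * η * τ) ^ 2) ^ 2 := by ring
      _ ≤ (1 / 2) ^ 2 := by gcongr
      _ = _ := by norm_num
  have hl := one_le_two_mul_log hK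
  have h0 : (1 + 1 / (K : ℝ)) ^ 4 * (1 - ε) ^ 4 * S ≤
      (1 + 15 * (1 / (K : ℝ))) * (1 - ε) ^ 2 * S := by
    have := one_add_pow_four_le (by positivity : 0 ≤ 1 / (K : ℝ)) hK1
    gcongr
  have h1 : (1 + 1 / (K : ℝ)) * (1 + 1 / (1 / (K : ℝ))) ^ 3 * η ^ 4 * 64 *
        (D + τ ^ 4 * A + τ ^ 4 * S) ≤
      1024 / K * ((K * η) ^ 4 * D + (K * η * τ) ^ 4 * A + (K * η * τ) ^ 4 * S) := by
    rw [one_div_one_div]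
    calc _ ≤ (1 + 1) * (K + K) ^ 3 * η ^ 4 * 64 * (D + τ ^ 4 * A + τ ^ 4 * S) := by
          gcongr; linarith
      _ = _ := by field_simp; ring
  have h2 : 1024 / K * ((K * η * τ) ^ 4 * S) ≤ 1024 / K * ((1 - ε) ^ 2 * S) := by
    gcongr; linarith
  have h3 : (256 / (1 / (K : ℝ)) + 176) * η ^ 4 * σ ^ 4 ≤
      1024 / K * (2 * Real.log K * (K ^ 2 * η ^ 4 * σ ^ 4)) := by
    have e : 256 / (1 / (K : ℝ)) = 256 * K := by field_simp
    rw [e]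
    calc (256 * (K : ℝ) + 176) * η ^ 4 * σ ^ 4 ≤ 1024 * K * η ^ 4 * σ ^ 4 * 1 := by
          rw [mul_one]; gcongr; linarith
      _ ≤ 1024 * K * η ^ 4 * σ ^ 4 * (2 * Real.log K) := by gcongr
      _ = _ := by field_simp
  have h4 : 0 ≤ 1 / K * ((1 - ε) ^ 2 * S) := by positivity
  calc S' ≤ (1 + 15 * (1 / (K : ℝ))) * (1 - ε) ^ 2 * S +
      1024 / K * ((K * η) ^ 4 * D + (K * η * τ) ^ 4 * A) + 1024 / K * ((1 - ε) ^ 2 * S) +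
      1024 / K * (2 * Real.log K * (K ^ 2 * η ^ 4 * σ ^ 4)) + 1 / K * ((1 - ε) ^ 2 * S) := by
        linarith
    _ = _ := by ring

/-- One step of the recursion for the consensus error, from the separate recursions of its second
and fourth moments. -/
theorem consensus_recursion {p : Params} (ha : p.Admissible) (hK : 2 ≤ p.K) {η Λ : ℝ} (hη : 0 < η)
    (hΛ : 1 ≤ Λ) (hκ : p.κ' * (p.K * η * p.τ) ^ 2 * Λ ^ 2 ≤ 1) {A E S S' T T' r : ℝ}
    (hA : 0 ≤ A) (hE : 0 ≤ E)
    (hS' : S' ≤ (1 + 1040 / (p.K : ℝ)) * r * S + 8 / p.K * ((p.K * η * p.τ) ^ 2 * A +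
      ((p.K * η) ^ 2 * (p.H ^ 2 * p.ζ ^ 2 + p.τ ^ 2 * p.φ ^ 2) +
        2 * Real.log p.K * (p.K * η ^ 2 * p.σ₂ ^ 2))))
    (hT' : T' ≤ (1 + 1040 / (p.K : ℝ)) * r * T + 1024 / p.K * ((p.K * η * p.τ) ^ 4 * E +
      ((p.K * η) ^ 4 * (p.H ^ 4 * p.ζ ^ 4 + p.τ ^ 4 * p.φ ^ 4) +
        2 * Real.log p.K * (p.K ^ 2 * η ^ 4 * p.σ₄ ^ 4)))) :
    Λ * (p.τ ^ 2 / p.μ ^ 2) * S' + Λ ^ 3 * (p.κ' / p.B ^ 2) * T' ≤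
      (1 + 1040 / (p.K : ℝ)) * r * (Λ * (p.τ ^ 2 / p.μ ^ 2) * S + Λ ^ 3 * (p.κ' / p.B ^ 2) * T) +
        1040 / p.K * ((A + E / p.B ^ 2) / Λ + consensusSource p η Λ) := by
  have hμ := ha.μ_pos
  have hB := ha.B_pos
  have hΛ0 : 0 < Λ := by linarith
  have hK0 : (0 : ℝ) < p.K := by exact_mod_cast ha.K_pos
  have hκ2 := ha.two_le_κ'
  have hlog : 0 ≤ Real.log p.K := Real.log_natCast_nonneg _
  set x := p.K * η * p.τ with hx
  have hx2 : 0 ≤ x ^ 2 := sq_nonneg x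
  have hx1 : Λ * x ^ 2 ≤ 1 / Λ := by
    rw [le_div_iff₀ hΛ0]
    nlinarith [mul_nonneg hx2 (sq_nonneg Λ)]
  -- The weights of Ψ cost Λ and Λ³, yet the coupling hypothesis leaves feedback of only 1/Λ for
  -- both moments; this is what the Gronwall inequality needs.
  have c1 : Λ * (p.τ ^ 2 / p.μ ^ 2) * x ^ 2 ≤ 1 / Λ := by
    calc Λ * (p.τ ^ 2 / p.μ ^ 2) * x ^ 2 ≤ Λ * p.κ' * x ^ 2 := by
          have := ha.τ_sq_div_le
          gcongr
      _ ≤ 1 / Λ := by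
          rw [le_div_iff₀ hΛ0]; linarith
  have c2 : Λ ^ 3 * p.κ' * x ^ 4 ≤ 1 / Λ := by
    calc Λ ^ 3 * p.κ' * x ^ 4 = (p.κ' * x ^ 2 * Λ ^ 2) * (Λ * x ^ 2) := by ring
      _ ≤ 1 * (1 / Λ) := by gcongr
      _ = _ := one_mul _
  have hG0 : 0 ≤ consensusSource p η Λ := by
    unfold consensusSource; positivity
  have d1 : Λ * (p.τ ^ 2 / p.μ ^ 2) * S' ≤ _ := mul_le_mul_of_nonneg_left hS' (by positivity)
  have d2 : Λ ^ 3 * (p.κ' / p.B ^ 2) * T' ≤ _ := mul_le_mul_of_nonneg_left hT' (by positivity)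
  have e1 : 8 / p.K * ((Λ * (p.τ ^ 2 / p.μ ^ 2) * x ^ 2) * A) ≤ 1040 / p.K * (A / Λ) := by
    calc _ ≤ 1040 / p.K * ((1 / Λ) * A) := by gcongr; norm_num
      _ = _ := by ring
  have e2 : 1024 / p.K * ((Λ ^ 3 * p.κ' * x ^ 4) * (E / p.B ^ 2)) ≤
      1040 / p.K * (E / p.B ^ 2 / Λ) := by
    calc _ ≤ 1040 / p.K * ((1 / Λ) * (E / p.B ^ 2)) := by gcongr; norm_num
      _ = _ := by ring
  have e3 : 1 / p.K * consensusSource p η Λ ≤ 1040 / p.K * consensusSource p η Λ := by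
    gcongr; norm_num
  calc _ ≤ (1 + 1040 / (p.K : ℝ)) * r * (Λ * (p.τ ^ 2 / p.μ ^ 2) * S +
        Λ ^ 3 * (p.κ' / p.B ^ 2) * T) + 8 / p.K * ((Λ * (p.τ ^ 2 / p.μ ^ 2) * x ^ 2) * A) +
        1024 / p.K * ((Λ ^ 3 * p.κ' * x ^ 4) * (E / p.B ^ 2)) +
        1 / p.K * consensusSource p η Λ := by
        refine (add_le_add d1 d2).trans_eq ?_
        rw [consensusSource]; ring
    _ ≤ (1 + 1040 / (p.K : ℝ)) * r * (Λ * (p.τ ^ 2 / p.μ ^ 2) * S +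
        Λ ^ 3 * (p.κ' / p.B ^ 2) * T) + 1040 / p.K * (A / Λ) + 1040 / p.K * (E / p.B ^ 2 / Λ) +
        1040 / p.K * consensusSource p η Λ := by gcongr
    _ = _ := by ring

end MainBound

/-! ### The error after KR steps for a general step size. -/

section FiniteHorizon

variable {d : ℕ} {Z : Type*} [MeasurableSpace Z] {p : Params} {P : Problem d p.M Z} {xs : Space d}
  {Ω : Type*} [MeasurableSpace Ω] {Pr : Measure Ω} [IsProbabilityMeasure Pr]
  {z : ℕ → Fin p.M → Ω → Z}

theorem Params.Admissible.consensusSource_nonneg (ha : p.Admissible) {η Λ : ℝ} (hΛ : 0 ≤ Λ) :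
    0 ≤ consensusSource p η Λ := by
  have := ha.two_le_κ'
  have hlog : 0 ≤ Real.log p.K := Real.log_natCast_nonneg _
  unfold consensusSource
  positivity

theorem Params.Admissible.noiseSource_nonneg (ha : p.Admissible) {η Λ : ℝ} (hη : 0 ≤ η)
    (hΛ : 0 ≤ Λ) : 0 ≤ noiseSource p η Λ := by
  have := ha.μ_pos
  unfold noiseSource
  positivity

theorem memLp_finalError (ha : p.Admissible) (h : InClass p P xs) (hz : IsSampling Pr P.D z)
    (hμH : p.μ ≤ p.H) {η : ℝ} (hη : 0 < η) (hη2 : η ≤ 1 / (2 * p.H)) :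
    MemLp (finalError p P xs η z) 4 Pr := by
  have hF := finiteMoments_state ha h hz hμH hη hη2 (p.K * p.R)
  have hm : Measurable (finalError p P xs η z) :=
    (measurable_mean.comp (hz.measurable_localIterate (fun m => (h.oracle m).2.1) p.K η
      (p.K * p.R))).sub_const xs
  refine (integrable_norm_rpow_iff hm.aestronglyMeasurable (by norm_num) (by norm_num)).1
    (hF.err_four.congr (Filter.Eventually.of_forall fun ω => ?_))
  rw [ENNReal.toReal_ofNat]
  exact (Real.rpow_ofNat ‖finalError p P xs η z ω‖ 4).symm

/-- The error of Local SGD for a general step size. -/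
theorem totalError_le (ha : p.Admissible) (h : InClass p P xs) (hz : IsSampling Pr P.D z)
    (hμH : p.μ ≤ p.H) {η Λ : ℝ} (hη : 0 < η) (hη2 : η ≤ 1 / (2 * p.H)) (hΛ : 1 ≤ Λ)
    (hT : η * p.μ * p.K * p.R ≤ Λ) (hκ : p.κ' * (p.K * η * p.τ) ^ 2 * Λ ^ 2 ≤ 1) :
    totalError p P xs η Pr z ≤ Real.exp (15 + 256 * Real.exp 1040) *
      (Real.exp (-(2 * (η * p.μ * p.K * p.R))) * (2 * p.B ^ 2) +
        64 * Real.exp 1040 * (Λ * consensusSource p η Λ) +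
        (p.K * p.R) * noiseSource p η Λ) := by
  have hμ := ha.μ_pos
  have hB := ha.B_pos
  have hΛ0 : 0 < Λ := by linarith
  have hκ2 := ha.two_le_κ'
  have hηH : η * p.H ≤ 1 / 2 := by
    have := mul_le_mul_of_nonneg_right hη2 ha.H_pos.le
    rwa [one_div_mul_eq_div, div_mul_cancel_right₀ ha.H_pos.ne', ← one_div] at this
  have hε : η * p.μ ≤ 1 / 2 := (mul_le_mul_of_nonneg_left hμH hη.le).trans hηH
  have hx : (p.K * η * p.τ) ^ 2 ≤ 1 / 2 := by
    have h1 : 1 ≤ Λ ^ 2 := one_le_pow₀ hΛ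
    have h2 : 2 * (p.K * η * p.τ) ^ 2 * 1 ≤ p.κ' * (p.K * η * p.τ) ^ 2 * Λ ^ 2 := by gcongr
    linarith
  have hF := finiteMoments_state ha h hz hμH hη hη2
  set A : ℕ → ℝ := fun t => ∫ ω, err xs 2 (state P η z t ω) ∂Pr with hA
  set E : ℕ → ℝ := fun t => ∫ ω, err xs 4 (state P η z t ω) ∂Pr with hE
  set S : ℕ → ℝ := fun t => ∫ ω, spread 2 (state P η z t ω) ∂Pr with hS
  set T : ℕ → ℝ := fun t => ∫ ω, spread 4 (state P η z t ω) ∂Pr with hT'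
  have hA0 : ∀ t, 0 ≤ A t := fun t => integral_nonneg fun ω => err_nonneg _ _ _
  have hE0 : ∀ t, 0 ≤ E t := fun t => integral_nonneg fun ω => err_nonneg _ _ _
  have hS0 : ∀ t, 0 ≤ S t := fun t => integral_nonneg fun ω => spread_nonneg _ _
  have hT0 : ∀ t, 0 ≤ T t := fun t => integral_nonneg fun ω => spread_nonneg _ _
  have he0 : ∀ q, ∫ ω, err xs q (state P η z 0 ω) ∂Pr ≤ p.B ^ q := fun q => by
    have h1 : ∀ ω, err xs q (state P η z 0 ω) = ‖xs‖ ^ q := fun ω => by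
      simp [err, state, Problem.localIterate, mean]
    simp only [h1, integral_const, probReal_univ, one_smul]
    exact pow_le_pow_left₀ (norm_nonneg _) h.bounded_optimum q
  have hs0 : ∀ q, q ≠ 0 → ∫ ω, spread q (state P η z 0 ω) ∂Pr = 0 := fun q hq => by
    have h1 : ∀ ω, spread q (state P η z 0 ω) = 0 := fun ω => by
      simp [spread, av, state, Problem.localIterate, hq]
    simp only [h1, integral_zero]
  have hmain := coupled_recursion_horizon (T := p.K * p.R) ha.K_pos
    (Φ := fun t => A t + E t / p.B ^ 2)
    (Ψ := fun t => Λ * (p.τ ^ 2 / p.μ ^ 2) * S t + Λ ^ 3 * (p.κ' / p.B ^ 2) * T t)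
    (ε := η * p.μ) (Λ := Λ) (c := 1040) (G := consensusSource p η Λ) (N := noiseSource p η Λ)
    (X := 2 * p.B ^ 2) (by positivity) hε hΛ (by norm_num) (ha.consensusSource_nonneg hΛ0.le)
    (ha.noiseSource_nonneg hη.le hΛ0.le) (by positivity)
    (by push_cast; rw [← mul_assoc]; exact hT)
    -- The start at 0 gives A ≤ B² and E/B² ≤ B⁴/B², hence the initial value 2B².
    (by
      have h1 : E 0 / p.B ^ 2 ≤ p.B ^ 4 / p.B ^ 2 :=
        div_le_div_of_nonneg_right (he0 4) (by positivity)
      have h2 : p.B ^ 4 / p.B ^ 2 = p.B ^ 2 := by field_simp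
      have h3 := he0 2
      show A 0 + E 0 / p.B ^ 2 ≤ _
      linarith)
    (by
      have h1 : S 0 = 0 := hs0 2 (by norm_num)
      have h2 : T 0 = 0 := hs0 4 (by norm_num)
      simp only [h1, h2, mul_zero, add_zero])
    (fun t => by
      obtain ⟨⟨-, h2⟩, ⟨-, h4⟩⟩ := err_next ha h hz hμH hη hη2
        (γ := η * p.μ / Λ) (by positivity) (hF t)
      exact error_recursion ha hη hε hΛ (hA0 t) (hE0 t) (hS0 t) (hT0 t) h2 h4)
    (fun t ht => by
      have h1 : S (t + 1) = 0 := by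
        simp only [hS, spread_next_of_sync η ht two_ne_zero, integral_zero]
      have h2 : T (t + 1) = 0 := by
        simp only [hT', spread_next_of_sync η ht four_ne_zero, integral_zero]
      simp only [h1, h2, mul_zero, add_zero])
    (fun t ht => by
      have hK0 := ha.K_pos
      have hK : 2 ≤ p.K := by
        by_contra hK
        have h1 : p.K = 1 := by omega
        exact ht (by rw [h1]; exact Nat.mod_one _)
      have hK0 : (0 : ℝ) < p.K := by exact_mod_cast ha.K_pos
      obtain ⟨⟨-, h2⟩, ⟨-, h4⟩⟩ := spread_next ha h hz hμH hη hη2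
        (θ := 1 / (p.K : ℝ)) (by positivity) ht (hF t)
      exact consensus_recursion ha hK hη hΛ hκ (hA0 t) (hE0 t)
        (spread_two_recursion hK hε (by positivity) (hA0 t) (hS0 t) hx h2)
        (spread_four_recursion hK (by positivity) hε (by positivity) (hE0 t) (hT0 t) hx h4))
  have e : totalError p P xs η Pr z = A (p.K * p.R) + E (p.K * p.R) / p.B ^ 2 := by
    rw [totalError, one_div_mul_eq_div]
    rfl
  rw [e]
  refine hmain.trans_eq ?_
  push_cast
  ring_nf

end FiniteHorizon

/-! ### Comparison of the source terms with the summands of the rate. -/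

section Tuning

theorem le_foldr_max {a x : ℝ} {l : List ℝ} (hx : x ∈ l) : x ≤ l.foldr max a := by
  induction l with
  | nil => simp at hx
  | cons y l ih =>
    rcases List.mem_cons.1 hx with rfl | h
    · exact le_max_left _ _
    · exact (ih h).trans (le_max_right _ _)

theorem base_le_foldr_max (a : ℝ) (l : List ℝ) : a ≤ l.foldr max a := by
  induction l with
  | nil => exact le_rfl
  | cons y l ih => exact ih.trans (le_max_right _ _)

theorem foldr_max_le {a b : ℝ} {l : List ℝ} (ha : a ≤ b) (hl : ∀ x ∈ l, x ≤ b) :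
    l.foldr max a ≤ b := by
  induction l with
  | nil => exact ha
  | cons y l ih =>
    exact max_le (hl y (by simp)) (ih fun x hx => hl x (by simp [hx]))

variable {p : Params}

theorem Params.Admissible.rateTerms_nonneg (ha : p.Admissible) : ∀ x ∈ p.rateTerms, 0 ≤ x := by
  have hμ := ha.μ_pos
  have hκ : 0 ≤ p.κ' := by linarith [ha.two_le_κ']
  have hlog : 0 ≤ Real.log p.K := Real.log_natCast_nonneg _
  simp only [Params.rateTerms, List.forall_mem_cons, List.not_mem_nil, false_imp_iff, implies_true,
    and_true]
  refine ⟨?_, ?_, ?_, ?_, ?_, ?_, ?_, ?_, ?_, ?_, ?_, ?_, ?_, ?_⟩ <;> positivity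

theorem Params.Admissible.le_rate (ha : p.Admissible) {x : ℝ} (hx : x ∈ p.rateTerms) :
    x ≤ p.rate :=
  List.single_le_sum ha.rateTerms_nonneg x hx

theorem Params.Admissible.rate_nonneg (ha : p.Admissible) : 0 ≤ p.rate :=
  List.sum_nonneg ha.rateTerms_nonneg

theorem Params.Admissible.accuracy_le (ha : p.Admissible) (εt : ℝ) {b : ℝ} (hε : εt ≤ b)
    (hb : p.rate ≤ b) : p.accuracy εt ≤ b :=
  foldr_max_le hε fun _ hx => (ha.le_rate hx).trans hb

theorem one_le_logFactor (εt : ℝ) : 1 ≤ p.logFactor εt := le_max_left _ _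

/-- Substituting η ≤ Λ/(μKR) turns each source into a power of Λ times κ' times a summand of the
rate. The largest power is 7 = 3 + 4, from the weight Λ³ and from η⁴; the constant is 8 + 8 + 16 +
1024 + 1024 + 2048. -/
theorem Params.Admissible.consensusSource_le (ha : p.Admissible) {η Λ : ℝ} (hη : 0 < η)
    (hΛ : 1 ≤ Λ) (hT : η * p.μ * p.K * p.R ≤ Λ) :
    consensusSource p η Λ ≤ 4128 * Λ ^ 7 * p.rate := by
  have hμ := ha.μ_pos
  have hB := ha.B_pos
  have hΛ0 : 0 < Λ := by linarith
  have hK : (0 : ℝ) < p.K := by exact_mod_cast ha.K_pos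
  have hR : (0 : ℝ) < p.R := by exact_mod_cast ha.R_pos
  have hK1 : (1 : ℝ) ≤ p.K := by exact_mod_cast ha.K_pos
  have hR1 : (1 : ℝ) ≤ p.R := by exact_mod_cast ha.R_pos
  have hκ := ha.two_le_κ'
  have hκ0 : 0 < p.κ' := by linarith
  have hlog : 0 ≤ Real.log p.K := Real.log_natCast_nonneg _
  have hS := ha.rate_nonneg
  have hηK : p.K * η ≤ Λ / (p.μ * p.R) := by
    rw [le_div_iff₀ (by positivity)]; linarith
  have hη' : η ≤ Λ / (p.μ * p.K * p.R) := by
    rw [le_div_iff₀ (by positivity)]; linarith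
  have hΛ37 : Λ ^ 3 ≤ Λ ^ 7 := pow_le_pow_right₀ hΛ (by norm_num)
  have hτ := ha.τ_sq_div_le
  have s3 := ha.le_rate (x := p.κ' * (p.τ ^ 2 * p.φ ^ 2 / (p.μ ^ 2 * p.R ^ 2)))
    (by simp [Params.rateTerms])
  have s6 := ha.le_rate (x := p.κ' * (p.τ ^ 4 * p.φ ^ 4 / (p.μ ^ 4 * p.B ^ 2 * p.R ^ 4)))
    (by simp [Params.rateTerms])
  have s7 := ha.le_rate (x := p.κ' * (p.H ^ 2 * p.ζ ^ 2 / (p.μ ^ 2 * p.R ^ 2)))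
    (by simp [Params.rateTerms])
  have s9 := ha.le_rate (x := p.κ' * (p.σ₂ ^ 2 * Real.log p.K / (p.μ ^ 2 * p.K * p.R ^ 2)))
    (by simp [Params.rateTerms])
  have s10 := ha.le_rate (x := p.κ' * (p.H ^ 4 * p.ζ ^ 4 / (p.μ ^ 4 * p.R ^ 3 * p.B ^ 2)))
    (by simp [Params.rateTerms])
  have s14 := ha.le_rate
    (x := p.κ' * (p.σ₄ ^ 4 * Real.log p.K / (p.μ ^ 4 * p.K * p.B ^ 2 * p.R ^ 4)))
    (by simp [Params.rateTerms])
  have a1 : (p.K * η) ^ 2 * (p.H ^ 2 * p.ζ ^ 2 + p.τ ^ 2 * p.φ ^ 2) ≤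
      (Λ / (p.μ * p.R)) ^ 2 * (p.H ^ 2 * p.ζ ^ 2 + p.τ ^ 2 * p.φ ^ 2) := by gcongr
  have a2 : p.K * η ^ 2 * p.σ₂ ^ 2 ≤ p.K * (Λ / (p.μ * p.K * p.R)) ^ 2 * p.σ₂ ^ 2 := by gcongr
  have a3 : (p.K * η) ^ 4 * (p.H ^ 4 * p.ζ ^ 4 + p.τ ^ 4 * p.φ ^ 4) ≤
      (Λ / (p.μ * p.R)) ^ 4 * (p.H ^ 4 * p.ζ ^ 4 + p.τ ^ 4 * p.φ ^ 4) := by gcongr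
  have a4 : p.K ^ 2 * η ^ 4 * p.σ₄ ^ 4 ≤ p.K ^ 2 * (Λ / (p.μ * p.K * p.R)) ^ 4 * p.σ₄ ^ 4 := by
    gcongr
  have b10 : p.H ^ 4 * p.ζ ^ 4 / (p.μ ^ 4 * p.R ^ 4 * p.B ^ 2) ≤
      p.H ^ 4 * p.ζ ^ 4 / (p.μ ^ 4 * p.R ^ 3 * p.B ^ 2) := by
    have : (p.R : ℝ) ^ 3 ≤ p.R ^ 4 := pow_le_pow_right₀ hR1 (by norm_num)
    gcongr
  have b14 : p.σ₄ ^ 4 * Real.log p.K / (p.μ ^ 4 * p.K ^ 2 * p.B ^ 2 * p.R ^ 4) ≤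
      p.σ₄ ^ 4 * Real.log p.K / (p.μ ^ 4 * p.K * p.B ^ 2 * p.R ^ 4) := by
    gcongr
    exact le_self_pow₀ hK1 (by norm_num)
  have c10 := (mul_le_mul_of_nonneg_left b10 hκ0.le).trans s10
  have c14 := (mul_le_mul_of_nonneg_left b14 hκ0.le).trans s14
  calc consensusSource p η Λ
      ≤ 8 * Λ * p.κ' * ((Λ / (p.μ * p.R)) ^ 2 * (p.H ^ 2 * p.ζ ^ 2 + p.τ ^ 2 * p.φ ^ 2) +
          2 * Real.log p.K * (p.K * (Λ / (p.μ * p.K * p.R)) ^ 2 * p.σ₂ ^ 2)) +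
        1024 * Λ ^ 3 * (p.κ' / p.B ^ 2) *
          ((Λ / (p.μ * p.R)) ^ 4 * (p.H ^ 4 * p.ζ ^ 4 + p.τ ^ 4 * p.φ ^ 4) +
          2 * Real.log p.K * (p.K ^ 2 * (Λ / (p.μ * p.K * p.R)) ^ 4 * p.σ₄ ^ 4)) := by
        unfold consensusSource; gcongr
    _ = 8 * Λ ^ 3 * (p.κ' * (p.H ^ 2 * p.ζ ^ 2 / (p.μ ^ 2 * p.R ^ 2))) +
        8 * Λ ^ 3 * (p.κ' * (p.τ ^ 2 * p.φ ^ 2 / (p.μ ^ 2 * p.R ^ 2))) +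
        16 * Λ ^ 3 * (p.κ' * (p.σ₂ ^ 2 * Real.log p.K / (p.μ ^ 2 * p.K * p.R ^ 2))) +
        1024 * Λ ^ 7 * (p.κ' * (p.H ^ 4 * p.ζ ^ 4 / (p.μ ^ 4 * p.R ^ 4 * p.B ^ 2))) +
        1024 * Λ ^ 7 * (p.κ' * (p.τ ^ 4 * p.φ ^ 4 / (p.μ ^ 4 * p.B ^ 2 * p.R ^ 4))) +
        2048 * Λ ^ 7 *
          (p.κ' * (p.σ₄ ^ 4 * Real.log p.K / (p.μ ^ 4 * p.K ^ 2 * p.B ^ 2 * p.R ^ 4))) := by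
        field_simp; ring
    _ ≤ 8 * Λ ^ 7 * p.rate + 8 * Λ ^ 7 * p.rate + 16 * Λ ^ 7 * p.rate + 1024 * Λ ^ 7 * p.rate +
        1024 * Λ ^ 7 * p.rate + 2048 * Λ ^ 7 * p.rate := by gcongr
    _ = _ := by ring

/-- The noise in the fourth moment produces s₁²/B², with s₁ the first summand of the rate; the
assumption s₁ ≤ B² brings this back to s₁. The constant is 1 + 16 + 8 + 3. -/
theorem Params.Admissible.noiseSource_le (ha : p.Admissible) {η Λ : ℝ} (hη : 0 < η)
    (hΛ : 1 ≤ Λ) (hT : η * p.μ * p.K * p.R ≤ Λ)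
    (hs : p.σ₂ ^ 2 / (p.μ ^ 2 * p.M * p.K * p.R) ≤ p.B ^ 2) :
    p.K * p.R * noiseSource p η Λ ≤ 28 * Λ ^ 4 * p.rate := by
  have hμ := ha.μ_pos
  have hB := ha.B_pos
  have hΛ0 : 0 < Λ := by linarith
  have hK : (0 : ℝ) < p.K := by exact_mod_cast ha.K_pos
  have hR : (0 : ℝ) < p.R := by exact_mod_cast ha.R_pos
  have hM : (0 : ℝ) < p.M := by exact_mod_cast ha.M_pos
  have hK1 : (1 : ℝ) ≤ p.K := by exact_mod_cast ha.K_pos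
  have hR1 : (1 : ℝ) ≤ p.R := by exact_mod_cast ha.R_pos
  have hM1 : (1 : ℝ) ≤ p.M := by exact_mod_cast ha.M_pos
  have hS := ha.rate_nonneg
  set s₁ := p.σ₂ ^ 2 / (p.μ ^ 2 * p.M * p.K * p.R) with hs₁
  set s₂ := p.σ₄ ^ 4 / (p.μ ^ 4 * p.K ^ 3 * p.R ^ 3 * p.M ^ 2 * p.B ^ 2) with hs₂
  have r1 : s₁ ≤ p.rate := ha.le_rate (by simp [Params.rateTerms, hs₁])
  have r2 : s₂ ≤ p.rate := ha.le_rate (by simp [Params.rateTerms, hs₂])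
  have hs₁0 : 0 ≤ s₁ := by positivity
  have hs₂0 : 0 ≤ s₂ := by positivity
  have hKR1 : (1 : ℝ) ≤ p.K * p.R := one_le_mul_of_one_le_of_one_le hK1 hR1
  have hq : s₁ ^ 2 / p.B ^ 2 ≤ s₁ := by
    rw [div_le_iff₀ (by positivity), sq]
    exact mul_le_mul_of_nonneg_left hs hs₁0
  set e := η * p.μ * p.K * p.R with he
  have he0 : 0 ≤ e := by positivity
  have hΛ24 : Λ ^ 2 ≤ Λ ^ 4 := pow_le_pow_right₀ hΛ (by norm_num)
  have v1 : p.K * p.R * (η ^ 2 * p.σ₂ ^ 2 / p.M) = e ^ 2 * s₁ := by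
    rw [he, hs₁]; field_simp
  have v2 : p.K * p.R * (16 / (η * p.μ / Λ) * (η ^ 2 * p.σ₂ ^ 2 / p.M) ^ 2) / p.B ^ 2 =
      16 * Λ * e ^ 3 * (s₁ ^ 2 / p.B ^ 2) := by
    rw [he, hs₁]; field_simp
  have v3 : p.K * p.R * (8 * (η ^ 2 * p.σ₂ ^ 2 / p.M) ^ 2) / p.B ^ 2 * (p.K * p.R) =
      8 * e ^ 4 * (s₁ ^ 2 / p.B ^ 2) := by
    rw [he, hs₁]; field_simp
  have v4 : p.K * p.R * (3 * (η ^ 4 * p.σ₄ ^ 4 / p.M ^ 3)) / p.B ^ 2 * p.M = 3 * e ^ 4 * s₂ := by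
    rw [he, hs₂]; field_simp
  have w3 : p.K * p.R * (8 * (η ^ 2 * p.σ₂ ^ 2 / p.M) ^ 2) / p.B ^ 2 ≤
      8 * e ^ 4 * (s₁ ^ 2 / p.B ^ 2) :=
    (le_mul_of_one_le_right (by positivity) hKR1).trans_eq v3
  have w4 : p.K * p.R * (3 * (η ^ 4 * p.σ₄ ^ 4 / p.M ^ 3)) / p.B ^ 2 ≤ 3 * e ^ 4 * s₂ :=
    (le_mul_of_one_le_right (by positivity) hM1).trans_eq v4
  have y : 16 * Λ * e ^ 3 * (s₁ ^ 2 / p.B ^ 2) ≤ 16 * Λ * Λ ^ 3 * p.rate := by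
    have := hq.trans r1
    gcongr
  calc p.K * p.R * noiseSource p η Λ = p.K * p.R * (η ^ 2 * p.σ₂ ^ 2 / p.M) +
        p.K * p.R * (16 / (η * p.μ / Λ) * (η ^ 2 * p.σ₂ ^ 2 / p.M) ^ 2) / p.B ^ 2 +
        p.K * p.R * (8 * (η ^ 2 * p.σ₂ ^ 2 / p.M) ^ 2) / p.B ^ 2 +
        p.K * p.R * (3 * (η ^ 4 * p.σ₄ ^ 4 / p.M ^ 3)) / p.B ^ 2 := by
        unfold noiseSource; ring
    _ ≤ e ^ 2 * s₁ + 16 * Λ * e ^ 3 * (s₁ ^ 2 / p.B ^ 2) + 8 * e ^ 4 * (s₁ ^ 2 / p.B ^ 2) +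
        3 * e ^ 4 * s₂ := by rw [v1, v2]; gcongr
    _ ≤ Λ ^ 4 * p.rate + 16 * Λ * Λ ^ 3 * p.rate + 8 * Λ ^ 4 * p.rate + 3 * Λ ^ 4 * p.rate := by
        have h2 : e ^ 2 ≤ Λ ^ 4 := (pow_le_pow_left₀ he0 hT 2).trans hΛ24
        have h3 := hq.trans r1
        gcongr
    _ = _ := by ring

/-- This is where the lower bound on R is used: Kη ≤ Λ/(μR), so the square root of the left-hand
side is at most τ√κ' Λ²/(μR). -/
theorem Params.Admissible.coupling_le (ha : p.Admissible) {η Λ : ℝ} (hη : 0 < η)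
    (hΛ : 1 ≤ Λ) (hT : η * p.μ * p.K * p.R ≤ Λ)
    (hR : p.τ * Real.sqrt p.κ' / p.μ * Λ ^ 2 ≤ p.R) :
    p.κ' * (p.K * η * p.τ) ^ 2 * Λ ^ 2 ≤ 1 := by
  have hμ := ha.μ_pos
  have hΛ0 : 0 < Λ := by linarith
  have hK0 : (0 : ℝ) < p.K := by exact_mod_cast ha.K_pos
  have hR0 : (0 : ℝ) < p.R := by exact_mod_cast ha.R_pos
  have hτ := ha.τ_nonneg
  have hκ : 0 ≤ p.κ' := by linarith [ha.two_le_κ']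
  have hηK : p.K * η ≤ Λ / (p.μ * p.R) := by
    rw [le_div_iff₀ (by positivity)]; linarith
  have h1 : Real.sqrt p.κ' * (p.K * η * p.τ) * Λ ≤ 1 := by
    calc _ ≤ Real.sqrt p.κ' * (Λ / (p.μ * p.R) * p.τ) * Λ := by gcongr
      _ = p.τ * Real.sqrt p.κ' / p.μ * Λ ^ 2 / p.R := by field_simp
      _ ≤ 1 := (div_le_one hR0).2 hR
  have h2 : p.κ' * (p.K * η * p.τ) ^ 2 * Λ ^ 2 = (Real.sqrt p.κ' * (p.K * η * p.τ) * Λ) ^ 2 := by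
    rw [mul_pow _ Λ, mul_pow (Real.sqrt _), Real.sq_sqrt hκ]
  rw [h2]
  exact pow_le_one₀ (by positivity) h1

/-- Every source term carries at least η², even the one divided by η, so a linear bound holds for η
≤ 1 and a small step makes the sources as small as desired. -/
theorem Params.Admissible.sources_le_of_small (ha : p.Admissible) {η : ℝ} (hη : 0 < η)
    (hη1 : η ≤ 1) :
    consensusSource p η 1 ≤ η * consensusSource p 1 1 ∧
      noiseSource p η 1 ≤ η * noiseSource p 1 1 := by
  have hμ := ha.μ_pos
  have hB := ha.B_pos
  have hκ : 0 ≤ p.κ' := by linarith [ha.two_le_κ']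
  have hlog : 0 ≤ Real.log p.K := Real.log_natCast_nonneg _
  have h2 : η ^ 2 ≤ η := pow_le_of_le_one hη.le hη1 (by norm_num)
  have h3 : η ^ 3 ≤ η := pow_le_of_le_one hη.le hη1 (by norm_num)
  have h4 : η ^ 4 ≤ η := pow_le_of_le_one hη.le hη1 (by norm_num)
  constructor
  · calc consensusSource p η 1
        = η ^ 2 * (8 * (p.τ ^ 2 / p.μ ^ 2) * (p.K ^ 2 * (p.H ^ 2 * p.ζ ^ 2 + p.τ ^ 2 * p.φ ^ 2) +
            2 * Real.log p.K * (p.K * p.σ₂ ^ 2))) +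
          η ^ 4 * (1024 * (p.κ' / p.B ^ 2) *
            (p.K ^ 4 * (p.H ^ 4 * p.ζ ^ 4 + p.τ ^ 4 * p.φ ^ 4) +
            2 * Real.log p.K * (p.K ^ 2 * p.σ₄ ^ 4))) := by unfold consensusSource; ring
      _ ≤ η * (8 * (p.τ ^ 2 / p.μ ^ 2) * (p.K ^ 2 * (p.H ^ 2 * p.ζ ^ 2 + p.τ ^ 2 * p.φ ^ 2) +
            2 * Real.log p.K * (p.K * p.σ₂ ^ 2))) +
          η * (1024 * (p.κ' / p.B ^ 2) *
            (p.K ^ 4 * (p.H ^ 4 * p.ζ ^ 4 + p.τ ^ 4 * p.φ ^ 4) +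
            2 * Real.log p.K * (p.K ^ 2 * p.σ₄ ^ 4))) := by gcongr
      _ = _ := by unfold consensusSource; ring
  · set V := p.σ₂ ^ 2 / p.M with hV
    set W := p.σ₄ ^ 4 / p.M ^ 3 with hW
    have hV0 : 0 ≤ V := by positivity
    have hW0 : 0 ≤ W := by positivity
    calc noiseSource p η 1
        = η ^ 2 * V + (16 / p.μ * (η ^ 3 * V ^ 2) + 8 * (η ^ 4 * V ^ 2) + 3 * (η ^ 4 * W)) /
          p.B ^ 2 := by
          unfold noiseSource; rw [hV, hW]; field_simp
      _ ≤ η * V + (16 / p.μ * (η * V ^ 2) + 8 * (η * V ^ 2) + 3 * (η * W)) / p.B ^ 2 := by gcongr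
      _ = _ := by unfold noiseSource; rw [hV, hW]; field_simp

end Tuning

/-! ### Choice of the step size and the final bounds. -/

section StepSize

variable {p : Params}

/-- The absolute constant of the general bound on the error. -/
def growthConst : ℝ := Real.exp (15 + 256 * Real.exp 1040)

/-- The absolute constant of the rate. -/
def rateConst : ℝ := growthConst * (30 + 264192 * Real.exp 1040)

theorem growthConst_pos : 0 < growthConst := Real.exp_pos _

theorem rateConst_pos : 0 < rateConst :=
  mul_pos growthConst_pos (by positivity)

theorem growthConst_le : 30 * growthConst ≤ rateConst := by
  have h := mul_pos growthConst_pos (Real.exp_pos 1040)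
  unfold rateConst; linarith

theorem Params.Admissible.accuracy_pos {εt : ℝ} (hε : 0 < εt) : 0 < p.accuracy εt :=
  hε.trans_le (base_le_foldr_max _ _)

/-- The condition B² > eε makes the logarithm exceed 1, so it is positive and equals Λ; the minimum
is then either the cap 1/(2H) or the exact logarithmic value. -/
theorem Params.Admissible.tunedStep_spec (ha : p.Admissible) {εt : ℝ} (hε : 0 < εt)
    (hB : Real.exp 1 * p.accuracy εt < p.B ^ 2) :
    0 < p.tunedStep εt ∧ p.tunedStep εt * p.μ * p.K * p.R ≤ p.logFactor εt ∧
      (p.tunedStep εt = 1 / (2 * p.H) ∨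
        p.tunedStep εt * p.μ * p.K * p.R = Real.log (p.B ^ 2 / p.accuracy εt)) := by
  have hμ := ha.μ_pos
  have hH := ha.H_pos
  have hK0 : (0 : ℝ) < p.K := by exact_mod_cast ha.K_pos
  have hR0 : (0 : ℝ) < p.R := by exact_mod_cast ha.R_pos
  have hacc := Params.Admissible.accuracy_pos (p := p) hε
  have hlog : 1 < Real.log (p.B ^ 2 / p.accuracy εt) := by
    rw [Real.lt_log_iff_exp_lt (div_pos (by have := ha.B_pos; positivity) hacc), lt_div_iff₀ hacc]
    exact hB
  have hL : p.logFactor εt = Real.log (p.B ^ 2 / p.accuracy εt) := max_eq_right hlog.le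
  have e : 1 / (p.μ * p.K * p.R) * Real.log (p.B ^ 2 / p.accuracy εt) * p.μ * p.K * p.R =
      Real.log (p.B ^ 2 / p.accuracy εt) := by field_simp
  refine ⟨lt_min (by positivity) (mul_pos (by positivity) (by linarith)), ?_, ?_⟩
  · rw [hL]
    refine le_of_le_of_eq ?_ e
    have : p.tunedStep εt ≤ 1 / (p.μ * p.K * p.R) * Real.log (p.B ^ 2 / p.accuracy εt) :=
      min_le_right _ _
    gcongr
  · rcases min_choice (1 / (2 * p.H))
      (1 / (p.μ * p.K * p.R) * Real.log (p.B ^ 2 / p.accuracy εt)) with h | h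
    · exact Or.inl h
    · refine Or.inr ?_
      rw [Params.tunedStep, h, e]

/-- A step size so small that the error stays of the order of its initial value. -/
def tinyStep (p : Params) : ℝ :=
  min (min 1 (1 / (2 * p.H))) (min (1 / (p.μ * p.K * p.R))
    (p.B ^ 2 / (64 * Real.exp 1040 * consensusSource p 1 1 +
      p.K * p.R * noiseSource p 1 1 + 1)))

theorem Params.Admissible.tinyStep_spec (ha : p.Admissible) :
    0 < tinyStep p ∧ tinyStep p ≤ 1 / (2 * p.H) ∧ tinyStep p * p.μ * p.K * p.R ≤ 1 ∧
      64 * Real.exp 1040 * consensusSource p (tinyStep p) 1 +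
        p.K * p.R * noiseSource p (tinyStep p) 1 ≤ p.B ^ 2 := by
  have hμ := ha.μ_pos
  have hH := ha.H_pos
  have hB := ha.B_pos
  have hK0 : (0 : ℝ) < p.K := by exact_mod_cast ha.K_pos
  have hR0 : (0 : ℝ) < p.R := by exact_mod_cast ha.R_pos
  have g0 := ha.consensusSource_nonneg (η := 1) zero_le_one
  have n0 := ha.noiseSource_nonneg (η := 1) zero_le_one zero_le_one
  set D := 64 * Real.exp 1040 * consensusSource p 1 1 + p.K * p.R * noiseSource p 1 1 + 1 with hD
  have hD0 : 0 < D := by positivity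
  have h0 : 0 < tinyStep p :=
    lt_min (lt_min one_pos (by positivity)) (lt_min (by positivity) (by positivity))
  have h1 : tinyStep p ≤ 1 := (min_le_left _ _).trans (min_le_left _ _)
  have h2 : tinyStep p ≤ 1 / (2 * p.H) := (min_le_left _ _).trans (min_le_right _ _)
  have h3 : tinyStep p ≤ 1 / (p.μ * p.K * p.R) := (min_le_right _ _).trans (min_le_left _ _)
  have h4 : tinyStep p ≤ p.B ^ 2 / D := (min_le_right _ _).trans (min_le_right _ _)
  obtain ⟨k1, k2⟩ := ha.sources_le_of_small h0 h1
  refine ⟨h0, h2, ?_, ?_⟩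
  · rw [le_div_iff₀ (by positivity)] at h3
    linarith
  · rw [le_div_iff₀ hD0] at h4
    calc _ ≤ 64 * Real.exp 1040 * (tinyStep p * consensusSource p 1 1) +
          p.K * p.R * (tinyStep p * noiseSource p 1 1) := by gcongr
      _ ≤ tinyStep p * D := by rw [hD]; linarith
      _ ≤ _ := h4

variable {d : ℕ} {Z : Type*} [MeasurableSpace Z] {P : Problem d p.M Z} {xs : Space d}
  {Ω : Type*} [MeasurableSpace Ω] {Pr : Measure Ω} [IsProbabilityMeasure Pr]
  {z : ℕ → Fin p.M → Ω → Z}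

theorem totalError_tunedStep_le (ha : p.Admissible) {εt : ℝ} (hε : 0 < εt)
    (hR : p.τ * Real.sqrt p.κ' / p.μ * p.logFactor εt ^ 2 ≤ (p.R : ℝ))
    (hB : Real.exp 1 * p.accuracy εt < p.B ^ 2) (h : InClass p P xs) (hz : IsSampling Pr P.D z)
    (hμH : p.μ ≤ p.H) :
    totalError p P xs (p.tunedStep εt) Pr z ≤ rateConst * p.logFactor εt ^ 8 *
      (Real.exp (-(2 * (p.tunedStep εt * p.μ * p.K * p.R))) * p.B ^ 2 + p.rate) := by
  obtain ⟨h0, hT, -⟩ := ha.tunedStep_spec hε hB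
  have hΛ := one_le_logFactor (p := p) εt
  set η := p.tunedStep εt
  set Λ := p.logFactor εt
  have hacc := Params.Admissible.accuracy_pos (p := p) hε
  -- The accuracy ε dominates every summand of the rate, and ε < B² in this regime.
  have hs1 : p.σ₂ ^ 2 / (p.μ ^ 2 * p.M * p.K * p.R) ≤ p.B ^ 2 := by
    have h1 : p.σ₂ ^ 2 / (p.μ ^ 2 * p.M * p.K * p.R) ≤ p.accuracy εt :=
      le_foldr_max (by simp [Params.rateTerms])
    have h2 : 1 * p.accuracy εt ≤ Real.exp 1 * p.accuracy εt := by
      gcongr; exact Real.one_le_exp zero_le_one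
    linarith
  have hG := ha.consensusSource_le h0 hΛ hT
  have hN := ha.noiseSource_le h0 hΛ hT hs1
  have hS := ha.rate_nonneg
  have hΛ0 : 0 < Λ := by linarith
  have hΛ8 : 1 ≤ Λ ^ 8 := one_le_pow₀ hΛ
  have hΛ48 : Λ ^ 4 ≤ Λ ^ 8 := pow_le_pow_right₀ hΛ (by norm_num)
  set D := Real.exp (-(2 * (η * p.μ * p.K * p.R))) * p.B ^ 2 with hD
  have hD0 : 0 ≤ D := by positivity
  have hmain := totalError_le ha h hz hμH h0 (min_le_left _ _) hΛ hT
    (ha.coupling_le h0 hΛ hT hR)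
  refine hmain.trans ((mul_le_mul_of_nonneg_left
    (c := (30 + 264192 * Real.exp 1040) * (Λ ^ 8 * (D + p.rate))) ?_ growthConst_pos.le).trans_eq
      (by rw [rateConst]; ring))
  have hE := Real.exp_pos 1040
  set c := Real.exp 1040
  calc _ ≤ 2 * (1 * D) + 64 * c * (Λ * (4128 * Λ ^ 7 * p.rate)) + 28 * Λ ^ 4 * p.rate := by
        rw [hD, show Real.exp (-(2 * (η * p.μ * p.K * p.R))) * (2 * p.B ^ 2) =
          2 * (1 * (Real.exp (-(2 * (η * p.μ * p.K * p.R))) * p.B ^ 2)) by ring]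
        gcongr
    _ ≤ 2 * (Λ ^ 8 * D) + 64 * c * (Λ * (4128 * Λ ^ 7 * p.rate)) + 28 * Λ ^ 8 * p.rate := by
        gcongr
    -- 264192 = 64 · 4128, and the exponent is 8 = 1 + 7.
    _ = (2 * (Λ ^ 8 * D)) + (264192 * c + 28) * (Λ ^ 8 * p.rate) := by ring
    _ ≤ (30 + 264192 * c) * (Λ ^ 8 * D) + (30 + 264192 * c) * (Λ ^ 8 * p.rate) := by
        exact add_le_add (mul_le_mul_of_nonneg_right (by linarith) (by positivity))
          (mul_le_mul_of_nonneg_right (by linarith) (by positivity))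
    _ = _ := by ring

/-- The general bound is applied with Λ = 1 whatever the actual logarithmic factor: 2B² comes from
the initial error and B² from the sources. -/
theorem totalError_tinyStep_le (ha : p.Admissible)
    (hR : p.τ * Real.sqrt p.κ' / p.μ ≤ (p.R : ℝ)) (h : InClass p P xs)
    (hz : IsSampling Pr P.D z) (hμH : p.μ ≤ p.H) :
    totalError p P xs (tinyStep p) Pr z ≤ 3 * growthConst * p.B ^ 2 := by
  obtain ⟨h0, h1, hT, hs⟩ := ha.tinyStep_spec
  have hmain := totalError_le ha h hz hμH h0 h1 le_rfl hT
    (ha.coupling_le h0 le_rfl hT (by simpa using hR))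
  have hμ := ha.μ_pos
  have he : Real.exp (-(2 * (tinyStep p * p.μ * p.K * p.R))) ≤ 1 :=
    Real.exp_le_one_iff.2 (by have : 0 ≤ tinyStep p * p.μ * p.K * p.R := by positivity
                              linarith)
  refine hmain.trans ((mul_le_mul_of_nonneg_left (c := 3 * p.B ^ 2) ?_
    growthConst_pos.le).trans_eq (by ring))
  have : Real.exp (-(2 * (tinyStep p * p.μ * p.K * p.R))) * (2 * p.B ^ 2) ≤ 1 * (2 * p.B ^ 2) := by
    gcongr
  linarith

/-- The target accuracy up to a constant factor. -/
theorem Params.Admissible.accuracy_le_bound (ha : p.Admissible) {εt b : ℝ} (hb : 0 ≤ b)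
    (hε : εt ≤ b + p.rate) : p.accuracy εt ≤ b + p.rate :=
  ha.accuracy_le εt hε (by linarith)

/-- The claims on the final error of Local SGD with a given step size. -/
def FinalBounds (p : Params) (εt : ℝ) (P : Problem d p.M Z) (xs : Space d) (η : ℝ)
    (Pr : Measure Ω) (z : ℕ → Fin p.M → Ω → Z) : Prop :=
  MemLp (finalError p P xs η z) 4 Pr ∧
    totalError p P xs η Pr z ≤ 3 * rateConst * p.logFactor εt ^ 8 *
      (Real.exp (-(η * p.μ * p.K * p.R)) * p.B ^ 2 + p.rate) ∧
    (εt ≤ Real.exp (-(p.K * p.R / p.κ)) * p.B ^ 2 + p.rate →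
      totalError p P xs η Pr z ≤ 3 * rateConst * p.logFactor εt ^ 8 *
        (Real.exp (-(p.K * p.R / p.κ)) * p.B ^ 2 + p.rate))

/-- In dimension zero μ ≤ H may fail, but the error is identically zero. -/
theorem finalBounds_of_subsingleton [Subsingleton (Space d)] (ha : p.Admissible) (εt η : ℝ) :
    FinalBounds p εt P xs η Pr z := by
  have h0 : finalError p P xs η z = fun _ => 0 := by ext1 ω; exact Subsingleton.elim _ _
  have h1 : totalError p P xs η Pr z = 0 := by simp [totalError, h0]
  have hS := ha.rate_nonneg
  have hC := rateConst_pos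
  have hΛ : 0 ≤ p.logFactor εt := zero_le_one.trans (one_le_logFactor εt)
  refine ⟨by rw [h0]; exact memLp_const 0, by rw [h1]; positivity, fun _ => by
    rw [h1]; positivity⟩

theorem finalBounds_tunedStep (ha : p.Admissible) {εt : ℝ} (hε : 0 < εt)
    (hR : p.τ * Real.sqrt p.κ' / p.μ * p.logFactor εt ^ 2 ≤ (p.R : ℝ))
    (hB : Real.exp 1 * p.accuracy εt < p.B ^ 2) (h : InClass p P xs) (hz : IsSampling Pr P.D z)
    (hμH : p.μ ≤ p.H) : FinalBounds p εt P xs (p.tunedStep εt) Pr z := by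
  obtain ⟨h0, -, hcase⟩ := ha.tunedStep_spec hε hB
  have hmain := totalError_tunedStep_le ha hε hR hB h hz hμH
  have hS := ha.rate_nonneg
  have hC := rateConst_pos
  have hμ := ha.μ_pos
  have hB0 := ha.B_pos
  have hH := ha.H_pos
  have hΛ : 0 < p.logFactor εt := zero_lt_one.trans_le (one_le_logFactor εt)
  have hacc := Params.Admissible.accuracy_pos (p := p) hε
  set e := p.tunedStep εt * p.μ * p.K * p.R with he
  have he0 : 0 ≤ e := by positivity
  have hexp : Real.exp (-(2 * e)) ≤ Real.exp (-e) := Real.exp_le_exp.2 (by linarith)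
  have hlift : ∀ b, 0 ≤ b → Real.exp (-(2 * e)) * p.B ^ 2 ≤ b + p.rate →
      totalError p P xs (p.tunedStep εt) Pr z ≤
        3 * rateConst * p.logFactor εt ^ 8 * (b + p.rate) := fun b hb hle => by
    calc _ ≤ _ := hmain
      _ ≤ rateConst * p.logFactor εt ^ 8 * (3 * (b + p.rate)) := by gcongr; linarith
      _ = _ := by ring
  refine ⟨memLp_finalError ha h hz hμH h0 (min_le_left _ _), ?_, fun hεt => ?_⟩
  · refine hlift _ (by positivity) ?_
    have := mul_le_mul_of_nonneg_right hexp (sq_nonneg p.B)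
    linarith
  · refine hlift _ (by positivity) ?_
    -- At the cap η = 1/(2H), the decay 2ημKR of the squared error is exactly KR/κ. Otherwise
    -- exp(-ημKR)B² equals ε, which is at most the target bound.
    rcases hcase with hc | hc
    · have : 2 * e = p.K * p.R / p.κ := by
        rw [he, hc, Params.κ]; field_simp
      rw [this]; linarith
    · have h1 : Real.exp (-e) * p.B ^ 2 = p.accuracy εt := by
        rw [hc, Real.exp_neg, Real.exp_log (by positivity)]
        field_simp
      have h2 := mul_le_mul_of_nonneg_right hexp (sq_nonneg p.B)
      exact (h2.trans_eq h1).trans (ha.accuracy_le_bound (by positivity) hεt)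

theorem finalBounds_tinyStep (ha : p.Admissible) {εt : ℝ}
    (hR : p.τ * Real.sqrt p.κ' / p.μ * p.logFactor εt ^ 2 ≤ (p.R : ℝ))
    (hB : p.B ^ 2 ≤ Real.exp 1 * p.accuracy εt) (h : InClass p P xs) (hz : IsSampling Pr P.D z)
    (hμH : p.μ ≤ p.H) : FinalBounds p εt P xs (tinyStep p) Pr z := by
  obtain ⟨h0, h1, hT, -⟩ := ha.tinyStep_spec
  have hS := ha.rate_nonneg
  have hC := rateConst_pos
  have hG := growthConst_pos
  have hμ := ha.μ_pos
  have hτ := ha.τ_nonneg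
  have hΛ := one_le_logFactor (p := p) εt
  have hR1 : p.τ * Real.sqrt p.κ' / p.μ ≤ (p.R : ℝ) :=
    (le_mul_of_one_le_right (by positivity) (one_le_pow₀ hΛ)).trans hR
  have hmain := totalError_tinyStep_le ha hR1 h hz hμH
  have he3 : Real.exp 1 ≤ 3 := by linarith [Real.exp_one_lt_d9]
  -- Both target brackets are at least B²/3: the first because ημKR ≤ 1, the second because B² ≤ eε
  -- and ε is at most that bracket.
  have hlift : ∀ b, p.B ^ 2 ≤ 3 * b → totalError p P xs (tinyStep p) Pr z ≤
      3 * rateConst * p.logFactor εt ^ 8 * b := fun b hb => by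
    have hb0 : 0 ≤ b := by linarith [sq_nonneg p.B]
    have hk := growthConst_le
    calc _ ≤ 3 * growthConst * p.B ^ 2 := hmain
      _ ≤ 3 * growthConst * (3 * b) := by gcongr
      _ ≤ 3 * rateConst * b := by nlinarith [mul_nonneg hG.le hb0, mul_le_mul_of_nonneg_right hk hb0]
      _ = 3 * rateConst * 1 * b := by ring
      _ ≤ _ := by
        have := one_le_pow₀ hΛ (n := 8)
        gcongr
  refine ⟨memLp_finalError ha h hz hμH h0 h1, hlift _ ?_, fun hεt => hlift _ ?_⟩
  · set e := tinyStep p * p.μ * p.K * p.R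
    have h2 : 1 ≤ 3 * Real.exp (-e) := by
      have h3 : Real.exp (-1) ≤ Real.exp (-e) := Real.exp_le_exp.2 (by linarith)
      have h4 : Real.exp 1 * Real.exp (-1) = 1 := by rw [← Real.exp_add]; simp
      nlinarith [Real.exp_pos (-1)]
    nlinarith [sq_nonneg p.B]
  · have h5 := ha.accuracy_le_bound
      (b := Real.exp (-(p.K * p.R / p.κ)) * p.B ^ 2) (by positivity) hεt
    calc p.B ^ 2 ≤ Real.exp 1 * p.accuracy εt := hB
      _ ≤ Real.exp 1 * (Real.exp (-(p.K * p.R / p.κ)) * p.B ^ 2 + p.rate) := by gcongr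
      _ ≤ _ := by gcongr

theorem mu_le_of_inClass [Nontrivial (Space d)] (ha : p.Admissible) (h : InClass p P xs) :
    p.μ ≤ p.H :=
  strongly_convex_mu_le (h.strongly_convex ⟨0, ha.M_pos⟩).1 (h.smooth_second ⟨0, ha.M_pos⟩).2
    (h.strongly_convex ⟨0, ha.M_pos⟩).2

end StepSize

end LocalSGD

end

open LocalSGD in
theorem mainTheorem5 :
    ∃ (C : ℝ) (q : ℕ), 0 < C ∧
      ∀ (p : Params) (εt : ℝ), p.Admissible → 0 < εt →
        p.τ * Real.sqrt p.κ' / p.μ * p.logFactor εt ^ 2 ≤ (p.R : ℝ) →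
        ∃ η : ℝ, 0 < η ∧ η ≤ 1 / (2 * p.H) ∧
          (Real.exp 1 * p.accuracy εt < p.B ^ 2 → η = p.tunedStep εt) ∧
          ∀ (d : ℕ) (Z : Type*) [MeasurableSpace Z] (P : Problem d p.M Z) (xs : Space d)
            (Ω : Type*) [MeasurableSpace Ω] (Pr : MeasureTheory.Measure Ω)
            [MeasureTheory.IsProbabilityMeasure Pr] (z : ℕ → Fin p.M → Ω → Z),
            InClass p P xs → IsSampling Pr P.D z →
            MeasureTheory.MemLp (finalError p P xs η z) 4 Pr ∧
            totalError p P xs η Pr z ≤ C * p.logFactor εt ^ q *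
              (Real.exp (-(η * p.μ * p.K * p.R)) * p.B ^ 2 + p.rate) ∧
            (εt ≤ Real.exp (-(p.K * p.R / p.κ)) * p.B ^ 2 + p.rate →
              totalError p P xs η Pr z ≤ C * p.logFactor εt ^ q *
                (Real.exp (-(p.K * p.R / p.κ)) * p.B ^ 2 + p.rate)) := by
  refine ⟨3 * rateConst, 8, mul_pos three_pos rateConst_pos, fun p εt ha hε hR => ?_⟩
  -- The case depends on the parameters and εt alone, so η is fixed before the problem instance and
  -- its dimension.
  by_cases hB : Real.exp 1 * p.accuracy εt < p.B ^ 2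
  · refine ⟨p.tunedStep εt, (ha.tunedStep_spec hε hB).1, min_le_left _ _, fun _ => rfl,
      fun d Z _ P xs Ω _ Pr _ z h hz => ?_⟩
    rcases subsingleton_or_nontrivial (Space d) with hd | hd
    · exact finalBounds_of_subsingleton ha εt _
    · exact finalBounds_tunedStep ha hε hR hB h hz (mu_le_of_inClass ha h)
  · obtain ⟨h0, h1, -⟩ := ha.tinyStep_spec
    refine ⟨tinyStep p, h0, h1, fun h => absurd h hB, fun d Z _ P xs Ω _ Pr _ z h hz => ?_⟩
    rcases subsingleton_or_nontrivial (Space d) with hd | hd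
    · exact finalBounds_of_subsingleton ha εt _
    · exact finalBounds_tinyStep ha hR (not_lt.1 hB) h hz (mu_le_of_inClass ha h)
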